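/- Let $0<b\le\infty$, $J=\begin{pmatrix}0&-1\\1&0\end{pmatrix}$, and let $q,w$ be $2\times2$ matrices whose entries are distributions of order $0$ (local complex measures) on $(0,b)$, finite near the endpoint $0$, with $q$ Hermitian and $w$ non-negative. For $x\in(0,b)$ and $\lambda\in\mathbb C$ put $\Delta_q(x)=q(\{x\})$, $\Delta_w(x)=w(\{x\})$ and $B_\pm(x,\lambda)=J\pm\frac12(\Delta_q(x)-\lambda\Delta_w(x))$, and let $\Lambda$ be the set of those $\lambda\in\mathbb C$ for which $\det B_+(x,\lambda)\det B_-(x,\lambda)=0$ for some $x\in(0,b)$. For $\lambda\notin\Lambda$ define $$\tau(x,\lambda)=\prod_{y\in(0,x)}\frac{\det B_-(y,\lambda)}{\det B_+(y,\lambda)}\;\exp\Big(2i\int_{(0,x)}\big(\operatorname{Im}(q_{c,12})-\lambda\operatorname{Im}(w_{c,12})\big)\Big),$$ where $q_{c,12}$ and $w_{c,12}$ are the continuous parts of $q_{12}$ and $w_{12}$ (all but countably many factors of the product are $1$). A solution of $Ju'+qu=\lambda wu$ is a function $u:[0,b)\to\mathbb C^2$ of locally bounded variation satisfying the equation as an equality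 of local measures on $(0,b)$, balanced, i.e. $u(x)=\frac12\big(\lim_{t\uparrow x}u(t)+\lim_{t\downarrow x}u(t)\big)$ for $x\in(0,b)$, and with $u(0)=\lim_{t\downarrow0}u(t)$. We write $\|u\|^2=\int_{(0,b)}u^*wu$ and $u\in\mathcal L^2(w)$ if $\|u\|<\infty$. The deficiency index at $\lambda$ is the maximal number of solutions of $Ju'+qu=\lambda wu$ in $\mathcal L^2(w)$ that are linearly independent modulo solutions of norm $0$ (for $\lambda$ in the upper, respectively lower, half-plane this is the number denoted $n_+$, respectively $n_-$). Let $\lambda\in\mathbb C\setminus\mathbb R$ with $\lambda\notin\Lambda$, and suppose that $\tau(\cdot,\lambda)$ is bounded and bounded away from $0$ on $(0,b)$. Then: 1. If $u$ and $v$ are solutions of $Ju'+qu=\lambda wu$ and $Jv'+qv=\overline\lambda wv$, respectively, and $v(0)=\overline{u(0)}$, then $u\in\mathcal L^2(w)$ if and only if $v\in\mathcal L^2(w)$. 2. The deficiency indices at $\lambda$ and at $\overline\lambda$ coincide. -/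

import Mathlib

open scoped ComplexOrder ComplexConjugate

noncomputable section

/-- The half-open interval `[0,b)`, where `0 < b ≤ ∞`. -/
def halfOpen (b : EReal) : Set ℝ := {x : ℝ | 0 ≤ x ∧ (x : EReal) < b}

/-- The open interval `(0,b)`, where `0 < b ≤ ∞`. -/
def openInt (b : EReal) : Set ℝ := {x : ℝ | 0 < x ∧ (x : EReal) < b}

/-- A `2 × 2` matrix of local complex measures (distributions of order `0`) on `(0,b)` which are
finite near the left endpoint `0`, so that `0` is a regular endpoint. Such a local measure need not
be a measure on all of `(0,b)`, but it restricts to a complex measure on `(0,c]` for every `c < b`;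
`restr c i j` is that restriction of the `(i,j)` entry, regarded as a complex measure on `ℝ`
supported in `(0,c]`. The restrictions are compatible with each other. -/
structure LocalMatrixMeasure (b : EReal) where
  /-- The restriction of the `(i,j)` entry to `(0,c]`. -/
  restr : ℝ → Fin 2 → Fin 2 → MeasureTheory.ComplexMeasure ℝ
  compatible : ∀ (c d : ℝ) (i j : Fin 2), c ≤ d → (d : EReal) < b →
    (restr d i j).restrict (Set.Ioc 0 c) = restr c i j

namespace LocalMatrixMeasure

variable {b : EReal}

/-- The value (a `2 × 2` matrix) of the local measure on a Borel set `E ⊆ (0,c]`. -/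
def val (μ : LocalMatrixMeasure b) (c : ℝ) (E : Set ℝ) : Matrix (Fin 2) (Fin 2) ℂ :=
  Matrix.of fun i j => μ.restr c i j E

/-- The local matrix measure is Hermitian. -/
def IsHermitian (μ : LocalMatrixMeasure b) : Prop :=
  ∀ c ∈ openInt b, ∀ E : Set ℝ, MeasurableSet E → (μ.val c E).IsHermitian

/-- The local matrix measure is non-negative (in particular Hermitian). -/
def IsNonneg (μ : LocalMatrixMeasure b) : Prop :=
  ∀ c ∈ openInt b, ∀ E : Set ℝ, MeasurableSet E → (μ.val c E).PosSemidef

/-- The atom `Δ_μ(x) = μ({x})`. -/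
def atom (μ : LocalMatrixMeasure b) (x : ℝ) : Matrix (Fin 2) (Fin 2) ℂ :=
  μ.val x {x}

/-- The integral `∫_E f dμ_{ij}` for `E ⊆ (0,c]`. -/
def integralOn (μ : LocalMatrixMeasure b) (c : ℝ) (E : Set ℝ) (i j : Fin 2) (f : ℝ → ℂ) : ℂ :=
  ((μ.restr c i j).restrict E).integral f (ContinuousLinearMap.mul ℝ ℂ)

/-- `μ_{c,12}((0,x))`, where `μ_{c,12}` is the continuous part of the `(1,2)` entry, i.e. the
entry with its (countably many) atoms removed. -/
def contPart12 (μ : LocalMatrixMeasure b) (x : ℝ) : ℂ :=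
  μ.restr x 0 1 (Set.Ioo 0 x \ {y : ℝ | μ.atom y 0 1 ≠ 0})

/-- `‖u‖_c² = ∫_{(0,c]} u^* w u` for a function `u` that is bounded and measurable on `(0,c]`. -/
def normSqUpTo (w : LocalMatrixMeasure b) (u : ℝ → Fin 2 → ℂ) (c : ℝ) : ℝ :=
  (∑ i, ∑ j, w.integralOn c (Set.Ioc 0 c) i j (fun x => conj (u x i) * u x j)).re

/-- `‖u‖² = ∫_{(0,b)} u^* w u ∈ [0,∞]` for a non-negative `w` and a function `u` of locally bounded
variation on `[0,b)`, as the supremum of the integrals over `(0,c]`, `c < b`. -/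
def normSq (w : LocalMatrixMeasure b) (u : ℝ → Fin 2 → ℂ) : ENNReal :=
  ⨆ c ∈ openInt b, ENNReal.ofReal (w.normSqUpTo u c)

/-- Membership in `𝓛²(w)` of a function of locally bounded variation on `[0,b)`. -/
def MemL2 (w : LocalMatrixMeasure b) (u : ℝ → Fin 2 → ℂ) : Prop :=
  w.normSq u < ⊤

end LocalMatrixMeasure

/-- The matrix `J`. -/
def matJ : Matrix (Fin 2) (Fin 2) ℂ := !![0, -1; 1, 0]

open Classical in
/-- The derivative on `(0,c)` of a function `f` of bounded variation on `[0,c]`: the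
Lebesgue–Stieltjes measure of the function that equals `f` on `[0,c]` and is constant on either
side. It is only used on subsets of `(0,c)`, where the constant continuation plays no role. -/
def stieltjes (f : ℝ → ℂ) (c : ℝ) : MeasureTheory.ComplexMeasure ℝ :=
  if h : BoundedVariationOn (fun x => f (max 0 (min x c))) Set.univ then h.vectorMeasure else 0

variable {b : EReal}

/-- `u` is a balanced solution on `(0,b)` of `J u' + q u = lam w u`, an equality between
(`ℂ²`-valued) local measures. It is of locally bounded variation (up to the regular endpoint `0`),
and its value at `0` is its limit there. The values of `u` outside `[0,b)` play no role. -/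
structure IsSolution (q w : LocalMatrixMeasure b) (lam : ℂ) (u : ℝ → Fin 2 → ℂ) : Prop where
  locallyBoundedVariation : LocallyBoundedVariationOn u (halfOpen b)
  tendsto_zero : Filter.Tendsto u (nhdsWithin 0 (Set.Ioi 0)) (nhds (u 0))
  balanced : ∀ x ∈ openInt b,
    u x = (1 / 2 : ℂ) • (Function.leftLim u x + Function.rightLim u x)
  equation : ∀ c ∈ openInt b, ∀ E : Set ℝ, MeasurableSet E → E ⊆ Set.Ioo 0 c → ∀ i : Fin 2,
    ∑ j, matJ i j * stieltjes (fun x => u x j) c E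
        + ∑ j, q.integralOn c E i j (fun x => u x j)
      = lam * ∑ j, w.integralOn c E i j (fun x => u x j)

/-- `B_+(x,lam) = J + (Δ_q(x) - lam Δ_w(x)) / 2`. -/
def matBPlus (q w : LocalMatrixMeasure b) (x : ℝ) (lam : ℂ) : Matrix (Fin 2) (Fin 2) ℂ :=
  matJ + (1 / 2 : ℂ) • (q.atom x - lam • w.atom x)

/-- `B_-(x,lam) = J - (Δ_q(x) - lam Δ_w(x)) / 2`. -/
def matBMinus (q w : LocalMatrixMeasure b) (x : ℝ) (lam : ℂ) : Matrix (Fin 2) (Fin 2) ℂ :=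
  matJ - (1 / 2 : ℂ) • (q.atom x - lam • w.atom x)

/-- The set `Λ` of those `lam` for which `B_+(x,lam)` or `B_-(x,lam)` fails to be invertible for
some `x ∈ (0,b)`. -/
def badSet (q w : LocalMatrixMeasure b) : Set ℂ :=
  {lam | ∃ x ∈ openInt b, (matBPlus q w x lam).det * (matBMinus q w x lam).det = 0}

/-- The function `τ(x,lam)`, for `lam ∉ Λ`. All but countably many factors of the
(unconditionally convergent) product are `1`. -/
def tau (q w : LocalMatrixMeasure b) (x : ℝ) (lam : ℂ) : ℂ :=
  (∏' y : Set.Ioo (0 : ℝ) x, (matBMinus q w y lam).det / (matBPlus q w y lam).det) *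
    Complex.exp (2 * Complex.I *
      (((q.contPart12 x).im : ℂ) - lam * ((w.contPart12 x).im : ℂ)))

/-- The deficiency index at `lam`: the maximal number of solutions of `J u' + q u = lam w u` of
finite norm that are linearly independent modulo solutions of norm `0`. For `lam` in the upper
(lower) half-plane this is the index `n_+` (`n_-`). -/
def deficiencyIndex (q w : LocalMatrixMeasure b) (lam : ℂ) : ℕ∞ :=
  ⨆ (n : ℕ) (_ : ∃ u : Fin n → ℝ → Fin 2 → ℂ,
      (∀ k, IsSolution q w lam (u k) ∧ w.MemL2 (u k)) ∧
      ∀ a : Fin n → ℂ, w.normSq (fun x => ∑ k, a k • u k x) = 0 → a = 0), (n : ℕ∞)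

end

set_option linter.unusedSectionVars false

/-! On each interval $(0,c]$ the entries of $q$ and $w$ have Hermitian densities $Q,W$ with respect
to one finite measure $m$. With $H=\lambda W-Q$ the equation says that $u'$ has density $J^{-1}Hu$.
Let $V$ be the left limit of $u$ and $r=m(\{t\})$. Balance gives $u=V+\frac r2J^{-1}Hu$, and
$\lambda\notin\Lambda$ makes $1-\frac r2J^{-1}H$ invertible. Hence $V(x)=u(0)+\int_{(0,x)}KV\,dm$
with $K=J^{-1}H(1-\frac r2J^{-1}H)^{-1}$ (`leftKernel`). A Gronwall argument shows that $u(0)$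
determines $V$ and hence $u$ on $(0,b)$; conversely every solution of the Volterra equation yields a
balanced solution (`isSolution_of_isVolterra`).

Two facts carry the theorem. The first concerns $\tau$, which is the determinant of the transfer
matrix $M_\lambda$ of left limits. Since $M_{\bar\lambda}^*JM_\lambda=J$, and
$JM^{-1}J^{-1}=M^{T}/\det M$ for $2\times2$ matrices, $M_{\bar\lambda}=\overline{M_\lambda/\tau}$.
So $V\mapsto\overline{V/\tau}$ carries left limits of solutions for $\lambda$ to those for
$\bar\lambda$, with conjugated initial value. Transfer matrices are not formed below: `tau_eq`
identifies $\tau$ with the solution of a scalar equation, and the product rule for measures with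
atoms (`cumInt_mul_cumInt`) reduces the claim to the pointwise identity
`leftKernel_conjTranspose_mulVec`.

The second is the energy identity (`IsVolterra.im_mul_conj`): $\operatorname{Im}(V_1\overline{V_2})$
grows from $0$ to $x$ by $\operatorname{Im}\lambda\int_{(0,x)}u^*wu$. Thus, for nonreal $\lambda$,
$u\in\mathcal L^2(w)$ exactly when this form stays bounded. Passing to $\overline{V/\tau}$
multiplies the form by $-|\tau|^{-2}$, which is harmless if $\tau$ is bounded and bounded away from
$0$. This is the first claim.

For the second claim solutions are replaced by their initial values in $\mathbb C^2$. Conjugation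
maps the initial values of $\mathcal L^2$ solutions for $\lambda$ onto those for $\bar\lambda$,
preserving dimension. A solution of norm $0$ has $Wu=0$ almost everywhere, so $\lambda$ drops out of
its equation and the null subspaces agree. The deficiency index is the difference of the two
dimensions. -/

section

open MeasureTheory Set Filter Topology

/-! ### Complex measures given by densities -/

section Densities

/-- Integration against a complex measure with density `k` is integration of the product. -/
theorem integral_withDensityᵥ_mul {m : Measure ℝ} {k : ℝ → ℂ} (hk : Integrable k m)
    {f : ℝ → ℂ} (hf : Integrable f (m.withDensity fun x => ‖k x‖ₑ)) :
    (m.withDensityᵥ k).integral f (ContinuousLinearMap.mul ℝ ℂ) = ∫ x, f x * k x ∂m := by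
  have hvar : (m.withDensityᵥ k).variation = m.withDensity fun x => ‖k x‖ₑ :=
    Measure.variation_withDensityᵥ hk
  have hkm : AEMeasurable (fun x => ‖k x‖ₑ) m := hk.aestronglyMeasurable.enorm
  have hklt : ∀ᵐ x ∂m, ‖k x‖ₑ < ⊤ := by simp
  have hnorm : ∀ g : ℝ → ℂ, Integrable g (m.withDensity fun x => ‖k x‖ₑ) →
      Integrable (fun x => g x * k x) m ∧
      ‖∫ x, g x * k x ∂m‖ ≤ ∫ x, ‖g x‖ ∂(m.withDensity fun x => ‖k x‖ₑ) := by
    intro g hg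
    have h1 := (integrable_withDensity_iff_integrable_smul₀' hkm hklt).1 hg
    have h1' : Integrable (fun x => ‖k x‖ • g x) m := by simpa using h1
    have h2 : AEStronglyMeasurable (fun x => g x * k x) m := by
      -- Where $k=0$ the function $g$ need not be $m$-measurable, so the product is rebuilt from
      -- $\|k\|g$ and the phase of $k$.
      have : (fun x => g x * k x) =
          fun x => (‖k x‖ • g x) * ((‖k x‖ : ℂ)⁻¹ * k x) := by
        ext x
        by_cases hx : k x = 0
        · simp [hx]
        · have : (‖k x‖ : ℂ) ≠ 0 := by simpa using hx
          rw [Complex.real_smul]; field_simp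
      rw [this]
      refine h1'.aestronglyMeasurable.mul (AEStronglyMeasurable.mul ?_ hk.aestronglyMeasurable)
      exact ((Complex.measurable_ofReal.comp_aemeasurable
        hk.aestronglyMeasurable.aemeasurable.norm).inv).aestronglyMeasurable
    have h3 : Integrable (fun x => g x * k x) m := by
      refine h1'.mono h2 (Eventually.of_forall fun x => ?_)
      simp [mul_comm]
    refine ⟨h3, ?_⟩
    rw [integral_withDensity_eq_integral_toReal_smul₀ hkm hklt]
    refine (norm_integral_le_integral_norm _).trans (le_of_eq ?_)
    refine integral_congr_ae (Eventually.of_forall fun x => ?_)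
    simp [mul_comm]
  have hcongr : ∀ g g' : ℝ → ℂ, g =ᵐ[m.withDensity fun x => ‖k x‖ₑ] g' →
      ∫ x, g x * k x ∂m = ∫ x, g' x * k x ∂m := by
    intro g g' h
    rw [EventuallyEq, ae_withDensity_iff' hkm] at h
    refine integral_congr_ae ?_
    filter_upwards [h] with x hx
    by_cases h0 : k x = 0
    · simp [h0]
    · rw [hx (by simpa using h0)]
  -- Both sides agree on indicators, are additive, and are continuous in $L^1(|k|m)$; for the right
  -- side, additivity and continuity come from `hnorm`.
  refine Integrable.induction (μ := m.withDensity fun x => ‖k x‖ₑ)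
    (fun f => (m.withDensityᵥ k).integral f (ContinuousLinearMap.mul ℝ ℂ) = ∫ x, f x * k x ∂m)
    ?_ ?_ ?_ ?_ hf
  · intro a s hs hlt
    have : IsFiniteMeasure (m.withDensityᵥ k).variation := by
      rw [hvar]
      exact isFiniteMeasure_withDensity hk.2.ne
    rw [VectorMeasure.integral_indicator_const a hs, withDensityᵥ_apply hk hs]
    rw [ContinuousLinearMap.mul_apply', ← integral_const_mul, ← integral_indicator hs]
    refine integral_congr_ae (Eventually.of_forall fun x => ?_)
    by_cases hx : x ∈ s <;> simp [hx]
  · intro f g _ hf hg ihf ihg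
    rw [VectorMeasure.integral_add (by rwa [VectorMeasure.Integrable, hvar])
      (by rwa [VectorMeasure.Integrable, hvar]), ihf, ihg,
      ← integral_add (hnorm f hf).1 (hnorm g hg).1]
    simp [add_mul]
  · rw [← hvar]
    refine isClosed_eq VectorMeasure.continuous_integral ?_
    refine (LipschitzWith.of_dist_le_mul (K := 1) fun f g => ?_).continuous
    have hf := L1.integrable_coeFn f
    have hg := L1.integrable_coeFn g
    rw [← hvar] at hnorm
    rw [dist_eq_norm, ← integral_sub (hnorm f hf).1 (hnorm g hg).1, L1.dist_eq_integral_dist]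
    simp_rw [dist_eq_norm, ← sub_mul]
    simpa using (hnorm _ (hf.sub hg)).2
  · intro f g hfg hf ih
    rw [← hcongr f g hfg, ← ih]
    exact (VectorMeasure.integral_congr_ae (by rwa [hvar])).symm

theorem ComplexMeasure.exists_finite_dominating (μ : ComplexMeasure ℝ) :
    ∃ m : Measure ℝ, IsFiniteMeasure m ∧ ∀ E, MeasurableSet E → m E = 0 → μ E = 0 := by
  refine ⟨(ComplexMeasure.re μ).totalVariation + (ComplexMeasure.im μ).totalVariation,
    inferInstance, fun E hE h => ?_⟩
  have h1 : (ComplexMeasure.re μ).totalVariation E = 0 := by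
    simp at h; exact h.1
  have h2 : (ComplexMeasure.im μ).totalVariation E = 0 := by
    simp at h; exact h.2
  have h3 : ComplexMeasure.re μ E = 0 := SignedMeasure.null_of_totalVariation_zero _ h1
  have h4 : ComplexMeasure.im μ E = 0 := SignedMeasure.null_of_totalVariation_zero _ h2
  exact Complex.ext h3 h4

theorem ComplexMeasure.exists_density (μ : ComplexMeasure ℝ) (m : Measure ℝ) [IsFiniteMeasure m]
    (h : ∀ E, MeasurableSet E → m E = 0 → μ E = 0) :
    ∃ k : ℝ → ℂ, StronglyMeasurable k ∧ Integrable k m ∧ m.withDensityᵥ k = μ := by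
  have hac : μ ≪ᵥ m.toENNRealVectorMeasure := by
    refine VectorMeasure.AbsolutelyContinuous.mk fun E hE h0 => h E hE ?_
    rwa [Measure.toENNRealVectorMeasure_apply_measurable hE] at h0
  rw [ComplexMeasure.absolutelyContinuous_ennreal_iff] at hac
  have h1 := SignedMeasure.withDensityᵥ_rnDeriv_eq _ m hac.1
  have h2 := SignedMeasure.withDensityᵥ_rnDeriv_eq _ m hac.2
  have hint := ComplexMeasure.integrable_rnDeriv μ m
  have hr : StronglyMeasurable (ComplexMeasure.rnDeriv μ m) := by
    have h1 : StronglyMeasurable ((ComplexMeasure.re μ).rnDeriv m) :=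
      (SignedMeasure.measurable_rnDeriv _ _).stronglyMeasurable
    have h2 : StronglyMeasurable ((ComplexMeasure.im μ).rnDeriv m) :=
      (SignedMeasure.measurable_rnDeriv _ _).stronglyMeasurable
    have : ComplexMeasure.rnDeriv μ m = fun x => (((ComplexMeasure.re μ).rnDeriv m x : ℝ) : ℂ) +
        ((ComplexMeasure.im μ).rnDeriv m x : ℝ) * Complex.I := by
      ext x
      simp [ComplexMeasure.rnDeriv, Complex.mk_eq_add_mul_I]
    rw [this]
    exact ((Complex.measurable_ofReal.comp h1.measurable).add
      ((Complex.measurable_ofReal.comp h2.measurable).mul_const _)).stronglyMeasurable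
  refine ⟨_, hr, hint, ?_⟩
  ext E hE
  rw [withDensityᵥ_apply hint hE]
  apply Complex.ext
  · rw [← RCLike.re_eq_complex_re, ← integral_re hint.integrableOn, RCLike.re_eq_complex_re]
    change ∫ a in E, (ComplexMeasure.re μ).rnDeriv m a ∂m = ComplexMeasure.re μ E
    rw [← withDensityᵥ_apply (SignedMeasure.integrable_rnDeriv _ _) hE, h1]
  · rw [← RCLike.im_eq_complex_im, ← integral_im hint.integrableOn, RCLike.im_eq_complex_im]
    change ∫ a in E, (ComplexMeasure.im μ).rnDeriv m a ∂m = ComplexMeasure.im μ E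
    rw [← withDensityᵥ_apply (SignedMeasure.integrable_rnDeriv _ _) hE, h2]

end Densities

/-! ### Hermitian matrix densities of $q$ and $w$ -/

section

variable {b : EReal}

namespace LocalMatrixMeasure

/-- `D` is a Hermitian matrix density of `μ` on `(0,c]` with respect to `m`. -/
structure IsDensity (μ : LocalMatrixMeasure b) (c : ℝ) (m : Measure ℝ)
    (D : ℝ → Matrix (Fin 2) (Fin 2) ℂ) : Prop where
  meas : ∀ i j, StronglyMeasurable fun t => D t i j
  int : ∀ i j, Integrable (fun t => D t i j) m
  eq : ∀ i j, m.withDensityᵥ (fun t => D t i j) = μ.restr c i j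
  herm : ∀ t, (D t).IsHermitian

theorem restr_restrict_self (μ : LocalMatrixMeasure b) {c : ℝ} (hc : c ∈ openInt b) (i j : Fin 2) :
    (μ.restr c i j).restrict (Ioc 0 c) = μ.restr c i j :=
  μ.compatible c c i j le_rfl hc.2

theorem restr_inter (μ : LocalMatrixMeasure b) {c : ℝ} (hc : c ∈ openInt b) (i j : Fin 2)
    {E : Set ℝ} (hE : MeasurableSet E) : μ.restr c i j (E ∩ Ioc 0 c) = μ.restr c i j E := by
  rw [← VectorMeasure.restrict_apply _ measurableSet_Ioc hE, μ.restr_restrict_self hc]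

theorem restr_of_subset (μ : LocalMatrixMeasure b) {c d : ℝ} (hcd : c ≤ d) (hd : (d : EReal) < b)
    (i j : Fin 2) {E : Set ℝ} (hE : MeasurableSet E) (hEc : E ⊆ Ioc 0 c) :
    μ.restr c i j E = μ.restr d i j E := by
  rw [← μ.compatible c d i j hcd hd, VectorMeasure.restrict_apply _ measurableSet_Ioc hE,
    inter_eq_left.2 hEc]

/-- Averaging the scalar Radon–Nikodym densities with their conjugate transposes makes the density
Hermitian at every point, not just almost everywhere. The later matrix algebra then needs no
exceptional null set. -/
theorem IsHermitian.exists_isDensity {μ : LocalMatrixMeasure b} (hμ : μ.IsHermitian) {c : ℝ}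
    (hc : c ∈ openInt b) {m : Measure ℝ} [IsFiniteMeasure m]
    (hm : ∀ i j, ∀ E, MeasurableSet E → m E = 0 → μ.restr c i j E = 0) :
    ∃ D, μ.IsDensity c m D := by
  choose k hk1 hk2 hk3 using fun i j => ComplexMeasure.exists_density _ m (hm i j)
  have hint : ∀ i j, Integrable (fun t => (1 / 2 : ℂ) * (k i j t + conj (k j i t))) m :=
    fun i j => ((hk2 i j).add ((Complex.conjCLE.toContinuousLinearMap).integrable_comp
      (hk2 j i))).const_mul _
  refine ⟨fun t => Matrix.of fun i j => (1 / 2 : ℂ) * (k i j t + conj (k j i t)), ?_, hint, ?_, ?_⟩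
  · intro i j
    exact ((hk1 i j).add (Complex.continuous_conj.comp_stronglyMeasurable (hk1 j i))).const_mul _
  · intro i j
    ext E hE
    simp only [Matrix.of_apply]
    rw [withDensityᵥ_apply (hint i j) hE]
    have h1 : ∀ i j, ∫ x in E, k i j x ∂m = μ.restr c i j E := fun i j => by
      rw [← hk3 i j, withDensityᵥ_apply (hk2 i j) hE]
    have h2 : conj (μ.restr c j i E) = μ.restr c i j E := (hμ c hc E hE).apply i j
    have h3 : ∫ x in E, conj (k j i x) ∂m = μ.restr c i j E := by
      rw [integral_conj, h1, h2]
    rw [integral_const_mul, integral_add (hk2 i j).integrableOn, h1, h3]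
    · ring
    · exact ((Complex.conjCLE.toContinuousLinearMap).integrable_comp (hk2 j i)).integrableOn
  · intro t
    ext i j
    simp [Matrix.conjTranspose_apply, add_comm]

section IsDensity

variable {μ : LocalMatrixMeasure b} {c : ℝ} {m : Measure ℝ}
  {D : ℝ → Matrix (Fin 2) (Fin 2) ℂ}

theorem IsDensity.restr_apply (h : μ.IsDensity c m D) (i j : Fin 2) {E : Set ℝ}
    (hE : MeasurableSet E) : μ.restr c i j E = ∫ t in E, D t i j ∂m := by
  rw [← h.eq, withDensityᵥ_apply (h.int i j) hE]

theorem IsDensity.integralOn_eq (h : μ.IsDensity c m D) {c' : ℝ} (hcc : c' ≤ c)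
    (hc : (c : EReal) < b) (i j : Fin 2) {E : Set ℝ} (hE : MeasurableSet E) (hE' : E ⊆ Ioc 0 c')
    {f : ℝ → ℂ} (hf : AEStronglyMeasurable f (m.restrict E)) {C : ℝ} (hC : ∀ x ∈ E, ‖f x‖ ≤ C) :
    μ.integralOn c' E i j f = ∫ t in E, f t * D t i j ∂m := by
  have hr : (μ.restr c' i j).restrict E = (m.restrict E).withDensityᵥ fun t => D t i j := by
    ext F hF
    rw [VectorMeasure.restrict_apply _ hE hF,
      μ.restr_of_subset hcc hc i j (hF.inter hE) (inter_subset_right.trans hE'),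
      h.restr_apply i j (hF.inter hE), withDensityᵥ_apply (h.int i j).restrict hF,
      Measure.restrict_restrict hF]
  rw [integralOn, hr]
  refine integral_withDensityᵥ_mul (h.int i j).restrict ?_
  have : IsFiniteMeasure ((m.restrict E).withDensity fun t => ‖D t i j‖ₑ) :=
    isFiniteMeasure_withDensity (h.int i j).restrict.2.ne
  refine Integrable.of_bound (hf.mono_ac (withDensity_absolutelyContinuous _ _)) C ?_
  refine (withDensity_absolutelyContinuous _ _).ae_le ?_
  exact (ae_restrict_iff' hE).2 (Eventually.of_forall hC)

theorem IsDensity.atom_eq (h : μ.IsDensity c m D) (hc : (c : EReal) < b) {t : ℝ}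
    (ht : t ∈ Ioc 0 c) : μ.atom t = (m.real {t} : ℂ) • D t := by
  ext i j
  have : μ.atom t i j = μ.restr t i j {t} := rfl
  rw [this, μ.restr_of_subset ht.2 hc i j (measurableSet_singleton t) (by
    simpa using ht.1), h.restr_apply i j (measurableSet_singleton t)]
  simp [Measure.restrict_singleton, integral_smul_measure, measureReal_def]

/-- The quadratic form `ξ ↦ ξ^* M ξ`. -/
def quadForm (M : Matrix (Fin 2) (Fin 2) ℂ) (ξ : Fin 2 → ℂ) : ℝ :=
  (∑ i, ∑ j, conj (ξ i) * ξ j * M i j).re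

theorem quadForm_eq (M : Matrix (Fin 2) (Fin 2) ℂ) (ξ : Fin 2 → ℂ) :
    quadForm M ξ = (star ξ ⬝ᵥ M.mulVec ξ).re := by
  simp [quadForm, Matrix.mulVec, dotProduct, Fin.sum_univ_two]
  ring

/-- For a fixed vector the form is nonnegative almost everywhere because its integrals over Borel
sets are. A countable dense set of vectors and continuity make the null set independent of the
vector. -/
theorem IsDensity.ae_posSemidef (h : μ.IsDensity c m D) (hμ : μ.IsNonneg) (hc : c ∈ openInt b) :
    ∀ᵐ t ∂m, (D t).PosSemidef := by
  have hint : ∀ ξ : Fin 2 → ℂ, Integrable (fun t => ∑ i, ∑ j, conj (ξ i) * ξ j * D t i j) m :=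
    fun ξ => integrable_finsetSum _ fun i _ => integrable_finsetSum _ fun j _ =>
      (h.int i j).const_mul _
  have h1 : ∀ ξ : Fin 2 → ℂ, ∀ᵐ t ∂m, 0 ≤ quadForm (D t) ξ := by
    intro ξ
    refine ae_nonneg_of_forall_setIntegral_nonneg (hint ξ).re fun E hE _ => ?_
    have h2 : ∫ t in E, quadForm (D t) ξ ∂m = quadForm (μ.val c E) ξ := by
      have := integral_re ((hint ξ).integrableOn (s := E))
      simp only [quadForm]
      rw [← RCLike.re_eq_complex_re, this]
      congr 1
      rw [integral_finsetSum _ fun i _ => (integrable_finsetSum _ fun j _ =>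
        (h.int i j).const_mul _).integrableOn]
      refine Finset.sum_congr rfl fun i _ => ?_
      rw [integral_finsetSum _ fun j _ => ((h.int i j).const_mul _).integrableOn]
      refine Finset.sum_congr rfl fun j _ => ?_
      rw [integral_const_mul, ← h.restr_apply i j hE]
      rfl
    change 0 ≤ ∫ t in E, quadForm (D t) ξ ∂m
    rw [h2, quadForm_eq]
    exact ((hμ c hc E hE).dotProduct_mulVec_nonneg ξ |> Complex.nonneg_iff.1).1
  have h2 := ae_all_iff.2 fun n => h1 (TopologicalSpace.denseSeq (Fin 2 → ℂ) n)
  filter_upwards [h2] with t ht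
  have h3 : ∀ ξ, 0 ≤ quadForm (D t) ξ := by
    intro ξ
    have hcl : IsClosed {ξ | 0 ≤ quadForm (D t) ξ} := by
      refine isClosed_le continuous_const ?_
      unfold quadForm
      fun_prop
    have := (TopologicalSpace.denseRange_denseSeq (Fin 2 → ℂ)).closure_range
    have h4 : closure (range (TopologicalSpace.denseSeq (Fin 2 → ℂ))) ⊆
        {ξ | 0 ≤ quadForm (D t) ξ} := hcl.closure_subset_iff.2 (by rintro _ ⟨n, rfl⟩; exact ht n)
    exact h4 (this ▸ mem_univ ξ)
  refine Matrix.PosSemidef.of_dotProduct_mulVec_nonneg (h.herm t) fun ξ => ?_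
  rw [Complex.nonneg_iff]
  refine ⟨by rw [← quadForm_eq]; exact h3 ξ, ?_⟩
  exact ((h.herm t).im_star_dotProduct_mulVec_self ξ).symm

end IsDensity

theorem exists_common_density {q w : LocalMatrixMeasure b} (hq : q.IsHermitian) (hw : w.IsNonneg)
    {c : ℝ} (hc : c ∈ openInt b) : ∃ m : Measure ℝ, IsFiniteMeasure m ∧ m (Ioc 0 c)ᶜ = 0 ∧
      ∃ Q W, q.IsDensity c m Q ∧ w.IsDensity c m W := by
  choose mq hq1 hq2 using fun i j => ComplexMeasure.exists_finite_dominating (q.restr c i j)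
  choose mw hw1 hw2 using fun i j => ComplexMeasure.exists_finite_dominating (w.restr c i j)
  let m : Measure ℝ := (∑ i, ∑ j, (mq i j + mw i j)).restrict (Ioc 0 c)
  have hfin : IsFiniteMeasure m := by
    constructor
    simp [m, Fin.sum_univ_two]
  have hdom : ∀ i j, ∀ E, MeasurableSet E → m E = 0 →
      mq i j (E ∩ Ioc 0 c) = 0 ∧ mw i j (E ∩ Ioc 0 c) = 0 := by
    intro i j E hE h0
    simp only [m, Measure.restrict_apply hE, Fin.sum_univ_two, Measure.add_apply,
      add_eq_zero] at h0
    fin_cases i <;> fin_cases j <;> simp_all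
  obtain ⟨Q, hQ⟩ := hq.exists_isDensity hc (m := m) fun i j E hE h0 => by
    rw [← q.restr_inter hc i j hE]
    exact hq2 i j _ (hE.inter measurableSet_Ioc) (hdom i j E hE h0).1
  have hwh : w.IsHermitian := fun c hc E hE => (hw c hc E hE).1
  obtain ⟨W, hW⟩ := hwh.exists_isDensity hc (m := m) fun i j E hE h0 => by
    rw [← w.restr_inter hc i j hE]
    exact hw2 i j _ (hE.inter measurableSet_Ioc) (hdom i j E hE h0).2
  refine ⟨m, hfin, ?_, Q, W, hQ, hW⟩
  rw [Measure.restrict_apply measurableSet_Ioc.compl]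
  simp

end LocalMatrixMeasure

end

/-! ### Calculus of cumulative integrals for a measure with atoms -/

section Cumulative

variable {m : Measure ℝ} [IsFiniteMeasure m]

/-- The integral of `k` over `(0,x)`. -/
noncomputable def cumInt (m : Measure ℝ) (k : ℝ → ℂ) (x : ℝ) : ℂ := ∫ t in Ioo 0 x, k t ∂m

theorem measurable_atom (m : Measure ℝ) [IsFiniteMeasure m] :
    Measurable fun t : ℝ => m.real {t} := by
  have h : MeasurableSet {p : ℝ × ℝ | p.2 = p.1} :=
    measurableSet_eq_fun measurable_snd measurable_fst
  exact (measurable_measure_prodMk_left (ν := m) h).ennreal_toReal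

theorem countable_atoms (m : Measure ℝ) [IsFiniteMeasure m] :
    {t : ℝ | m.real {t} ≠ 0}.Countable := by
  have h := Measure.countable_meas_pos_of_disjoint_iUnion (μ := m) (As := fun t : ℝ => {t})
    (fun t => measurableSet_singleton t) fun s t hst => by simpa using hst
  refine h.mono fun t ht => ?_
  simp only [mem_ofPred_eq, ne_eq] at ht ⊢
  exact pos_iff_ne_zero.2 fun h0 => ht (by simp [measureReal_def, h0])

omit [IsFiniteMeasure m] in
theorem integral_singleton_eq (k : ℝ → ℂ) (t : ℝ) :
    ∫ s in {t}, k s ∂m = m.real {t} * k t := by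
  simp [Measure.restrict_singleton, integral_smul_measure, measureReal_def]

omit [IsFiniteMeasure m] in
theorem norm_setIntegral_le {k : ℝ → ℂ} (hk : Integrable k m) (E : Set ℝ) :
    ‖∫ t in E, k t ∂m‖ ≤ ∫ t, ‖k t‖ ∂m :=
  (norm_integral_le_integral_norm _).trans
    (setIntegral_le_integral hk.norm (Eventually.of_forall fun _ => norm_nonneg _))

theorem norm_atom_mul_le {k : ℝ → ℂ} (hk : Integrable k m) (t : ℝ) :
    ‖(m.real {t} : ℂ) * k t‖ ≤ ∫ t, ‖k t‖ ∂m := by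
  rw [← integral_singleton_eq]
  exact norm_setIntegral_le hk _

theorem integrable_atom_mul_mul {k l : ℝ → ℂ} (hk : Integrable k m) (hl : Integrable l m) :
    Integrable (fun t => m.real {t} * k t * l t) m :=
  hl.bdd_mul (((Complex.measurable_ofReal.comp (measurable_atom m)).aestronglyMeasurable).mul
    hk.aestronglyMeasurable) (Eventually.of_forall fun t => norm_atom_mul_le hk t)

omit [IsFiniteMeasure m] in
theorem norm_cumInt_le {k : ℝ → ℂ} (hk : Integrable k m) (x : ℝ) :
    ‖cumInt m k x‖ ≤ ∫ t, ‖k t‖ ∂m := norm_setIntegral_le hk _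

theorem stronglyMeasurable_cumInt {k : ℝ → ℂ} (hk : Integrable k m) :
    StronglyMeasurable (cumInt m k) := by
  have h1 : cumInt m k = fun x => ∫ t, (Ioo 0 x).indicator (hk.aestronglyMeasurable.mk k) t ∂m := by
    ext x
    rw [cumInt, integral_indicator measurableSet_Ioo]
    exact integral_congr_ae (ae_restrict_of_ae hk.aestronglyMeasurable.ae_eq_mk)
  rw [h1]
  refine StronglyMeasurable.integral_prod_right (f := fun x t =>
    (Ioo 0 x).indicator (hk.aestronglyMeasurable.mk k) t) ?_
  have h2 : MeasurableSet {p : ℝ × ℝ | 0 < p.2 ∧ p.2 < p.1} :=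
    (measurableSet_lt measurable_const measurable_snd).inter
      (measurableSet_lt measurable_snd measurable_fst)
  exact (hk.aestronglyMeasurable.stronglyMeasurable_mk.comp_measurable measurable_snd).indicator h2

theorem integrable_mul_cumInt {k l : ℝ → ℂ} (hk : Integrable k m) (hl : Integrable l m) (a : ℂ) :
    Integrable (fun t => l t * (a + cumInt m k t)) m := by
  refine hl.mul_bdd ((stronglyMeasurable_cumInt hk).aestronglyMeasurable.const_add a)
    (c := ‖a‖ + ∫ t, ‖k t‖ ∂m) (Eventually.of_forall fun t => ?_)
  exact (norm_add_le _ _).trans (add_le_add_right (norm_cumInt_le hk t) _)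

theorem cumInt_split {k : ℝ → ℂ} (hk : Integrable k m) {t x : ℝ} (ht : t ∈ Ioo 0 x) :
    cumInt m k x = cumInt m k t + m.real {t} * k t + ∫ s in Ioo t x, k s ∂m := by
  have h1 : Ioo 0 x = (Ioo 0 t ∪ {t}) ∪ Ioo t x := by
    ext s
    simp only [mem_union, mem_Ioo, mem_singleton_iff]
    have := ht.1; have := ht.2
    constructor
    · rintro ⟨h1, h2⟩
      rcases lt_trichotomy s t with h | h | h <;> simp [*]
    · rintro ((h | h) | h)
      · exact ⟨h.1, h.2.trans ht.2⟩
      · rw [h]; exact ht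
      · exact ⟨ht.1.trans h.1, h.2⟩
  have hd1 : Disjoint (Ioo 0 t ∪ {t}) (Ioo t x) := by
    rw [Set.disjoint_left]
    rintro s (h | h) h'
    · exact absurd h.2 h'.1.not_gt
    · exact absurd h h'.1.ne'
  have hd2 : Disjoint (Ioo 0 t) {t} := by simp
  rw [cumInt, h1, setIntegral_union hd1 measurableSet_Ioo hk.integrableOn hk.integrableOn,
    setIntegral_union hd2 (measurableSet_singleton t) hk.integrableOn hk.integrableOn,
    integral_singleton_eq, cumInt]

/-- Fubini on the triangle $t<s$ in $(0,x)^2$. -/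
theorem setIntegral_mul_tail {k l : ℝ → ℂ} (hk : Integrable k m) (hl : Integrable l m) (x : ℝ) :
    ∫ t in Ioo 0 x, l t * ∫ s in Ioo t x, k s ∂m ∂m = ∫ s in Ioo 0 x, k s * cumInt m l s ∂m := by
  have hmeas : MeasurableSet {p : ℝ × ℝ | p.1 < p.2} :=
    measurableSet_lt measurable_fst measurable_snd
  have hint : Integrable (Function.uncurry fun t s : ℝ =>
      {p : ℝ × ℝ | p.1 < p.2}.indicator (fun p => l p.1 * k p.2) (t, s))
      ((m.restrict (Ioo 0 x)).prod (m.restrict (Ioo 0 x))) :=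
    (Integrable.mul_prod (f := l) (g := k) hl.restrict hk.restrict).indicator hmeas
  have hswap := integral_integral_swap hint
  have h1 : ∀ t ∈ Ioo 0 x, ∫ s in Ioo 0 x, {p : ℝ × ℝ | p.1 < p.2}.indicator
      (fun p => l p.1 * k p.2) (t, s) ∂m = l t * ∫ s in Ioo t x, k s ∂m := by
    intro t ht
    have : ∀ s, {p : ℝ × ℝ | p.1 < p.2}.indicator (fun p => l p.1 * k p.2) (t, s) =
        (Ioi t).indicator (fun s => l t * k s) s := fun s => by
      by_cases h : t < s <;> simp [h]
    simp_rw [this]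
    rw [setIntegral_indicator measurableSet_Ioi, integral_const_mul]
    congr 3
    ext s
    simp only [mem_inter_iff, mem_Ioo, mem_Ioi]
    exact ⟨fun h => ⟨h.2, h.1.2⟩, fun h => ⟨⟨ht.1.trans h.1, h.2⟩, h.1⟩⟩
  have h2 : ∀ s ∈ Ioo 0 x, ∫ t in Ioo 0 x, {p : ℝ × ℝ | p.1 < p.2}.indicator
      (fun p => l p.1 * k p.2) (t, s) ∂m = k s * cumInt m l s := by
    intro s hs
    have : ∀ t, {p : ℝ × ℝ | p.1 < p.2}.indicator (fun p => l p.1 * k p.2) (t, s) =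
        (Iio s).indicator (fun t => k s * l t) t := fun t => by
      by_cases h : t < s <;> simp [h, mul_comm]
    simp_rw [this]
    rw [setIntegral_indicator measurableSet_Iio, integral_const_mul, cumInt]
    congr 3
    ext t
    simp only [mem_inter_iff, mem_Ioo, mem_Iio]
    exact ⟨fun h => ⟨h.1.1, h.2⟩, fun h => ⟨⟨h.1, h.2.trans hs.2⟩, h.2⟩⟩
  rw [setIntegral_congr_fun measurableSet_Ioo h1, setIntegral_congr_fun measurableSet_Ioo h2]
    at hswap
  exact hswap

/-- The product rule for cumulative integrals. -/
theorem cumInt_mul_cumInt {k l : ℝ → ℂ} (hk : Integrable k m) (hl : Integrable l m) (a c : ℂ)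
    (x : ℝ) : (a + cumInt m k x) * (c + cumInt m l x) = a * c + cumInt m (fun t =>
      k t * (c + cumInt m l t) + l t * (a + cumInt m k t) + m.real {t} * k t * l t) x := by
  have hkl := integrable_mul_cumInt hl hk 0
  have hlk := integrable_mul_cumInt hk hl 0
  have hat := integrable_atom_mul_mul hk hl
  simp only [zero_add] at hkl hlk
  -- For each $t$ the factor $\int_{(0,x)}k$ splits into the parts before, at and after $t$. The
  -- part at $t$ is the atomic correction; the part after $t$ becomes the symmetric term by
  -- `setIntegral_mul_tail`.
  have hcore : cumInt m k x * cumInt m l x = ∫ t in Ioo 0 x,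
      (k t * cumInt m l t + l t * cumInt m k t + m.real {t} * k t * l t) ∂m := by
    have h1 : cumInt m k x * cumInt m l x = ∫ t in Ioo 0 x, (l t * cumInt m k t +
        m.real {t} * k t * l t + l t * ∫ s in Ioo t x, k s ∂m) ∂m := by
      rw [mul_comm, cumInt, ← integral_mul_const]
      refine setIntegral_congr_fun measurableSet_Ioo fun t ht => ?_
      simp only [cumInt_split hk ht]
      ring
    have h3 : IntegrableOn (fun t => l t * ∫ s in Ioo t x, k s ∂m) (Ioo 0 x) m := by
      have : IntegrableOn (fun t => l t * cumInt m k x - l t * cumInt m k t -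
          m.real {t} * k t * l t) (Ioo 0 x) m :=
        (((hl.mul_const _).sub hlk).sub hat).integrableOn
      refine this.congr_fun (fun t ht => ?_) measurableSet_Ioo
      simp only [cumInt_split hk ht]
      ring
    have h5 : Integrable (fun t => l t * cumInt m k t + m.real {t} * k t * l t) m := hlk.add hat
    rw [h1, integral_add h5.integrableOn h3, setIntegral_mul_tail hk hl,
      ← integral_add h5.integrableOn hkl.integrableOn]
    refine integral_congr_ae (Eventually.of_forall fun t => ?_)
    ring
  have h4 : cumInt m (fun t => k t * (c + cumInt m l t) + l t * (a + cumInt m k t) +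
      m.real {t} * k t * l t) x = c * cumInt m k x + a * cumInt m l x +
        cumInt m k x * cumInt m l x := by
    have h5 : Integrable (fun t => c * k t + a * l t) m := (hk.const_mul c).add (hl.const_mul a)
    have h6 : Integrable (fun t => k t * cumInt m l t + l t * cumInt m k t +
        m.real {t} * k t * l t) m := (hkl.add hlk).add hat
    rw [hcore, cumInt, cumInt, cumInt, ← integral_const_mul, ← integral_const_mul,
      ← integral_add (hk.const_mul c).integrableOn (hl.const_mul a).integrableOn,
      ← integral_add h5.integrableOn h6.integrableOn]
    refine integral_congr_ae (Eventually.of_forall fun t => ?_)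
    ring
  rw [h4]
  ring

/-- Since $k$ vanishes at the atoms of $m$, the product rule has no correction term and the
classical power rule survives. -/
theorem cumInt_pow {k : ℝ → ℂ} (hk : Integrable k m) (hat : ∀ t, (m.real {t} : ℂ) * k t = 0)
    (n : ℕ) (x : ℝ) : cumInt m k x ^ (n + 1) =
      cumInt m (fun t => (n + 1) * (k t * cumInt m k t ^ n)) x := by
  induction n generalizing x with
  | zero => simp
  | succ n ih =>
    have hint : Integrable (fun t => (n + 1) * (k t * cumInt m k t ^ n)) m := by
      refine Integrable.const_mul (hk.mul_bdd
        ((stronglyMeasurable_cumInt hk).pow n).aestronglyMeasurable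
        (c := (∫ t, ‖k t‖ ∂m) ^ n) (Eventually.of_forall fun t => ?_)) _
      rw [Pi.pow_apply, norm_pow]
      exact pow_le_pow_left₀ (norm_nonneg _) (norm_cumInt_le hk t) n
    have h := cumInt_mul_cumInt hk hint 0 0 x
    simp only [zero_add, mul_zero, hat, zero_mul, add_zero] at h
    rw [pow_succ', ih, h]
    congr 1
    ext t
    rw [← ih]
    push_cast
    ring

/-- The exponential series is integrated termwise with `cumInt_pow`, dominated by the series at
$\int\|k\|\,dm$; the index shifts by one and the missing term is the $1$. -/
theorem exp_cumInt {k : ℝ → ℂ} (hk : Integrable k m) (hat : ∀ t, (m.real {t} : ℂ) * k t = 0)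
    (x : ℝ) : Complex.exp (cumInt m k x) = 1 + cumInt m (fun t => k t * Complex.exp (cumInt m k t)) x
    := by
  set R := ∫ t, ‖k t‖ ∂m
  have hR : 0 ≤ R := integral_nonneg fun _ => norm_nonneg _
  have hexp : ∀ z : ℂ, HasSum (fun n : ℕ => z ^ n / (n.factorial : ℂ)) (Complex.exp z) := fun z => by
    rw [Complex.exp_eq_exp_ℂ]
    exact NormedSpace.expSeries_div_hasSum_exp z
  have h1 : HasSum (fun n : ℕ => ∫ t in Ioo 0 x, k t * (cumInt m k t ^ n / (n.factorial : ℂ)) ∂m)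
      (∫ t in Ioo 0 x, k t * Complex.exp (cumInt m k t) ∂m) := by
    have hs : HasSum (fun n : ℕ => R ^ n / (n.factorial : ℝ)) (Real.exp R) := by
      rw [Real.exp_eq_exp_ℝ]
      exact NormedSpace.expSeries_div_hasSum_exp R
    refine hasSum_integral_of_dominated_convergence
      (fun n t => ‖k t‖ * (R ^ n / (n.factorial : ℝ))) ?_ ?_ ?_ ?_ ?_
    · intro n
      exact (hk.aestronglyMeasurable.mul (((stronglyMeasurable_cumInt hk).pow n).div
        stronglyMeasurable_const).aestronglyMeasurable).restrict
    · intro n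
      refine Eventually.of_forall fun t => ?_
      rw [norm_mul, norm_div, norm_pow, Complex.norm_natCast]
      gcongr
      exact norm_cumInt_le hk t
    · exact Eventually.of_forall fun t => (hs.summable.mul_left _)
    · simp_rw [tsum_mul_left]
      exact (hk.norm.mul_const _).integrableOn
    · exact Eventually.of_forall fun t => (hexp _).mul_left _
  have h2 : ∀ n : ℕ, ∫ t in Ioo 0 x, k t * (cumInt m k t ^ n / (n.factorial : ℂ)) ∂m =
      cumInt m k x ^ (n + 1) / ((n + 1).factorial : ℂ) := by
    intro n
    rw [cumInt_pow hk hat, cumInt, integral_const_mul, Nat.factorial_succ, Nat.cast_mul,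
      Nat.cast_succ, mul_div_mul_left _ _ (by exact_mod_cast Nat.succ_ne_zero n),
      ← integral_div]
    simp_rw [mul_div_assoc]
  simp_rw [h2] at h1
  have h3 := (hexp (cumInt m k x))
  rw [← hasSum_nat_add_iff' 1] at h3
  have h4 := h1.unique h3
  change _ = 1 + ∫ t in Ioo 0 x, k t * Complex.exp (cumInt m k t) ∂m
  rw [h4]
  simp

end Cumulative

/-! ### Solving a scalar equation by a product over atoms times an exponential -/

section ProductExponential

theorem norm_prod_one_add_le_exp_tsum {ι : Type*} {s : ι → ℂ} (hs : Summable fun y => ‖s y‖)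
    (F : Finset ι) : ‖∏ y ∈ F, (1 + s y)‖ ≤ Real.exp (∑' y, ‖s y‖) := by
  rw [norm_prod]
  calc ∏ y ∈ F, ‖1 + s y‖ ≤ ∏ y ∈ F, (1 + ‖s y‖) :=
        Finset.prod_le_prod (fun _ _ => norm_nonneg _) fun y _ => by
          simpa using norm_add_le (1 : ℂ) (s y)
    _ ≤ Real.exp (∑ y ∈ F, ‖s y‖) := Real.prod_one_add_le_exp_sum _ fun y => norm_nonneg _
    _ ≤ Real.exp (∑' y, ‖s y‖) := Real.exp_le_exp.2
        (hs.sum_le_tsum F fun _ _ => norm_nonneg _)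

theorem summable_norm_indicator {s : ℝ → ℂ} (hs : Summable fun y => ‖s y‖) (I : Set ℝ) :
    Summable fun y => ‖I.indicator s y‖ := by
  simpa only [norm_indicator_eq_indicator_norm] using hs.indicator I

theorem tsum_norm_indicator_le {s : ℝ → ℂ} (hs : Summable fun y => ‖s y‖) (I : Set ℝ) :
    ∑' y, ‖I.indicator s y‖ ≤ ∑' y, ‖s y‖ :=
  (summable_norm_indicator hs I).tsum_le_tsum (fun y => norm_indicator_le_norm_self s y) hs

/-- The product of `1 + s y` over `0 < y < x`. -/
noncomputable def cumProd (s : ℝ → ℂ) (x : ℝ) : ℂ := ∏' y : Ioo (0 : ℝ) x, (1 + s y)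

theorem cumProd_eq_tprod (s : ℝ → ℂ) (x : ℝ) :
    cumProd s x = ∏' y, (1 + (Ioo (0 : ℝ) x).indicator s y) := by
  rw [cumProd, tprod_subtype (Ioo (0 : ℝ) x) fun y => 1 + s y]
  congr 1
  ext y
  by_cases hy : y ∈ Ioo (0 : ℝ) x <;> simp only [mulIndicator, indicator, hy, if_true, if_false,
    add_zero]

theorem hasProd_cumProd {s : ℝ → ℂ} (hs : Summable fun y => ‖s y‖) (x : ℝ) :
    HasProd (fun y => 1 + (Ioo (0 : ℝ) x).indicator s y) (cumProd s x) := by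
  rw [cumProd_eq_tprod]
  exact (Complex.multipliable_one_add_of_summable (summable_norm_indicator hs _).of_norm).hasProd

theorem norm_cumProd_le {s : ℝ → ℂ} (hs : Summable fun y => ‖s y‖) (x : ℝ) :
    ‖cumProd s x‖ ≤ Real.exp (∑' y, ‖s y‖) := by
  refine le_of_tendsto (continuous_norm.tendsto _ |>.comp (hasProd_cumProd hs x)) (Eventually.of_forall fun F => ?_)
  exact (norm_prod_one_add_le_exp_tsum (summable_norm_indicator hs _) F).trans
    (Real.exp_le_exp.2 (tsum_norm_indicator_le hs _))

/-- A finite product of $1+s_y$ expands according to the largest index used: it is $1+\sum_y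
s_y\prod_{z<y}(1+s_z)$. The limit over finite sets is dominated, all partial products being at most
$\exp\sum\|s_y\|$. -/
theorem cumProd_eq_one_add_tsum {s : ℝ → ℂ} (hs : Summable fun y => ‖s y‖) (x : ℝ) :
    cumProd s x = 1 + ∑' y, (Ioo 0 x).indicator (fun y => s y * cumProd s y) y := by
  classical
  let P : Finset ℝ → ℝ → ℂ := fun F x => ∏ y ∈ F, (1 + (Ioo (0 : ℝ) x).indicator s y)
  have hP : ∀ x, Tendsto (fun F => P F x) atTop (𝓝 (cumProd s x)) := fun x => hasProd_cumProd hs x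
  have hfin : ∀ F : Finset ℝ, P F x =
      1 + ∑' y, (Ioo 0 x).indicator (fun y => if y ∈ F then s y * P F y else 0) y := by
    intro F
    rw [tsum_eq_sum (s := F) fun y hy => by simp [indicator, hy]]
    simp only [P]
    rw [Finset.prod_one_add_ordered]
    congr 1
    refine Finset.sum_congr rfl fun y hy => ?_
    by_cases hyx : y ∈ Ioo (0 : ℝ) x
    · simp only [indicator_of_mem hyx, hy, if_true]
      congr 1
      rw [Finset.prod_filter]
      refine Finset.prod_congr rfl fun z _ => ?_
      by_cases hzy : z < y
      · by_cases hz : 0 < z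
        · simp [hzy, hz, hzy.trans hyx.2]
        · simp [hz]
      · simp [hzy]
    · simp [indicator_of_notMem hyx]
  have hlim : Tendsto (fun F : Finset ℝ =>
      ∑' y, (Ioo 0 x).indicator (fun y => if y ∈ F then s y * P F y else 0) y) atTop
      (𝓝 (∑' y, (Ioo 0 x).indicator (fun y => s y * cumProd s y) y)) := by
    refine tendsto_tsum_of_dominated_convergence
      (bound := fun y => ‖s y‖ * Real.exp (∑' y, ‖s y‖)) (hs.mul_right _) ?_ ?_
    · intro y
      by_cases hyx : y ∈ Ioo (0 : ℝ) x
      · simp only [indicator_of_mem hyx]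
        refine ((hP y).const_mul (s y)).congr' ?_
        filter_upwards [eventually_ge_atTop {y}] with F hF
        rw [if_pos (Finset.singleton_subset_iff.1 hF)]
      · simp only [indicator_of_notMem hyx]
        exact tendsto_const_nhds
    · refine Eventually.of_forall fun F y => (norm_indicator_le_norm_self _ _).trans ?_
      by_cases hy : y ∈ F
      · rw [if_pos hy, norm_mul]
        gcongr
        exact (norm_prod_one_add_le_exp_tsum (summable_norm_indicator hs _) F).trans
          (Real.exp_le_exp.2 (tsum_norm_indicator_le hs _))
      · simp only [hy, if_false, norm_zero]
        positivity
  refine tendsto_nhds_unique (hP x) ?_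
  simp_rw [hfin]
  exact hlim.const_add 1

variable {m : Measure ℝ} [IsFiniteMeasure m]

omit [IsFiniteMeasure m] in
theorem summable_atom_mul {k : ℝ → ℂ} (hk : Integrable k m) :
    Summable fun t => ‖(m.real {t} : ℂ) * k t‖ := by
  refine summable_of_sum_le (c := ∫ t, ‖k t‖ ∂m) (fun _ => norm_nonneg _) fun F => ?_
  have h1 := setIntegral_countable (μ := m) (fun t => ‖k t‖) F.countable_toSet hk.norm.integrableOn
  rw [Finset.tsum_subtype' F fun t => m.real {t} • ‖k t‖] at h1
  have h2 : ∑ t ∈ F, ‖(m.real {t} : ℂ) * k t‖ = ∑ t ∈ F, m.real {t} • ‖k t‖ :=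
    Finset.sum_congr rfl fun t _ => by simp [abs_of_nonneg measureReal_nonneg]
  rw [h2, ← h1]
  exact setIntegral_le_integral hk.norm (Eventually.of_forall fun _ => norm_nonneg _)

/-- The set of atoms of `m`. -/
def atomSet (m : Measure ℝ) : Set ℝ := {t | m.real {t} ≠ 0}

theorem measurableSet_atomSet (m : Measure ℝ) [IsFiniteMeasure m] : MeasurableSet (atomSet m) :=
  (countable_atoms m).measurableSet

theorem stronglyMeasurable_atomSet_indicator (f : ℝ → ℂ) :
    StronglyMeasurable ((atomSet m).indicator f) := by
  refine (measurable_zero.measurable_of_countable_ne (β := ℂ) (α := ℝ) ?_).stronglyMeasurable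
  refine (countable_atoms m).mono fun t ht => ?_
  by_contra h
  exact ht (indicator_of_notMem h f).symm

/-- The solution of `T' = k T`, `T(0) = 1`. -/
noncomputable def prodExp (m : Measure ℝ) (k : ℝ → ℂ) (x : ℝ) : ℂ :=
  cumProd (fun y => m.real {y} * k y) x * Complex.exp (cumInt m ((atomSet m)ᶜ.indicator k) x)

/-- On the countable set of atoms an integral is a sum weighted by $m(\{y\})$, so the expansion of
the product is itself a Volterra equation driven by the atomic part of $k$. -/
theorem cumProd_atom_eq {k : ℝ → ℂ} (hk : Integrable k m) (x : ℝ) :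
    Integrable ((atomSet m).indicator fun t => k t * cumProd (fun y => m.real {y} * k y) t) m ∧
    cumProd (fun y => m.real {y} * k y) x = 1 + cumInt m
      ((atomSet m).indicator fun t => k t * cumProd (fun y => m.real {y} * k y) t) x := by
  set s : ℝ → ℂ := fun y => m.real {y} * k y with hs_def
  have hs : Summable fun y => ‖s y‖ := summable_atom_mul hk
  have hint : Integrable ((atomSet m).indicator fun t => k t * cumProd s t) m := by
    refine (hk.norm.mul_const (Real.exp (∑' y, ‖s y‖))).mono'
      (stronglyMeasurable_atomSet_indicator _).aestronglyMeasurable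
      (Eventually.of_forall fun t => ?_)
    refine (norm_indicator_le_norm_self _ _).trans ?_
    rw [norm_mul]
    gcongr
    exact norm_cumProd_le hs t
  refine ⟨hint, ?_⟩
  rw [cumProd_eq_one_add_tsum hs]
  congr 1
  have hI : Integrable (fun t => (atomSet m).indicator (fun t => k t * cumProd s t) t) m := hint
  rw [cumInt, setIntegral_indicator (measurableSet_atomSet m),
    setIntegral_countable _ ((countable_atoms m).mono (inter_subset_right : _ ∩ atomSet m ⊆ _))
      ((integrable_indicator_iff (measurableSet_atomSet m)).1 hI |>.mono_set inter_subset_right)]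
  rw [tsum_subtype (Ioo 0 x ∩ atomSet m) fun t => m.real {t} • (k t * cumProd s t)]
  congr 1
  ext y
  by_cases hy : y ∈ Ioo (0 : ℝ) x <;> by_cases hy' : y ∈ atomSet m
  · simp [hy, hy', hs_def, mul_assoc, -mem_Ioo]
  · have : m.real {y} = 0 := by simpa [atomSet] using hy'
    simp [hy, hy', hs_def, this, -mem_Ioo]
  · simp [hy, -mem_Ioo]
  · simp [hy, -mem_Ioo]

/-- Product rule for the atomic and the continuous factor. The correction term vanishes, since the
continuous part `kc` is zero at every atom. -/
theorem prodExp_eq {k : ℝ → ℂ} (hk : Integrable k m) :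
    Integrable (fun t => k t * prodExp m k t) m ∧
    ∀ x, prodExp m k x = 1 + cumInt m (fun t => k t * prodExp m k t) x := by
  set s : ℝ → ℂ := fun y => m.real {y} * k y with hs_def
  set kc := (atomSet m)ᶜ.indicator k with hkc
  have hkci : Integrable kc m := hk.indicator (measurableSet_atomSet m).compl
  have hat : ∀ t, (m.real {t} : ℂ) * kc t = 0 := by
    intro t
    by_cases ht : t ∈ atomSet m
    · simp [hkc, ht]
    · have : m.real {t} = 0 := by simpa [atomSet] using ht
      simp [this]
  set kd := (atomSet m).indicator fun t => k t * cumProd s t with hkd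
  have hd := fun x => (cumProd_atom_eq hk x).2
  have hdi : Integrable kd m := (cumProd_atom_eq hk 0).1
  set l : ℝ → ℂ := fun t => kc t * Complex.exp (cumInt m kc t) with hl
  have he := exp_cumInt hkci hat
  have hli : Integrable l m := by
    refine hkci.mul_bdd (c := Real.exp (∫ t, ‖kc t‖ ∂m))
      (Complex.continuous_exp.comp_stronglyMeasurable
        (stronglyMeasurable_cumInt hkci)).aestronglyMeasurable (Eventually.of_forall fun t => ?_)
    rw [Complex.norm_exp]
    exact Real.exp_le_exp.2 ((Complex.re_le_norm _).trans (norm_cumInt_le hkci t))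
  have hfun : (fun t => kd t * (1 + cumInt m l t) + l t * (1 + cumInt m kd t) +
      m.real {t} * kd t * l t) = fun t => k t * prodExp m k t := by
    ext t
    rw [← hd, ← he, prodExp]
    have h0 : (m.real {t} : ℂ) * kd t * l t = 0 := by
      rw [hl]
      linear_combination kd t * Complex.exp (cumInt m kc t) * hat t
    rw [h0, hl]
    by_cases ht : t ∈ atomSet m
    · simp only [hkd, hkc, indicator_of_mem ht, indicator_of_notMem (notMem_compl_iff.2 ht)]
      ring
    · simp only [hkd, hkc, indicator_of_notMem ht, indicator_of_mem (mem_compl ht)]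
      ring
  constructor
  · rw [← hfun]
    exact ((integrable_mul_cumInt hli hdi 1).add (integrable_mul_cumInt hdi hli 1)).add
      (integrable_atom_mul_mul hdi hli)
  · intro x
    rw [← hfun]
    have := cumInt_mul_cumInt hdi hli 1 1 x
    rw [one_mul] at this
    rw [← this, ← he, ← hd, prodExp]

end ProductExponential

/-! ### Shrinking sets and a Gronwall lemma -/

section Gronwall

variable {m : Measure ℝ} [IsFiniteMeasure m]

omit [IsFiniteMeasure m] in
theorem tendsto_setIntegral_of_eventually_notMem {ι E : Type*} [NormedAddCommGroup E]
    [NormedSpace ℝ E] {l : Filter ι} [l.IsCountablyGenerated] {I : ι → Set ℝ}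
    (hI : ∀ i, MeasurableSet (I i)) (h : ∀ t, ∀ᶠ i in l, t ∉ I i) {g : ℝ → E}
    (hg : Integrable g m) : Tendsto (fun i => ∫ t in I i, g t ∂m) l (𝓝 0) := by
  simp_rw [← fun i => integral_indicator (μ := m) (f := g) (hI i)]
  rw [← integral_zero ℝ E (μ := m)]
  refine tendsto_integral_filter_of_dominated_convergence (fun t => ‖g t‖)
    (Eventually.of_forall fun i => hg.aestronglyMeasurable.indicator (hI i))
    (Eventually.of_forall fun i => Eventually.of_forall fun t => norm_indicator_le_norm_self _ _)
    hg.norm (Eventually.of_forall fun t => ?_)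
  refine tendsto_const_nhds.congr' ?_
  filter_upwards [h t] with i hi
  simp [hi]

omit [IsFiniteMeasure m] in
/-- A Gronwall lemma: a bounded nonnegative `f` with `f(x) ≤ ∫_(0,x) κ f` vanishes. -/
theorem eq_zero_of_le_setIntegral {c M : ℝ} {f κ : ℝ → ℝ} (hf : ∀ x ∈ Ioc 0 c, 0 ≤ f x)
    (hM : ∀ x ∈ Ioc 0 c, f x ≤ M) (hκ : Integrable κ m) (hκ0 : ∀ t, 0 ≤ κ t)
    (hκf : IntegrableOn (fun t => κ t * f t) (Ioc 0 c) m)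
    (hle : ∀ x ∈ Ioc 0 c, f x ≤ ∫ t in Ioo 0 x, κ t * f t ∂m) : ∀ x ∈ Ioc 0 c, f x = 0 := by
  by_contra! hne
  obtain ⟨x₀, hx₀, hfx₀⟩ := hne
  -- No continuity of $f$ is available. The contradiction comes from showing that the supremum of
  -- `Z` can be moved to the right.
  let Z : Set ℝ := {x | x ∈ Icc 0 c ∧ ∀ y ∈ Ioc 0 x, f y = 0}
  have hc0 : 0 ≤ c := hx₀.1.le.trans hx₀.2
  have hZ0 : (0 : ℝ) ∈ Z := ⟨⟨le_rfl, hc0⟩, fun y hy => absurd hy.1 hy.2.not_gt⟩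
  have hZb : BddAbove Z := ⟨c, fun x hx => hx.1.2⟩
  set s := sSup Z
  have hs0 : 0 ≤ s := le_csSup hZb hZ0
  have hsc : s ≤ c := csSup_le ⟨0, hZ0⟩ fun x hx => hx.1.2
  have hlt : ∀ y ∈ Ioo 0 s, f y = 0 := by
    intro y hy
    obtain ⟨z, hz, hyz⟩ := exists_lt_of_lt_csSup ⟨0, hZ0⟩ hy.2
    exact hz.2 y ⟨hy.1, hyz.le⟩
  -- The bound at $s$ integrates over the open interval $(0,s)$ only, so vanishing extends to $s$
  -- even if $m$ has an atom there.
  have hle' : ∀ y ∈ Ioc 0 s, f y = 0 := by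
    intro y hy
    rcases hy.2.lt_or_eq with h | h
    · exact hlt y ⟨hy.1, h⟩
    · subst h
      have h1 := hle s ⟨hy.1, hsc⟩
      rw [setIntegral_congr_fun measurableSet_Ioo (g := fun _ => 0)
        fun t ht => by simp [hlt t ht]] at h1
      exact le_antisymm (by simpa using h1) (hf s ⟨hy.1, hsc⟩)
  have hsx : s < x₀ := by
    by_contra! h
    exact hfx₀ (hle' x₀ ⟨hx₀.1, h⟩)
  have htend : Tendsto (fun x => ∫ t in Ioo s x, κ t ∂m) (𝓝[>] s) (𝓝 0) := by
    refine tendsto_setIntegral_of_eventually_notMem (fun _ => measurableSet_Ioo) (fun t => ?_) hκ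
    by_cases ht : s < t
    · filter_upwards [Ioo_mem_nhdsGT ht] with x hx h
      exact absurd h.2 hx.2.not_gt
    · exact Eventually.of_forall fun x h => ht h.1
  -- The interval $(s,\delta)$ omits an atom at $s$, so its $\kappa$-mass can be made less than
  -- $\frac12$. Each use of the integral inequality then halves the bound on $f$ over $(s,\delta]$.
  obtain ⟨δ, hδ1, hδ2⟩ : ∃ δ, ∫ t in Ioo s δ, κ t ∂m < 1 / 2 ∧ δ ∈ Ioc s c :=
    ((htend.eventually_lt_const (by norm_num : (0 : ℝ) < 1 / 2)).and
      (Ioc_mem_nhdsGT (hsx.trans_le hx₀.2))).exists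
  have hM0 : 0 ≤ M := (hf x₀ hx₀).trans (hM x₀ hx₀)
  have hpow : ∀ n : ℕ, ∀ x ∈ Ioc s δ, f x ≤ M * (1 / 2) ^ n := by
    intro n
    induction n with
    | zero => intro x hx; simpa using hM x ⟨hs0.trans_lt hx.1, hx.2.trans hδ2.2⟩
    | succ n ih =>
      intro x hx
      have hxc : x ≤ c := hx.2.trans hδ2.2
      calc f x ≤ ∫ t in Ioo 0 x, κ t * f t ∂m := hle x ⟨hs0.trans_lt hx.1, hxc⟩
        _ = ∫ t in Ioo s x, κ t * f t ∂m := by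
          refine setIntegral_eq_of_subset_of_forall_sdiff_eq_zero measurableSet_Ioo
            (Ioo_subset_Ioo_left hs0) fun t ht => ?_
          rw [hle' t ⟨ht.1.1, ?_⟩, mul_zero]
          by_contra! h
          exact ht.2 ⟨h, ht.1.2⟩
        _ ≤ ∫ t in Ioo s x, κ t * (M * (1 / 2) ^ n) ∂m := by
          refine setIntegral_mono_on (hκf.mono_set fun t ht => ⟨hs0.trans_lt ht.1,
            ht.2.le.trans hxc⟩) (hκ.mul_const _).integrableOn measurableSet_Ioo fun t ht => ?_
          exact mul_le_mul_of_nonneg_left (ih t ⟨ht.1, ht.2.le.trans hx.2⟩) (hκ0 t)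
        _ = (∫ t in Ioo s x, κ t ∂m) * (M * (1 / 2) ^ n) := integral_mul_const _ _
        _ ≤ (1 / 2) * (M * (1 / 2) ^ n) := by
          refine mul_le_mul_of_nonneg_right (le_trans ?_ hδ1.le) (by positivity)
          exact setIntegral_mono_set hκ.integrableOn (Eventually.of_forall hκ0)
            (Ioo_subset_Ioo_right hx.2).eventuallyLE
        _ = M * (1 / 2) ^ (n + 1) := by ring
  have hδZ : δ ∈ Z := by
    refine ⟨⟨hs0.trans hδ2.1.le, hδ2.2⟩, fun y hy => ?_⟩
    rcases le_or_gt y s with h | h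
    · exact hle' y ⟨hy.1, h⟩
    · have hlim : Tendsto (fun n : ℕ => M * (1 / 2 : ℝ) ^ n) atTop (𝓝 (M * 0)) :=
        (tendsto_pow_atTop_nhds_zero_of_lt_one (by norm_num) (by norm_num)).const_mul M
      rw [mul_zero] at hlim
      exact le_antisymm (ge_of_tendsto' hlim fun n => hpow n y ⟨h, hy.2⟩)
        (hf y ⟨hy.1, hy.2.trans hδ2.2⟩)
  exact absurd (le_csSup hZb hδZ) hδ2.1.not_ge

end Gronwall

open Matrix

/-! ### Algebra of the jump matrices -/

section Algebra

/-- The matrix `J⁻¹ H`. -/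
def jInvMul (H : Matrix (Fin 2) (Fin 2) ℂ) : Matrix (Fin 2) (Fin 2) ℂ :=
  !![H 1 0, H 1 1; -H 0 0, -H 0 1]

/-- The determinant of `1 - (r/2) J⁻¹ H`. -/
noncomputable def jumpDet (r : ℂ) (H : Matrix (Fin 2) (Fin 2) ℂ) : ℂ :=
  1 - r / 2 * (H 1 0 - H 0 1) + r ^ 2 / 4 * (H 0 0 * H 1 1 - H 0 1 * H 1 0)

/-- The matrix `J⁻¹ H (1 - (r/2) J⁻¹ H)⁻¹`, which drives the left limits of a solution. -/
noncomputable def leftKernel (r : ℂ) (H : Matrix (Fin 2) (Fin 2) ℂ) : Matrix (Fin 2) (Fin 2) ℂ :=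
  (jumpDet r H)⁻¹ • (jInvMul H - (r / 2 * (H 0 0 * H 1 1 - H 0 1 * H 1 0)) • 1)

/-- The scalar that drives the determinant of a fundamental system. -/
noncomputable def detKernel (r : ℂ) (H : Matrix (Fin 2) (Fin 2) ℂ) : ℂ :=
  (H 1 0 - H 0 1) / jumpDet r H

variable (r : ℂ) (H : Matrix (Fin 2) (Fin 2) ℂ) (v : Fin 2 → ℂ)

theorem leftKernel_mulVec_zero : (leftKernel r H *ᵥ v) 0 = (jumpDet r H)⁻¹ *
    ((H 1 0 - r / 2 * (H 0 0 * H 1 1 - H 0 1 * H 1 0)) * v 0 + H 1 1 * v 1) := by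
  simp [leftKernel, jInvMul, Matrix.mulVec, dotProduct, Fin.sum_univ_two, Matrix.one_apply]
  ring

theorem leftKernel_mulVec_one : (leftKernel r H *ᵥ v) 1 = (jumpDet r H)⁻¹ *
    (-H 0 0 * v 0 + (-H 0 1 - r / 2 * (H 0 0 * H 1 1 - H 0 1 * H 1 0)) * v 1) := by
  simp [leftKernel, jInvMul, Matrix.mulVec, dotProduct, Fin.sum_univ_two, Matrix.one_apply]
  ring

theorem jInvMul_mulVec_zero : (jInvMul H *ᵥ v) 0 = H 1 0 * v 0 + H 1 1 * v 1 := by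
  simp [jInvMul, Matrix.mulVec, dotProduct, Fin.sum_univ_two]

theorem jInvMul_mulVec_one : (jInvMul H *ᵥ v) 1 = -(H 0 0 * v 0 + H 0 1 * v 1) := by
  simp [jInvMul, Matrix.mulVec, dotProduct, Fin.sum_univ_two]
  ring

variable {r H}

/-- Put $A=J^{-1}H$. By Cayley–Hamilton $A\operatorname{adj}(1-\frac r2A)=A-\frac r2\det A$, so
`leftKernel` is $A(1-\frac r2A)^{-1}$. The vector in parentheses is $(1-\frac r2A)^{-1}v$, which
recovers the balanced value from the left limit $v$. -/
theorem jInvMul_mulVec_balanced (h : jumpDet r H ≠ 0) :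
    jInvMul H *ᵥ (v + (r / 2) • (leftKernel r H *ᵥ v)) = leftKernel r H *ᵥ v := by
  ext i
  fin_cases i
  · simp only [Fin.zero_eta, jInvMul_mulVec_zero, Pi.add_apply, Pi.smul_apply, smul_eq_mul,
      leftKernel_mulVec_zero, leftKernel_mulVec_one]
    field_simp
    rw [jumpDet]
    ring
  · simp only [Fin.mk_one, jInvMul_mulVec_one, Pi.add_apply, Pi.smul_apply, smul_eq_mul,
      leftKernel_mulVec_zero, leftKernel_mulVec_one]
    field_simp
    rw [jumpDet]
    ring

theorem leftKernel_mulVec_of_balanced {u : Fin 2 → ℂ} (h : jumpDet r H ≠ 0)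
    (hu : u = v + (r / 2) • (jInvMul H *ᵥ u)) : leftKernel r H *ᵥ v = jInvMul H *ᵥ u := by
  have h0 := congrFun hu 0
  have h1 := congrFun hu 1
  simp only [Pi.add_apply, Pi.smul_apply, smul_eq_mul, jInvMul_mulVec_zero,
    jInvMul_mulVec_one] at h0 h1
  have e0 : v 0 = u 0 - r / 2 * (H 1 0 * u 0 + H 1 1 * u 1) := by linear_combination -h0
  have e1 : v 1 = u 1 + r / 2 * (H 0 0 * u 0 + H 0 1 * u 1) := by linear_combination -h1
  ext i
  fin_cases i
  · simp only [Fin.zero_eta, jInvMul_mulVec_zero, leftKernel_mulVec_zero, e0, e1]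
    field_simp
    rw [jumpDet]
    ring
  · simp only [Fin.mk_one, jInvMul_mulVec_one, leftKernel_mulVec_one, e0, e1]
    field_simp
    rw [jumpDet]
    ring

/-- At an atom only the product $rH$ matters. This allows jumps to be expressed through the atoms of
$q$ and $w$, independently of the auxiliary measure. -/
theorem smul_leftKernel (r : ℂ) (H : Matrix (Fin 2) (Fin 2) ℂ) :
    r • leftKernel r H = leftKernel 1 (r • H) := by
  have h : jumpDet 1 (r • H) = jumpDet r H := by
    simp [jumpDet]
    ring
  ext i j
  fin_cases i <;> fin_cases j <;>
    simp [leftKernel, h, jInvMul] <;> ring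

theorem jumpDet_one_smul (r : ℂ) (H : Matrix (Fin 2) (Fin 2) ℂ) :
    jumpDet 1 (r • H) = jumpDet r H := by
  simp [jumpDet]
  ring

/-- Conjugate transposition of $H$ sends the trace of $J^{-1}H$ to minus its conjugate. Consequently
$\det B_+$ and $\det B_-$ are exchanged, up to conjugation, between $\lambda$ and $\bar\lambda$. -/
theorem jumpDet_conjTranspose {r : ℝ} : jumpDet r Hᴴ = conj (jumpDet r (-H)) := by
  simp [jumpDet, Matrix.conjTranspose_apply, map_ofNat]
  ring

theorem jumpDet_zero (H : Matrix (Fin 2) (Fin 2) ℂ) : jumpDet 0 H = 1 := by simp [jumpDet]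

/-- Write $d_\pm$ for the kernels of $\pm H$. The identity is $(1+rd_+)(1+rd_-)=1$ with a factor $r$
cancelled, and it remains valid for $r=0$; it makes the two scalar solutions reciprocal. -/
theorem detKernel_add_neg (h : jumpDet r H ≠ 0) (h' : jumpDet r (-H) ≠ 0) :
    detKernel r H + detKernel r (-H) + r * detKernel r H * detKernel r (-H) = 0 := by
  simp only [detKernel]
  field_simp
  simp only [jumpDet, Matrix.neg_apply]
  ring

theorem one_add_detKernel (h : jumpDet r H ≠ 0) :
    1 + r * detKernel r H = jumpDet r (-H) / jumpDet r H := by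
  simp only [detKernel]
  field_simp
  simp only [jumpDet, Matrix.neg_apply]
  ring

/-- The product rule identity behind `conj (V / τ)` solving the conjugate equation. -/
theorem leftKernel_conjTranspose_mulVec {r : ℝ} {H : Matrix (Fin 2) (Fin 2) ℂ}
    (h : jumpDet r H ≠ 0) (h' : jumpDet r (-H) ≠ 0) (v : Fin 2 → ℂ) (s : ℂ) (i : Fin 2) :
    conj ((leftKernel r H *ᵥ v) i * s + detKernel r (-H) * s * v i +
      r * (leftKernel r H *ᵥ v) i * (detKernel r (-H) * s)) =
    (leftKernel r Hᴴ *ᵥ fun j => conj (v j * s)) i := by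
  have hc : (starRingEnd ℂ) (jumpDet r H) ≠ 0 := by simpa using h
  have hc' : (starRingEnd ℂ) (jumpDet r (-H)) ≠ 0 := by simpa using h'
  -- At an atom this is the relation $M_{\bar\lambda}=\overline{M_\lambda/\det M_\lambda}$ for the
  -- jump $M=1+rK$, with the identity part removed and $r$ cancelled. After clearing both jump
  -- determinants it is a polynomial identity in each component.
  fin_cases i
  · simp only [Fin.zero_eta, leftKernel_mulVec_zero, detKernel, jumpDet_conjTranspose, map_add,
      map_mul, map_sub, map_div₀, map_inv₀, Complex.conj_ofReal, Matrix.conjTranspose_apply,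
      Complex.star_def, Matrix.neg_apply, map_neg, map_ofNat]
    field_simp
    simp only [jumpDet, Matrix.neg_apply, map_add, map_sub, map_mul, map_div₀, map_pow, map_neg,
      Complex.conj_ofReal, map_one, map_ofNat]
    ring
  · simp only [Fin.mk_one, leftKernel_mulVec_one, detKernel, jumpDet_conjTranspose, map_add,
      map_mul, map_sub, map_div₀, map_inv₀, Complex.conj_ofReal, Matrix.conjTranspose_apply,
      Complex.star_def, Matrix.neg_apply, map_neg, map_ofNat]
    field_simp
    simp only [jumpDet, Matrix.neg_apply, map_add, map_sub, map_mul, map_div₀, map_pow, map_neg,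
      Complex.conj_ofReal, map_one, map_ofNat]
    ring

end Algebra

/-! ### Volterra equations for left limits -/

section Volterra

variable {m : Measure ℝ} [IsFiniteMeasure m] {H : ℝ → Matrix (Fin 2) (Fin 2) ℂ} {c : ℝ}

/-- An integrable matrix density for which all jump matrices are invertible. -/
structure IsRegularDensity (m : Measure ℝ) (H : ℝ → Matrix (Fin 2) (Fin 2) ℂ) : Prop where
  meas : ∀ i j, StronglyMeasurable fun t => H t i j
  int : ∀ i j, Integrable (fun t => H t i j) m
  det : ∀ t, jumpDet (m.real {t}) (H t) ≠ 0

theorem stronglyMeasurable_atom : StronglyMeasurable fun t : ℝ => (m.real {t} : ℂ) :=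
  (Complex.measurable_ofReal.comp (measurable_atom m)).stronglyMeasurable

namespace IsRegularDensity

theorem stronglyMeasurable_inv_jumpDet (h : IsRegularDensity m H) :
    StronglyMeasurable fun t => (jumpDet (m.real {t}) (H t))⁻¹ := by
  have h1 : Measurable fun t : ℝ => (m.real {t} : ℂ) := stronglyMeasurable_atom.measurable
  have h2 := fun i j => (h.meas i j).measurable
  refine Measurable.stronglyMeasurable (Measurable.inv ?_)
  unfold jumpDet
  fun_prop

omit [IsFiniteMeasure m] in
-- The atomic masses $m(\{t\})H(t)$ are summable, so all but finitely many are small enough to give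
-- $|\det-1|\le\frac12$. The finitely many exceptions are absorbed by adding their inverses to the
-- constant $2$.
theorem exists_bound_inv_jumpDet (h : IsRegularDensity m H) :
    ∃ C, ∀ t, ‖(jumpDet (m.real {t}) (H t))⁻¹‖ ≤ C := by
  let s : ℝ → ℝ := fun t => ∑ i, ∑ j, ‖(m.real {t} : ℂ) * H t i j‖
  have hs : Summable s := summable_sum fun i _ => summable_sum fun j _ => summable_atom_mul (h.int i j)
  have hfin : {t | ¬ s t < 1 / 2}.Finite :=
    (hs.tendsto_cofinite_zero.eventually_lt_const (by norm_num : (0 : ℝ) < 1 / 2))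
  refine ⟨2 + ∑ t ∈ hfin.toFinset, ‖(jumpDet (m.real {t}) (H t))⁻¹‖, fun t => ?_⟩
  by_cases ht : s t < 1 / 2
  · have h1 : ‖jumpDet (m.real {t}) (H t) - 1‖ ≤ 1 / 2 := by
      have hle : ∀ i j, ‖(m.real {t} : ℂ) * H t i j‖ ≤ 1 / 2 := by
        intro i j
        refine le_trans ?_ ht.le
        refine le_trans ?_ (Finset.single_le_sum (f := fun i => ∑ j, ‖(m.real {t} : ℂ) * H t i j‖)
          (fun i _ => Finset.sum_nonneg fun j _ => norm_nonneg _) (Finset.mem_univ i))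
        exact Finset.single_le_sum (f := fun j => ‖(m.real {t} : ℂ) * H t i j‖)
          (fun j _ => norm_nonneg _) (Finset.mem_univ j)
      set r : ℂ := (m.real {t} : ℂ)
      have hst : s t = ‖r * H t 0 0‖ + ‖r * H t 0 1‖ + (‖r * H t 1 0‖ + ‖r * H t 1 1‖) := by
        simp [s, Fin.sum_univ_two, r]
      have h2 : jumpDet r (H t) - 1 = (-(1 / 2) * (r * H t 1 0) + 1 / 2 * (r * H t 0 1)) +
          (1 / 4 * ((r * H t 0 0) * (r * H t 1 1)) +
          -(1 / 4) * ((r * H t 0 1) * (r * H t 1 0))) := by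
        rw [jumpDet]
        ring
      rw [h2]
      refine (norm_add_le _ _).trans ?_
      refine (add_le_add (norm_add_le _ _) (norm_add_le _ _)).trans ?_
      simp only [norm_mul (-(1 / 2 : ℂ)), norm_mul (1 / 2 : ℂ), norm_mul (1 / 4 : ℂ),
        norm_mul (-(1 / 4 : ℂ)), norm_mul (r * H t 0 0), norm_mul (r * H t 0 1)]
      norm_num
      have a1 := norm_nonneg (r * H t 0 0)
      have a2 := norm_nonneg (r * H t 0 1)
      have a3 := norm_nonneg (r * H t 1 0)
      have a4 := norm_nonneg (r * H t 1 1)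
      have b1 := hle 0 0
      have b2 := hle 0 1
      have b3 := hle 1 0
      have b4 := hle 1 1
      simp only [norm_mul] at *
      nlinarith
    have h3 : 1 / 2 ≤ ‖jumpDet (m.real {t}) (H t)‖ := by
      have h4 := norm_sub_norm_le (1 : ℂ) (1 - jumpDet (m.real {t}) (H t))
      rw [sub_sub_cancel, norm_one, norm_sub_rev] at h4
      linarith
    rw [norm_inv]
    refine (inv_anti₀ (by norm_num) h3).trans ?_
    have : 0 ≤ ∑ t ∈ hfin.toFinset, ‖(jumpDet (m.real {t}) (H t))⁻¹‖ :=
      Finset.sum_nonneg fun t _ => norm_nonneg _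
    norm_num
    simpa using this
  · have := Finset.single_le_sum (f := fun t => ‖(jumpDet (m.real {t}) (H t))⁻¹‖)
      (fun t _ => norm_nonneg _) (hfin.mem_toFinset.2 ht)
    linarith

theorem integrable_detKernel (h : IsRegularDensity m H) :
    Integrable (fun t => detKernel (m.real {t}) (H t)) m := by
  obtain ⟨C, hC⟩ := h.exists_bound_inv_jumpDet
  simp only [detKernel, div_eq_mul_inv]
  exact ((h.int 1 0).sub (h.int 0 1)).mul_bdd
    h.stronglyMeasurable_inv_jumpDet.aestronglyMeasurable (Eventually.of_forall hC)

theorem integrable_leftKernel (h : IsRegularDensity m H) (i j : Fin 2) :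
    Integrable (fun t => leftKernel (m.real {t}) (H t) i j) m := by
  obtain ⟨C, hC⟩ := h.exists_bound_inv_jumpDet
  have h1 : Integrable (fun t => jInvMul (H t) i j) m := by
    fin_cases i <;> fin_cases j
    · exact h.int 1 0
    · exact h.int 1 1
    · exact (h.int 0 0).neg
    · exact (h.int 0 1).neg
  -- The determinant term is quadratic in the density, but the atom times one entry is bounded, so
  -- it is still integrable.
  have h2 : Integrable (fun t => ((m.real {t} : ℂ) * H t 0 0 * H t 1 1 -
      m.real {t} * H t 0 1 * H t 1 0) * (1 / 2 * (1 : Matrix (Fin 2) (Fin 2) ℂ) i j)) m :=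
    ((integrable_atom_mul_mul (h.int 0 0) (h.int 1 1)).sub
      (integrable_atom_mul_mul (h.int 0 1) (h.int 1 0))).mul_const _
  refine ((h1.sub h2).bdd_mul h.stronglyMeasurable_inv_jumpDet.aestronglyMeasurable
    (Eventually.of_forall hC)).congr (Eventually.of_forall fun t => ?_)
  simp only [leftKernel, Pi.sub_apply, Matrix.smul_apply, Matrix.sub_apply, smul_eq_mul]
  ring

end IsRegularDensity

/-- `V` solves `V(x) = ξ + ∫_(0,x) k V dm` on `(0,c]`. -/
structure IsVolterra (m : Measure ℝ) (k : ℝ → Matrix (Fin 2) (Fin 2) ℂ) (c : ℝ) (ξ : Fin 2 → ℂ)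
    (V : ℝ → Fin 2 → ℂ) : Prop where
  int : ∀ i, Integrable (fun t => (k t *ᵥ V t) i) m
  eq : ∀ x ∈ Ioc 0 c, ∀ i, V x i = ξ i + cumInt m (fun t => (k t *ᵥ V t) i) x

theorem ae_mem_Ioc (hm : m (Ioc 0 c)ᶜ = 0) : ∀ᵐ t ∂m, t ∈ Ioc 0 c := by
  rwa [ae_iff]

theorem cumInt_congr {k l : ℝ → ℂ} {x : ℝ} (h : ∀ t ∈ Ioo 0 x, k t = l t) :
    cumInt m k x = cumInt m l x := setIntegral_congr_fun measurableSet_Ioo h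

theorem cumInt_conj (k : ℝ → ℂ) (x : ℝ) :
    cumInt m (fun t => conj (k t)) x = conj (cumInt m k x) := integral_conj

namespace IsVolterra

variable {k : ℝ → Matrix (Fin 2) (Fin 2) ℂ} {ξ η : Fin 2 → ℂ} {V U : ℝ → Fin 2 → ℂ}

theorem add (hV : IsVolterra m k c ξ V) (hU : IsVolterra m k c η U) :
    IsVolterra m k c (ξ + η) (V + U) := by
  have h : ∀ i, (fun t => (k t *ᵥ (V + U) t) i) =
      fun t => (k t *ᵥ V t) i + (k t *ᵥ U t) i := fun i => by
    ext t
    rw [Pi.add_apply, mulVec_add, Pi.add_apply]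
  refine ⟨fun i => by rw [h]; exact (hV.int i).add (hU.int i), fun x hx i => ?_⟩
  rw [h, Pi.add_apply, Pi.add_apply, hV.eq x hx i, hU.eq x hx i, cumInt, cumInt, cumInt,
    integral_add (hV.int i).integrableOn (hU.int i).integrableOn, Pi.add_apply]
  ring

theorem smul (hV : IsVolterra m k c ξ V) (a : ℂ) : IsVolterra m k c (a • ξ) (a • V) := by
  have h : ∀ i, (fun t => (k t *ᵥ (a • V) t) i) = fun t => a * (k t *ᵥ V t) i := fun i => by
    ext t
    rw [Pi.smul_apply, mulVec_smul, Pi.smul_apply, smul_eq_mul]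
  refine ⟨fun i => by rw [h]; exact (hV.int i).const_mul a, fun x hx i => ?_⟩
  rw [h, Pi.smul_apply, Pi.smul_apply, hV.eq x hx i, cumInt, cumInt, integral_const_mul,
    Pi.smul_apply, smul_eq_mul, smul_eq_mul]
  ring

theorem norm_le (hV : IsVolterra m k c ξ V) {x : ℝ} (hx : x ∈ Ioc 0 c) (i : Fin 2) :
    ‖V x i‖ ≤ ‖ξ i‖ + ∫ t, ‖(k t *ᵥ V t) i‖ ∂m := by
  rw [hV.eq x hx i]
  exact (norm_add_le _ _).trans (add_le_add_right (norm_cumInt_le (hV.int i) x) _)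

/-- Uniqueness of solutions of a Volterra equation. -/
theorem unique (hk : ∀ i j, Integrable (fun t => k t i j) m) (hV : IsVolterra m k c ξ V)
    (hU : IsVolterra m k c ξ U) : ∀ x ∈ Ioc 0 c, V x = U x := by
  have hD := hV.add (hU.smul (-1))
  set D := V + (-1 : ℂ) • U with hD_def
  let κ : ℝ → ℝ := fun t => ∑ i, ∑ j, ‖k t i j‖
  have hκ : Integrable κ m := integrable_finsetSum _ fun i _ => integrable_finsetSum _ fun j _ =>
    (hk i j).norm
  have hκ0 : ∀ t, 0 ≤ κ t := fun t => Finset.sum_nonneg fun i _ => Finset.sum_nonneg fun j _ =>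
    norm_nonneg _
  let f : ℝ → ℝ := fun t => ‖D t 0‖ + ‖D t 1‖
  have hpt : ∀ t, ‖(k t *ᵥ D t) 0‖ + ‖(k t *ᵥ D t) 1‖ ≤ κ t * f t := by
    intro t
    have h1 : ∀ i, ‖(k t *ᵥ D t) i‖ ≤ ‖k t i 0‖ * ‖D t 0‖ + ‖k t i 1‖ * ‖D t 1‖ := fun i => by
      simp only [mulVec, dotProduct, Fin.sum_univ_two, ← norm_mul]
      exact norm_add_le _ _
    have h2 : κ t = ‖k t 0 0‖ + ‖k t 0 1‖ + (‖k t 1 0‖ + ‖k t 1 1‖) := by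
      simp [κ, Fin.sum_univ_two]
    rw [h2]
    simp only [f]
    nlinarith [h1 0, h1 1, norm_nonneg (k t 0 0), norm_nonneg (k t 0 1), norm_nonneg (k t 1 0),
      norm_nonneg (k t 1 1), norm_nonneg (D t 0), norm_nonneg (D t 1),
      mul_nonneg (norm_nonneg (k t 0 0)) (norm_nonneg (D t 1)),
      mul_nonneg (norm_nonneg (k t 0 1)) (norm_nonneg (D t 0)),
      mul_nonneg (norm_nonneg (k t 1 0)) (norm_nonneg (D t 1)),
      mul_nonneg (norm_nonneg (k t 1 1)) (norm_nonneg (D t 0))]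
  set M := ∑ i, (‖(ξ + (-1 : ℂ) • ξ) i‖ + ∫ t, ‖(k t *ᵥ D t) i‖ ∂m) with hM_def
  have hM : ∀ x ∈ Ioc 0 c, f x ≤ M := fun x hx => by
    rw [hM_def, Fin.sum_univ_two]
    exact add_le_add (hD.norm_le hx 0) (hD.norm_le hx 1)
  have hf0 : ∀ x, 0 ≤ f x := fun x => add_nonneg (norm_nonneg _) (norm_nonneg _)
  have hmeas : ∀ i, AEStronglyMeasurable (fun t => D t i) (m.restrict (Ioc 0 c)) := fun i => by
    refine ((stronglyMeasurable_cumInt (hD.int i)).aestronglyMeasurable.const_add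
      ((ξ + (-1 : ℂ) • ξ) i)).congr ?_
    filter_upwards [ae_restrict_mem measurableSet_Ioc] with t ht
    rw [hD.eq t ht i]
  have hκf : IntegrableOn (fun t => κ t * f t) (Ioc 0 c) m := by
    refine hκ.restrict.mul_bdd (c := M) ((hmeas 0).norm.add (hmeas 1).norm) ?_
    filter_upwards [ae_restrict_mem measurableSet_Ioc] with t ht
    exact (Real.norm_of_nonneg (hf0 t)).le.trans (hM t ht)
  have hzero := eq_zero_of_le_setIntegral (fun x _ => hf0 x) hM hκ hκ0 hκf fun x hx => by
    have h1 : ∀ i, ‖D x i‖ ≤ ∫ t in Ioo 0 x, ‖(k t *ᵥ D t) i‖ ∂m := fun i => by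
      rw [hD.eq x hx i]
      simp only [Pi.add_apply, Pi.smul_apply, smul_eq_mul, neg_mul, one_mul, add_neg_cancel,
        zero_add]
      exact norm_integral_le_integral_norm _
    calc f x ≤ ∫ t in Ioo 0 x, (‖(k t *ᵥ D t) 0‖ + ‖(k t *ᵥ D t) 1‖) ∂m := by
          rw [integral_add (hD.int 0).norm.integrableOn (hD.int 1).norm.integrableOn]
          exact add_le_add (h1 0) (h1 1)
      _ ≤ _ := setIntegral_mono_on ((hD.int 0).norm.add (hD.int 1).norm).integrableOn
          (hκf.mono_set fun t ht => ⟨ht.1, ht.2.le.trans hx.2⟩) measurableSet_Ioo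
          fun t _ => hpt t
  intro x hx
  have h := hzero x hx
  have h0 : D x 0 = 0 := norm_eq_zero.1 (by
    linarith [norm_nonneg (D x 0), norm_nonneg (D x 1), show ‖D x 0‖ + ‖D x 1‖ = 0 from h])
  have h1 : D x 1 = 0 := norm_eq_zero.1 (by
    linarith [norm_nonneg (D x 0), norm_nonneg (D x 1), show ‖D x 0‖ + ‖D x 1‖ = 0 from h])
  ext i
  have : D x i = 0 := by fin_cases i <;> assumption
  simpa [hD_def, ← sub_eq_add_neg, sub_eq_zero] using this

end IsVolterra

/-- The product rule integrand for the two factors vanishes by `detKernel_add_neg`, so the product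
keeps its initial value $1$. -/
theorem prodExp_mul_prodExp_neg (hm : IsRegularDensity m H) (hm' : IsRegularDensity m (-H)) (x : ℝ) :
    prodExp m (fun t => detKernel (m.real {t}) (H t)) x *
      prodExp m (fun t => detKernel (m.real {t}) (-H t)) x = 1 := by
  obtain ⟨i1, e1⟩ := prodExp_eq hm.integrable_detKernel
  obtain ⟨i2, e2⟩ := prodExp_eq hm'.integrable_detKernel
  simp only [Pi.neg_apply] at i2 e2
  rw [e1, e2, cumInt_mul_cumInt i1 i2, cumInt_congr (l := fun _ => 0)]
  · simp [cumInt]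
  · intro t _
    rw [← e1, ← e2]
    have := detKernel_add_neg (hm.det t) (hm'.det t)
    linear_combination prodExp m (fun t => detKernel (m.real {t}) (H t)) t *
      prodExp m (fun t => detKernel (m.real {t}) (-H t)) t * this

/-- Dividing a solution by `τ` and conjugating gives a solution of the adjoint equation. -/
theorem IsVolterra.conj_mul_prodExp {ξ : Fin 2 → ℂ} {V : ℝ → Fin 2 → ℂ} (hc : m (Ioc 0 c)ᶜ = 0)
    (hm : IsRegularDensity m H) (hm' : IsRegularDensity m (-H))
    (hV : IsVolterra m (fun t => leftKernel (m.real {t}) (H t)) c ξ V) :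
    IsVolterra m (fun t => leftKernel (m.real {t}) (H t)ᴴ) c (fun i => conj (ξ i))
      (fun t i => conj (V t i * prodExp m (fun t => detKernel (m.real {t}) (-H t)) t)) := by
  obtain ⟨i2, e2⟩ := prodExp_eq hm'.integrable_detKernel
  simp only [Pi.neg_apply] at i2 e2
  set S := prodExp m (fun t => detKernel (m.real {t}) (-H t))
  -- The product rule integrand of $V_iS$, where $S$ will be $1/\tau$. Its conjugate is the kernel
  -- of $H^*$ applied to $\overline{VS}$, and $H^*$ belongs to $\bar\lambda$.
  let g : Fin 2 → ℝ → ℂ := fun i t => (leftKernel (m.real {t}) (H t) *ᵥ V t) i *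
    (1 + cumInt m (fun t => detKernel (m.real {t}) (-H t) * S t) t) +
    detKernel (m.real {t}) (-H t) * S t * (ξ i + cumInt m (fun t =>
      (leftKernel (m.real {t}) (H t) *ᵥ V t) i) t) + m.real {t} *
      (leftKernel (m.real {t}) (H t) *ᵥ V t) i * (detKernel (m.real {t}) (-H t) * S t)
  have hgi : ∀ i, Integrable (g i) m := fun i =>
    ((integrable_mul_cumInt i2 (hV.int i) 1).add (integrable_mul_cumInt (hV.int i) i2 (ξ i))).add
      (integrable_atom_mul_mul (hV.int i) i2)
  have hg : ∀ i, ∀ t ∈ Ioc 0 c, conj (g i t) =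
      (leftKernel (m.real {t}) (H t)ᴴ *ᵥ fun j => conj (V t j * S t)) i := by
    intro i t ht
    rw [← leftKernel_conjTranspose_mulVec (hm.det t) (hm'.det t)]
    simp only [g]
    rw [← e2, ← hV.eq t ht i]
  refine ⟨fun i => ?_, fun x hx i => ?_⟩
  · refine ((Complex.conjCLE.toContinuousLinearMap).integrable_comp (hgi i)).congr ?_
    filter_upwards [ae_mem_Ioc hc] with t ht
    exact hg i t ht
  · rw [← cumInt_congr fun t ht => hg i t ⟨ht.1, ht.2.le.trans hx.2⟩, cumInt_conj, hV.eq x hx i,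
      e2 x, cumInt_mul_cumInt (hV.int i) i2, mul_one, map_add]

end Volterra

open LocalMatrixMeasure (quadForm)

/-! ### The energy identity -/

section Energy

/-- The left side is the product rule density of $V_1\overline{V_2}$. Replacing left limits by
balanced values, $v=u-\frac r2a$, absorbs the atomic correction exactly and leaves
$a_1\overline{u_2}+\overline{a_2}u_1$. In its imaginary part the Hermitian $Q$ cancels and $W$
survives with the factor $\operatorname{Im}\lambda$. -/
theorem im_boundaryForm_eq {Q W : Matrix (Fin 2) (Fin 2) ℂ} (hQ : Q.IsHermitian)
    (hW : W.IsHermitian) (lam : ℂ) (r : ℝ) (u : Fin 2 → ℂ) {v a : Fin 2 → ℂ}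
    (ha : a = jInvMul (lam • W - Q) *ᵥ u) (hv : u = v + ((r : ℂ) / 2) • a) :
    (a 0 * conj (v 1) + conj (a 1) * v 0 + r * a 0 * conj (a 1)).im = lam.im * quadForm W u := by
  have hv0 : v 0 = u 0 - r / 2 * a 0 := by
    have := congrFun hv 0
    simp only [Pi.add_apply, Pi.smul_apply, smul_eq_mul] at this
    linear_combination -this
  have hv1 : v 1 = u 1 - r / 2 * a 1 := by
    have := congrFun hv 1
    simp only [Pi.add_apply, Pi.smul_apply, smul_eq_mul] at this
    linear_combination -this
  have h1 : a 0 * conj (v 1) + conj (a 1) * v 0 + r * a 0 * conj (a 1) =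
      a 0 * conj (u 1) + conj (a 1) * u 0 := by
    rw [hv0, hv1]
    simp only [map_sub, map_mul, map_div₀, Complex.conj_ofReal, map_ofNat]
    ring
  have ha0 : a 0 = (lam * W 1 0 - Q 1 0) * u 0 + (lam * W 1 1 - Q 1 1) * u 1 := by
    rw [ha, jInvMul_mulVec_zero]; simp
  have ha1 : a 1 = -((lam * W 0 0 - Q 0 0) * u 0 + (lam * W 0 1 - Q 0 1) * u 1) := by
    rw [ha, jInvMul_mulVec_one]; simp
  have w01 : W 0 1 = conj (W 1 0) := (hW.apply 0 1).symm
  have q01 : Q 0 1 = conj (Q 1 0) := (hQ.apply 0 1).symm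
  have w0 : (W 0 0).im = 0 := Complex.conj_eq_iff_im.1 (hW.apply 0 0)
  have w1 : (W 1 1).im = 0 := Complex.conj_eq_iff_im.1 (hW.apply 1 1)
  have q0 : (Q 0 0).im = 0 := Complex.conj_eq_iff_im.1 (hQ.apply 0 0)
  have q1 : (Q 1 1).im = 0 := Complex.conj_eq_iff_im.1 (hQ.apply 1 1)
  rw [h1, ha0, ha1, quadForm, w01, q01]
  simp only [Fin.sum_univ_two, w01, Complex.add_im, Complex.mul_im, Complex.mul_re, Complex.sub_re,
    Complex.sub_im, Complex.conj_re, Complex.conj_im, Complex.neg_re, Complex.neg_im,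
    Complex.add_re, w0, w1, q0, q1]
  ring

variable {m : Measure ℝ} [IsFiniteMeasure m] {Q W : ℝ → Matrix (Fin 2) (Fin 2) ℂ} {c : ℝ}
  {lam : ℂ} {ξ : Fin 2 → ℂ} {V : ℝ → Fin 2 → ℂ}

/-- The balanced function with left limits `V`. -/
noncomputable def balancedOf (m : Measure ℝ) (H : ℝ → Matrix (Fin 2) (Fin 2) ℂ)
    (V : ℝ → Fin 2 → ℂ) (t : ℝ) : Fin 2 → ℂ :=
  V t + ((m.real {t} : ℂ) / 2) • (leftKernel (m.real {t}) (H t) *ᵥ V t)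

/-- The energy identity. -/
theorem IsVolterra.im_mul_conj (hQ : ∀ t, (Q t).IsHermitian) (hW : ∀ t, (W t).IsHermitian)
    (hm : IsRegularDensity m fun t => lam • W t - Q t)
    (hV : IsVolterra m (fun t => leftKernel (m.real {t}) (lam • W t - Q t)) c ξ V) {x : ℝ}
    (hx : x ∈ Ioc 0 c) : (V x 0 * conj (V x 1)).im = (ξ 0 * conj (ξ 1)).im +
      lam.im * ∫ t in Ioo 0 x, quadForm (W t)
        (balancedOf m (fun t => lam • W t - Q t) V t) ∂m := by
  set H := fun t => lam • W t - Q t with hH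
  set a : Fin 2 → ℝ → ℂ := fun i t => (leftKernel (m.real {t}) (H t) *ᵥ V t) i with ha
  have hc1 : Integrable (fun t => conj (a 1 t)) m :=
    (Complex.conjCLE.toContinuousLinearMap).integrable_comp (hV.int 1)
  have h0 : V x 0 = ξ 0 + cumInt m (a 0) x := hV.eq x hx 0
  have h1 : ∀ t ∈ Ioc 0 c, conj (V t 1) = conj (ξ 1) + cumInt m (fun t => conj (a 1 t)) t :=
    fun t ht => by rw [cumInt_conj, hV.eq t ht 1, map_add]
  have hint := ((integrable_mul_cumInt hc1 (hV.int 0) (conj (ξ 1))).add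
    (integrable_mul_cumInt (hV.int 0) hc1 (ξ 0))).add (integrable_atom_mul_mul (hV.int 0) hc1)
  rw [h0, h1 x hx, cumInt_mul_cumInt (hV.int 0) hc1, Complex.add_im]
  congr 1
  rw [cumInt, ← integral_const_mul]
  refine Eq.trans (integral_im hint.integrableOn).symm ?_
  refine setIntegral_congr_fun measurableSet_Ioo fun t ht => ?_
  have ht' : t ∈ Ioc 0 c := ⟨ht.1, ht.2.le.trans hx.2⟩
  simp only [Pi.add_apply, RCLike.im_eq_complex_im]
  rw [← h1 t ht', ← hV.eq t ht' 0]
  exact im_boundaryForm_eq (hQ t) (hW t) lam _ (balancedOf m H V t)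
    (a := leftKernel (m.real {t}) (H t) *ᵥ V t)
    (jInvMul_mulVec_balanced _ (hm.det t)).symm rfl

end Energy

/-! ### Measurability and boundedness of functions of bounded variation -/

section BoundedVariation

theorem BoundedVariationOn.measurable_real {f : ℝ → ℝ} (hf : BoundedVariationOn f univ) :
    Measurable f := by
  obtain ⟨p, q, hp, hq, rfl⟩ := hf.locallyBoundedVariationOn.exists_monotoneOn_sub_monotoneOn
  exact (monotoneOn_univ.1 hp).measurable.sub (monotoneOn_univ.1 hq).measurable

theorem BoundedVariationOn.measurable_complex {f : ℝ → ℂ} (hf : BoundedVariationOn f univ) :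
    Measurable f := by
  have h1 : Measurable fun x => (f x).re :=
    (Complex.reCLM.lipschitz.comp_boundedVariationOn hf).measurable_real
  have h2 : Measurable fun x => (f x).im :=
    (Complex.imCLM.lipschitz.comp_boundedVariationOn hf).measurable_real
  exact measurable_of_re_im h1 h2

theorem BoundedVariationOn.exists_norm_le {f : ℝ → ℂ} (hf : BoundedVariationOn f univ) :
    ∃ C, ∀ x, ‖f x‖ ≤ C := by
  refine ⟨‖f 0‖ + (eVariationOn f univ).toReal, fun x => ?_⟩
  have h := hf.dist_le (mem_univ x) (mem_univ 0)
  rw [dist_eq_norm] at h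
  calc ‖f x‖ = ‖f 0 + (f x - f 0)‖ := by rw [add_sub_cancel]
    _ ≤ _ := (norm_add_le _ _).trans (add_le_add_right h _)

end BoundedVariation

/-! ### From the differential equation to the Volterra equation -/

section Solutions

variable {b : EReal} {q w : LocalMatrixMeasure b} {c : ℝ} {lam : ℂ}

/-- A finite measure on `(0,c]` together with Hermitian densities of `q` and `w`. -/
structure CommonDensity (q w : LocalMatrixMeasure b) (c : ℝ) where
  mem : c ∈ openInt b
  m : Measure ℝ
  fin : IsFiniteMeasure m
  supp : m (Ioc 0 c)ᶜ = 0
  Q : ℝ → Matrix (Fin 2) (Fin 2) ℂ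
  W : ℝ → Matrix (Fin 2) (Fin 2) ℂ
  hQ : q.IsDensity c m Q
  hW : w.IsDensity c m W

attribute [instance] CommonDensity.fin

theorem nonempty_commonDensity (hq : q.IsHermitian) (hw : w.IsNonneg) (hc : c ∈ openInt b) :
    Nonempty (CommonDensity q w c) := by
  obtain ⟨m, h1, h2, Q, W, h3, h4⟩ := LocalMatrixMeasure.exists_common_density hq hw hc
  exact ⟨⟨hc, m, h1, h2, Q, W, h3, h4⟩⟩

/-- The jump matrix `lam Δ_w(t) - Δ_q(t)`. -/
noncomputable def jumpMat (q w : LocalMatrixMeasure b) (lam : ℂ) (t : ℝ) : Matrix (Fin 2) (Fin 2) ℂ :=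
  lam • w.atom t - q.atom t

theorem det_matBPlus (q w : LocalMatrixMeasure b) (t : ℝ) (lam : ℂ) :
    (matBPlus q w t lam).det = jumpDet 1 (jumpMat q w lam t) := by
  simp [matBPlus, jumpDet, jumpMat, Matrix.det_fin_two, matJ]
  ring

theorem det_matBMinus (q w : LocalMatrixMeasure b) (t : ℝ) (lam : ℂ) :
    (matBMinus q w t lam).det = jumpDet 1 (-jumpMat q w lam t) := by
  simp [matBMinus, jumpDet, jumpMat, Matrix.det_fin_two, matJ]
  ring

namespace CommonDensity

/-- The density of `lam w - q`. -/
def H (D : CommonDensity q w c) (lam : ℂ) (t : ℝ) : Matrix (Fin 2) (Fin 2) ℂ :=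
  lam • D.W t - D.Q t

variable (D : CommonDensity q w c)

theorem ae_mem : ∀ᵐ t ∂D.m, t ∈ Ioc 0 c := ae_mem_Ioc D.supp

theorem atom_smul_H (lam : ℂ) {t : ℝ} (ht : t ∈ Ioc 0 c) :
    (D.m.real {t} : ℂ) • D.H lam t = jumpMat q w lam t := by
  rw [jumpMat, D.hQ.atom_eq D.mem.2 ht, D.hW.atom_eq D.mem.2 ht, H, smul_sub,
    smul_comm lam]

theorem measureReal_singleton_eq_zero {t : ℝ} (ht : t ∉ Ioc 0 c) : D.m.real {t} = 0 := by
  rw [measureReal_def, measure_mono_null (singleton_subset_iff.2 ht) D.supp, ENNReal.toReal_zero]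

theorem H_conjTranspose (t : ℝ) : (D.H lam t)ᴴ = D.H (conj lam) t := by
  rw [H, H, conjTranspose_sub, conjTranspose_smul, (D.hW.herm t).eq, (D.hQ.herm t).eq]
  rfl

theorem isRegularDensity (hlam : lam ∉ badSet q w) : IsRegularDensity D.m (D.H lam) := by
  refine ⟨fun i j => ?_, fun i j => ?_, fun t => ?_⟩
  · exact ((D.hW.meas i j).const_mul lam).sub (D.hQ.meas i j)
  · exact ((D.hW.int i j).const_mul lam).sub (D.hQ.int i j)
  · by_cases ht : t ∈ Ioc 0 c
    · rw [← jumpDet_one_smul, D.atom_smul_H lam ht, ← det_matBPlus]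
      intro h0
      exact hlam ⟨t, ⟨ht.1, (EReal.coe_le_coe_iff.2 ht.2).trans_lt D.mem.2⟩, by rw [h0, zero_mul]⟩
    · rw [D.measureReal_singleton_eq_zero ht, Complex.ofReal_zero, jumpDet_zero]
      exact one_ne_zero

theorem isRegularDensity_neg (hlam : lam ∉ badSet q w) : IsRegularDensity D.m (-D.H lam) := by
  have h := D.isRegularDensity hlam
  refine ⟨fun i j => (h.meas i j).neg, fun i j => (h.int i j).neg, fun t => ?_⟩
  by_cases ht : t ∈ Ioc 0 c
  · rw [Pi.neg_apply, ← jumpDet_one_smul, smul_neg, D.atom_smul_H lam ht, ← det_matBMinus]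
    intro h0
    exact hlam ⟨t, ⟨ht.1, (EReal.coe_le_coe_iff.2 ht.2).trans_lt D.mem.2⟩, by rw [h0, mul_zero]⟩
  · rw [D.measureReal_singleton_eq_zero ht, Complex.ofReal_zero, jumpDet_zero]
    exact one_ne_zero

/-- The kernel of the Volterra equation for the left limits of solutions. -/
noncomputable def kernel (lam : ℂ) (t : ℝ) : Matrix (Fin 2) (Fin 2) ℂ :=
  leftKernel (D.m.real {t}) (D.H lam t)

end CommonDensity

/-- The balanced function with left limits `V`, in terms of the atoms of `q` and `w`. -/
noncomputable def balance (q w : LocalMatrixMeasure b) (lam : ℂ) (V : ℝ → Fin 2 → ℂ) (t : ℝ) :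
    Fin 2 → ℂ :=
  V t + (1 / 2 : ℂ) • (leftKernel 1 (jumpMat q w lam t) *ᵥ V t)

/-- The measure depends on $c$, but `balance` does not, so a single function on $(0,b)$ serves all
the local densities. -/
theorem CommonDensity.balance_eq (D : CommonDensity q w c) (V : ℝ → Fin 2 → ℂ) {t : ℝ}
    (ht : t ∈ Ioc 0 c) : balance q w lam V t = balancedOf D.m (D.H lam) V t := by
  rw [balance, balancedOf, ← D.atom_smul_H lam ht, ← smul_leftKernel, smul_mulVec, smul_smul]
  congr 2
  ring

section Forward

variable {u : ℝ → Fin 2 → ℂ}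

/-- The function `u` frozen outside `[0,c]`. -/
def clamp {α : Type*} (u : ℝ → α) (c : ℝ) (x : ℝ) : α := u (max 0 (min x c))

theorem clamp_of_mem {α : Type*} (u : ℝ → α) {x : ℝ} (hx : x ∈ Icc 0 c) : clamp u c x = u x := by
  rw [clamp, min_eq_left hx.2, max_eq_right hx.1]

theorem LocallyBoundedVariationOn.clamp {α : Type*} [PseudoEMetricSpace α] {u : ℝ → α}
    (hu : LocallyBoundedVariationOn u (halfOpen b)) (hc : c ∈ openInt b) :
    BoundedVariationOn (clamp u c) univ := by
  have h0 : (0 : ℝ) ∈ halfOpen b :=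
    ⟨le_rfl, (EReal.coe_le_coe_iff.2 hc.1.le).trans_lt hc.2⟩
  have h1 := hu 0 c h0 ⟨hc.1.le, hc.2⟩
  refine ne_top_of_le_ne_top h1 (eVariationOn.comp_le_of_monotoneOn u (fun x => max 0 (min x c))
    (fun x _ y _ hxy => max_le_max le_rfl (min_le_min hxy le_rfl)) fun x _ => ?_)
  have h2 : max 0 (min x c) ≤ c := max_le hc.1.le (min_le_right _ _)
  exact ⟨⟨le_max_left _ _, (EReal.coe_le_coe_iff.2 h2).trans_lt hc.2⟩, le_max_left _ _, h2⟩

theorem LocallyBoundedVariationOn.clamp_apply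
    (hu : LocallyBoundedVariationOn u (halfOpen b)) (hc : c ∈ openInt b) (j : Fin 2) :
    BoundedVariationOn (_root_.clamp (fun x => u x j) c) univ :=
  (LipschitzWith.eval j).comp_boundedVariationOn (hu.clamp hc)

theorem clamp_eventuallyEq_left {α : Type*} (u : ℝ → α) {x : ℝ} (hx : x ∈ Ioc 0 c) :
    clamp u c =ᶠ[𝓝[<] x] u := by
  filter_upwards [Ioo_mem_nhdsLT hx.1] with t ht
  exact clamp_of_mem u ⟨ht.1.le, ht.2.le.trans hx.2⟩

theorem clamp_eventuallyEq_right {α : Type*} (u : ℝ → α) {x : ℝ} (hx : x ∈ Ico 0 c) :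
    clamp u c =ᶠ[𝓝[>] x] u := by
  filter_upwards [Ioo_mem_nhdsGT hx.2] with t ht
  exact clamp_of_mem u ⟨hx.1.trans ht.1.le, ht.2.le⟩

theorem LocallyBoundedVariationOn.tendsto_left (hu : LocallyBoundedVariationOn u (halfOpen b))
    {x : ℝ} (hx : x ∈ openInt b) : Tendsto u (𝓝[<] x) (𝓝 (Function.leftLim u x)) := by
  have h := ((hu.clamp hx).tendsto_leftLim x).congr' (clamp_eventuallyEq_left u ⟨hx.1, le_rfl⟩)
  rwa [← leftLim_eq_of_tendsto h] at h

theorem exists_gt_mem_openInt {x : ℝ} (hx : x ∈ openInt b) : ∃ c, x < c ∧ c ∈ openInt b := by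
  obtain ⟨c, h1, h2⟩ := EReal.lt_iff_exists_real_btwn.1 hx.2
  have h1' : x < c := EReal.coe_lt_coe_iff.1 h1
  exact ⟨c, h1', hx.1.trans h1', h2⟩

theorem LocallyBoundedVariationOn.tendsto_right (hu : LocallyBoundedVariationOn u (halfOpen b))
    {x : ℝ} (hx : x ∈ openInt b) : Tendsto u (𝓝[>] x) (𝓝 (Function.rightLim u x)) := by
  obtain ⟨c, hxc, hc⟩ := exists_gt_mem_openInt hx
  have h := ((hu.clamp hc).tendsto_rightLim x).congr' (clamp_eventuallyEq_right u ⟨hx.1.le, hxc⟩)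
  rwa [← rightLim_eq_of_tendsto h] at h

theorem stieltjes_eq {f : ℝ → ℂ} (hf : BoundedVariationOn (clamp f c) univ) :
    stieltjes f c = hf.vectorMeasure := dif_pos hf

namespace LocallyBoundedVariationOn

theorem aestronglyMeasurable (hu : LocallyBoundedVariationOn u (halfOpen b)) (D : CommonDensity q w c) (j : Fin 2)
    {E : Set ℝ} (hE : MeasurableSet E) (hEc : E ⊆ Icc 0 c) :
    AEStronglyMeasurable (fun t => u t j) (D.m.restrict E) := by
  refine (hu.clamp_apply D.mem j).measurable_complex.aestronglyMeasurable
    |>.congr ?_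
  filter_upwards [ae_restrict_mem hE] with t ht
  exact clamp_of_mem _ (hEc ht)

theorem exists_bound (hu : LocallyBoundedVariationOn u (halfOpen b)) (hc : c ∈ openInt b) (j : Fin 2) :
    ∃ C, ∀ t ∈ Icc 0 c, ‖u t j‖ ≤ C := by
  obtain ⟨C, hC⟩ := (hu.clamp_apply hc j).exists_norm_le
  refine ⟨C, fun t ht => ?_⟩
  have := hC t
  rwa [clamp_of_mem _ ht] at this

theorem integrableOn_mul (hu : LocallyBoundedVariationOn u (halfOpen b)) (D : CommonDensity q w c) (j : Fin 2)
    {k : ℝ → ℂ} (hk : Integrable k D.m) {E : Set ℝ} (hE : MeasurableSet E) (hEc : E ⊆ Icc 0 c) :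
    IntegrableOn (fun t => u t j * k t) E D.m := by
  obtain ⟨C, hC⟩ := hu.exists_bound D.mem j
  refine hk.restrict.bdd_mul (c := C) (hu.aestronglyMeasurable D j hE hEc) ?_
  filter_upwards [ae_restrict_mem hE] with t ht
  exact hC t (hEc ht)

/-- The equation `J u' = (lam w - q) u` on a Borel set, in terms of densities. -/
theorem equation_iff (hu : LocallyBoundedVariationOn u (halfOpen b)) (lam : ℂ)
    (D : CommonDensity q w c) {E : Set ℝ} (hE : MeasurableSet E) (hEc : E ⊆ Ioo 0 c) :
    (∀ i, ∑ j, matJ i j * stieltjes (fun x => u x j) c E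
        + ∑ j, q.integralOn c E i j (fun x => u x j)
      = lam * ∑ j, w.integralOn c E i j (fun x => u x j)) ↔
    ∀ i, stieltjes (fun x => u x i) c E = ∫ t in E, (jInvMul (D.H lam t) *ᵥ u t) i ∂D.m := by
  have hE1 : E ⊆ Icc 0 c := hEc.trans Ioo_subset_Icc_self
  have hE2 : E ⊆ Ioc 0 c := hEc.trans Ioo_subset_Ioc_self
  have hqi : ∀ i j, q.integralOn c E i j (fun x => u x j) = ∫ t in E, u t j * D.Q t i j ∂D.m := by
    intro i j
    obtain ⟨C, hC⟩ := hu.exists_bound D.mem j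
    exact D.hQ.integralOn_eq le_rfl D.mem.2 i j hE hE2 (hu.aestronglyMeasurable D j hE hE1)
      fun x hx => hC x (hE1 hx)
  have hwi : ∀ i j, w.integralOn c E i j (fun x => u x j) = ∫ t in E, u t j * D.W t i j ∂D.m := by
    intro i j
    obtain ⟨C, hC⟩ := hu.exists_bound D.mem j
    exact D.hW.integralOn_eq le_rfl D.mem.2 i j hE hE2 (hu.aestronglyMeasurable D j hE hE1)
      fun x hx => hC x (hE1 hx)
  have hQint := fun i j => hu.integrableOn_mul D j (D.hQ.int i j) hE hE1
  have hWint := fun i j => hu.integrableOn_mul D j (D.hW.int i j) hE hE1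
  have hHint : ∀ i j, IntegrableOn (fun t => D.H lam t i j * u t j) E D.m := fun i j => by
    refine (((hWint i j).const_mul lam).sub (hQint i j)).congr (Eventually.of_forall fun t => ?_)
    simp only [CommonDensity.H, Pi.sub_apply, Matrix.sub_apply, Matrix.smul_apply, smul_eq_mul]
    ring
  have hsum : ∀ i, ∫ t in E, (D.H lam t i 0 * u t 0 + D.H lam t i 1 * u t 1) ∂D.m =
      lam * ∑ j, w.integralOn c E i j (fun x => u x j) -
        ∑ j, q.integralOn c E i j (fun x => u x j) := by
    intro i
    have hj : ∀ j, ∫ t in E, D.H lam t i j * u t j ∂D.m =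
        lam * w.integralOn c E i j (fun x => u x j) - q.integralOn c E i j (fun x => u x j) := by
      intro j
      rw [hqi, hwi, ← integral_const_mul, ← integral_sub ((hWint i j).const_mul lam) (hQint i j)]
      refine integral_congr_ae (Eventually.of_forall fun t => ?_)
      simp only [CommonDensity.H, Matrix.sub_apply, Matrix.smul_apply, smul_eq_mul]
      ring
    rw [integral_add (hHint i 0) (hHint i 1), hj, hj, Fin.sum_univ_two, Fin.sum_univ_two]
    ring
  have hJ : ∀ i, ∑ j, matJ i j * stieltjes (fun x => u x j) c E =
      matJ i 0 * stieltjes (fun x => u x 0) c E + matJ i 1 * stieltjes (fun x => u x 1) c E :=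
    fun i => Fin.sum_univ_two _
  rw [Fin.forall_fin_two, Fin.forall_fin_two, hJ, hJ]
  simp only [matJ, of_apply, cons_val_zero, cons_val_one, cons_val', cons_val_fin_one, zero_mul,
    zero_add, one_mul, neg_mul, add_zero, jInvMul_mulVec_zero, jInvMul_mulVec_one, integral_neg]
  rw [hsum 1, hsum 0]
  constructor
  · rintro ⟨h0, h1⟩
    exact ⟨by linear_combination h1, by linear_combination -h0⟩
  · rintro ⟨h0, h1⟩
    exact ⟨by linear_combination -h1, by linear_combination h0⟩

end LocallyBoundedVariationOn

namespace IsSolution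

theorem stieltjes_eq_setIntegral (hu : IsSolution q w lam u) (D : CommonDensity q w c) {E : Set ℝ}
    (hE : MeasurableSet E) (hEc : E ⊆ Ioo 0 c) (i : Fin 2) :
    stieltjes (fun x => u x i) c E = ∫ t in E, (jInvMul (D.H lam t) *ᵥ u t) i ∂D.m :=
  (hu.locallyBoundedVariation.equation_iff lam D hE hEc).1 (hu.equation c D.mem E hE hEc) i

/-- The equation evaluated on the singleton $\{t\}$. -/
theorem rightLim_sub_leftLim (hu : IsSolution q w lam u) (D : CommonDensity q w c) {t : ℝ}
    (ht : t ∈ Ioo 0 c) : Function.rightLim u t - Function.leftLim u t =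
      (D.m.real {t} : ℂ) • (jInvMul (D.H lam t) *ᵥ u t) := by
  have htb : t ∈ openInt b := ⟨ht.1, (EReal.coe_lt_coe_iff.2 ht.2).trans D.mem.2⟩
  ext i
  have hbv := hu.locallyBoundedVariation.clamp_apply D.mem i
  have h1 := hu.stieltjes_eq_setIntegral D (measurableSet_singleton t) (singleton_subset_iff.2 ht) i
  rw [stieltjes_eq hbv, hbv.vectorMeasure_singleton, integral_singleton_eq] at h1
  have hl : Function.leftLim (clamp (fun x => u x i) c) t = Function.leftLim u t i := by
    refine leftLim_eq_of_tendsto ?_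
    refine Tendsto.congr' (clamp_eventuallyEq_left (fun x => u x i) ⟨ht.1, ht.2.le⟩).symm ?_
    exact tendsto_pi_nhds.1 (hu.locallyBoundedVariation.tendsto_left htb) i
  have hr : Function.rightLim (clamp (fun x => u x i) c) t = Function.rightLim u t i := by
    refine rightLim_eq_of_tendsto ?_
    refine Tendsto.congr' (clamp_eventuallyEq_right (fun x => u x i) ⟨ht.1.le, ht.2⟩).symm ?_
    exact tendsto_pi_nhds.1 (hu.locallyBoundedVariation.tendsto_right htb) i
  rw [hl, hr] at h1
  exact h1

theorem eq_leftLim_add (hu : IsSolution q w lam u) (D : CommonDensity q w c) {t : ℝ}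
    (ht : t ∈ Ioo 0 c) : u t = Function.leftLim u t +
      ((D.m.real {t} : ℂ) / 2) • (jInvMul (D.H lam t) *ᵥ u t) := by
  have htb : t ∈ openInt b := ⟨ht.1, (EReal.coe_lt_coe_iff.2 ht.2).trans D.mem.2⟩
  have h1 := hu.rightLim_sub_leftLim D ht
  have h2 := hu.balanced t htb
  have h3 : ((D.m.real {t} : ℂ) / 2) • (jInvMul (D.H lam t) *ᵥ u t) =
      (1 / 2 : ℂ) • (Function.rightLim u t - Function.leftLim u t) := by
    rw [h1, smul_smul]
    congr 1
    ring
  rw [h3, h2]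
  module

theorem kernel_mulVec_leftLim (hlam : lam ∉ badSet q w) (hu : IsSolution q w lam u)
    (D : CommonDensity q w c) {t : ℝ} (ht : t ∈ Ioo 0 c) :
    D.kernel lam t *ᵥ Function.leftLim u t = jInvMul (D.H lam t) *ᵥ u t :=
  leftKernel_mulVec_of_balanced _ ((D.isRegularDensity hlam).det t) (hu.eq_leftLim_add D ht)

theorem eq_balance (hq : q.IsHermitian) (hw : w.IsNonneg) (hlam : lam ∉ badSet q w)
    (hu : IsSolution q w lam u) {t : ℝ} (ht : t ∈ openInt b) :
    u t = balance q w lam (Function.leftLim u) t := by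
  obtain ⟨c, htc, hc⟩ := exists_gt_mem_openInt ht
  obtain ⟨D⟩ := nonempty_commonDensity hq hw hc
  rw [D.balance_eq _ ⟨ht.1, htc.le⟩, balancedOf]
  have := hu.kernel_mulVec_leftLim hlam D ⟨ht.1, htc⟩
  rw [CommonDensity.kernel] at this
  rw [this]
  exact hu.eq_leftLim_add D ⟨ht.1, htc⟩

/-- Evaluated on $(0,x)$ the Stieltjes measure of $u$ is $u(x^-)-u(0^+)$, and $u(0^+)=u(0)$. The
density is then rewritten in terms of left limits. -/
theorem leftLim_eq_add_setIntegral (hlam : lam ∉ badSet q w) (hu : IsSolution q w lam u)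
    (D : CommonDensity q w c) {x : ℝ} (hx : x ∈ Ioc 0 c) (i : Fin 2) : Function.leftLim u x i =
      u 0 i + cumInt D.m (fun t => (D.kernel lam t *ᵥ Function.leftLim u t) i) x := by
  have hxb : x ∈ openInt b := ⟨hx.1, (EReal.coe_le_coe_iff.2 hx.2).trans_lt D.mem.2⟩
  have hbv := hu.locallyBoundedVariation.clamp_apply D.mem i
  have h1 := hu.stieltjes_eq_setIntegral D (measurableSet_Ioo (a := 0) (b := x))
    (Ioo_subset_Ioo_right hx.2) i
  rw [stieltjes_eq hbv, hbv.vectorMeasure_Ioo hx.1] at h1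
  have hl : Function.leftLim (clamp (fun x => u x i) c) x = Function.leftLim u x i := by
    refine leftLim_eq_of_tendsto ?_
    refine Tendsto.congr' (clamp_eventuallyEq_left (fun x => u x i) hx).symm ?_
    exact tendsto_pi_nhds.1 (hu.locallyBoundedVariation.tendsto_left hxb) i
  have hr : Function.rightLim (clamp (fun x => u x i) c) 0 = u 0 i := by
    refine rightLim_eq_of_tendsto ?_
    refine Tendsto.congr' (clamp_eventuallyEq_right (fun x => u x i) ⟨le_rfl, D.mem.1⟩).symm ?_
    exact tendsto_pi_nhds.1 hu.tendsto_zero i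
  rw [hl, hr] at h1
  rw [← sub_eq_iff_eq_add', h1, cumInt]
  refine setIntegral_congr_fun measurableSet_Ioo fun t ht => ?_
  simp only [hu.kernel_mulVec_leftLim hlam D ⟨ht.1, ht.2.trans_le hx.2⟩]

theorem isVolterra (hlam : lam ∉ badSet q w) (hu : IsSolution q w lam u)
    (D : CommonDensity q w c) : IsVolterra D.m (D.kernel lam) c (u 0) (Function.leftLim u) := by
  refine ⟨fun i => ?_, fun x hx i => hu.leftLim_eq_add_setIntegral hlam D hx i⟩
  have hreg := D.isRegularDensity hlam
  have h1 : ∀ j, Integrable (fun t => D.kernel lam t i j * Function.leftLim u t j) D.m := by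
    intro j
    obtain ⟨C, hC⟩ := (hu.locallyBoundedVariation.clamp_apply D.mem j).leftLim.exists_norm_le
    have h2 := (hreg.integrable_leftKernel i j).mul_bdd
      (hu.locallyBoundedVariation.clamp_apply D.mem j).leftLim.measurable_complex.aestronglyMeasurable
      (Eventually.of_forall hC)
    refine h2.congr ?_
    filter_upwards [D.ae_mem] with t ht
    have htb : t ∈ openInt b := ⟨ht.1, (EReal.coe_le_coe_iff.2 ht.2).trans_lt D.mem.2⟩
    have hl : Function.leftLim (clamp (fun x => u x j) c) t = Function.leftLim u t j := by
      refine leftLim_eq_of_tendsto ?_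
      refine Tendsto.congr' (clamp_eventuallyEq_left (fun x => u x j) ht).symm ?_
      exact tendsto_pi_nhds.1 (hu.locallyBoundedVariation.tendsto_left htb) j
    rw [hl]
    rfl
  refine ((h1 0).add (h1 1)).congr (Eventually.of_forall fun t => ?_)
  simp only [mulVec, dotProduct, Fin.sum_univ_two, Pi.add_apply]

end IsSolution

end Forward

end Solutions

/-! ### Balanced indefinite integrals -/

section IndefiniteIntegral

variable {E : Type*} [NormedAddCommGroup E] [NormedSpace ℝ E] {m : Measure ℝ}

/-- The balanced indefinite integral of `g`. -/
noncomputable def balancedInt (m : Measure ℝ) (g : ℝ → E) (t : ℝ) : E :=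
  ∫ s in Iio t, g s ∂m + (m.real {t} / 2) • g t

theorem setIntegral_Iio_sub [CompleteSpace E] {g : ℝ → E} (hg : Integrable g m) {s t : ℝ}
    (h : s ≤ t) : ∫ x in Iio t, g x ∂m - ∫ x in Iio s, g x ∂m = ∫ x in Ico s t, g x ∂m := by
  rw [← Iio_union_Ico_eq_Iio h, setIntegral_union _ measurableSet_Ico hg.integrableOn
    hg.integrableOn, add_sub_cancel_left]
  exact Set.disjoint_left.2 fun x hx hx' => not_lt.2 hx'.1 hx

theorem balancedInt_sub [CompleteSpace E] {g : ℝ → E} (hg : Integrable g m) {s t : ℝ}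
    (h : s < t) : balancedInt m g t - balancedInt m g s =
      (m.real {s} / 2) • g s + ∫ x in Ioo s t, g x ∂m + (m.real {t} / 2) • g t := by
  have h1 := setIntegral_Iio_sub hg h.le
  rw [← Ioo_union_left h, setIntegral_union (by simp) (measurableSet_singleton s)
    hg.integrableOn hg.integrableOn, integral_singleton] at h1
  have h2 : m.real {s} • g s = (m.real {s} / 2) • g s + (m.real {s} / 2) • g s := by
    rw [← add_smul, add_halves]
  rw [h2] at h1
  rw [balancedInt, balancedInt, add_sub_add_comm, h1]
  abel

/-- An increment consists of half an atom at either end and the integral over the open interval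
between, and each piece is bounded by its counterpart for $\|g\|$. So the variation is controlled by
a monotone function. -/
theorem norm_balancedInt_sub_le [CompleteSpace E] {g : ℝ → E} (hg : Integrable g m) {s t : ℝ}
    (h : s ≤ t) : ‖balancedInt m g t - balancedInt m g s‖ ≤
      balancedInt m (fun x => ‖g x‖) t - balancedInt m (fun x => ‖g x‖) s := by
  rcases h.eq_or_lt with rfl | h
  · simp
  rw [balancedInt_sub hg h, balancedInt_sub hg.norm h]
  refine (norm_add₃_le).trans (add_le_add (add_le_add ?_ (norm_integral_le_integral_norm _)) ?_)
  all_goals rw [norm_smul, Real.norm_of_nonneg (by positivity), smul_eq_mul]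

theorem monotone_balancedInt_norm [CompleteSpace E] {g : ℝ → E} (hg : Integrable g m) :
    Monotone (balancedInt m fun x => ‖g x‖) := fun _ _ h =>
  sub_nonneg.1 ((norm_nonneg _).trans (norm_balancedInt_sub_le hg h))

theorem eVariationOn_le_of_edist_le {α F G : Type*} [LinearOrder α] [PseudoEMetricSpace F]
    [PseudoEMetricSpace G] {f : α → F} {g : α → G} {s : Set α}
    (h : ∀ x ∈ s, ∀ y ∈ s, edist (f x) (f y) ≤ edist (g x) (g y)) :
    eVariationOn f s ≤ eVariationOn g s := by
  refine iSup_le fun p => ?_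
  refine (Finset.sum_le_sum fun i _ => ?_).trans
    (eVariationOn.sum_le (f := g) (s := s) (n := p.1) p.2.2.1 fun i => p.2.2.2 i)
  exact h _ (p.2.2.2 _) _ (p.2.2.2 _)

theorem eVariationOn_balancedInt_ne_top [CompleteSpace E] {g : ℝ → E} (hg : Integrable g m)
    (x y : ℝ) : eVariationOn (balancedInt m g) (Icc x y) ≠ ⊤ := by
  rcases lt_or_ge y x with h | h
  · simp [Icc_eq_empty_of_lt h]
  refine ne_top_of_le_ne_top ?_ (eVariationOn_le_of_edist_le
    (g := balancedInt m fun x => ‖g x‖) fun s _ t _ => ?_)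
  · have := ((monotone_balancedInt_norm hg).monotoneOn (Icc x y)).eVariationOn_eq
      (left_mem_Icc.2 h) (right_mem_Icc.2 h)
    rw [inter_self] at this
    exact this ▸ ENNReal.ofReal_ne_top
  · rw [edist_dist, edist_dist]
    refine ENNReal.ofReal_le_ofReal ?_
    rw [dist_eq_norm, Real.dist_eq]
    rcases le_total s t with hst | hst
    · rw [norm_sub_rev, abs_sub_comm]
      exact (norm_balancedInt_sub_le hg hst).trans (le_abs_self _)
    · exact (norm_balancedInt_sub_le hg hst).trans (le_abs_self _)

/-- As $t\to x$ with $t\ne x$, the sets $\{t\}$ eventually avoid any given point, so dominated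
convergence makes the half-atom terms vanish in one-sided limits. -/
theorem tendsto_atom_smul [CompleteSpace E] {g : ℝ → E} (hg : Integrable g m) (x : ℝ) :
    Tendsto (fun t => (m.real {t} / 2) • g t) (𝓝[≠] x) (𝓝 0) := by
  have h := tendsto_setIntegral_of_eventually_notMem (m := m) (l := 𝓝[≠] x) (I := fun t => {t})
    (fun t => measurableSet_singleton t) (fun t => ?_) hg
  · have h2 := h.const_smul (1 / 2 : ℝ)
    rw [smul_zero] at h2
    refine h2.congr fun t => ?_
    rw [integral_singleton, smul_smul]
    congr 1
    ring
  · rcases eq_or_ne t x with rfl | h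
    · filter_upwards [self_mem_nhdsWithin] with s hs using fun h => hs h.symm
    · filter_upwards [mem_nhdsWithin_of_mem_nhds (isOpen_ne.mem_nhds h.symm)] with s hs
      exact fun h => hs h.symm

theorem tendsto_balancedInt_left [CompleteSpace E] {g : ℝ → E} (hg : Integrable g m) (x : ℝ) :
    Tendsto (balancedInt m g) (𝓝[<] x) (𝓝 (∫ s in Iio x, g s ∂m)) := by
  have h := tendsto_setIntegral_of_eventually_notMem (m := m) (l := 𝓝[<] x) (I := fun t => Ico t x)
    (fun t => measurableSet_Ico) (fun t => ?_) hg
  · have h2 := (h.const_sub (∫ s in Iio x, g s ∂m)).add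
      ((tendsto_atom_smul hg x).mono_left (nhdsWithin_mono x fun y hy => ne_of_lt hy))
    rw [sub_zero, add_zero] at h2
    refine h2.congr' ?_
    filter_upwards [self_mem_nhdsWithin] with t ht
    rw [← setIntegral_Iio_sub hg (le_of_lt ht), sub_sub_cancel, balancedInt]
  · rcases lt_or_ge t x with ht | ht
    · filter_upwards [Ioo_mem_nhdsLT ht] with s hs using fun h => not_lt.2 h.1 hs.1
    · exact Eventually.of_forall fun s h => not_lt.2 ht h.2

theorem tendsto_balancedInt_right [CompleteSpace E] {g : ℝ → E} (hg : Integrable g m) (x : ℝ) :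
    Tendsto (balancedInt m g) (𝓝[>] x) (𝓝 (∫ s in Iio x, g s ∂m + m.real {x} • g x)) := by
  have h := tendsto_setIntegral_of_eventually_notMem (m := m) (l := 𝓝[>] x) (I := fun t => Ioo x t)
    (fun t => measurableSet_Ioo) (fun t => ?_) hg
  · have h2 := (h.const_add (∫ s in Iio x, g s ∂m + m.real {x} • g x)).add
      ((tendsto_atom_smul hg x).mono_left (nhdsWithin_mono x fun y hy => ne_of_gt hy))
    rw [add_zero, add_zero] at h2
    refine h2.congr' ?_
    filter_upwards [self_mem_nhdsWithin] with t ht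
    have h3 := setIntegral_Iio_sub hg (le_of_lt ht)
    rw [← Ioo_union_left (mem_Ioi.1 ht), setIntegral_union (by simp) (measurableSet_singleton x)
      hg.integrableOn hg.integrableOn, integral_singleton] at h3
    rw [balancedInt, sub_eq_iff_eq_add'.1 h3]
    abel
  · rcases lt_or_ge x t with ht | ht
    · filter_upwards [Ioo_mem_nhdsGT ht] with s hs using fun h => not_lt.2 hs.2.le h.2
    · exact Eventually.of_forall fun s h => not_lt.2 ht h.1

end IndefiniteIntegral

/-! ### From the Volterra equation back to the differential equation -/

section Backward

variable {b : EReal} {q w : LocalMatrixMeasure b} {c : ℝ} {lam : ℂ} {ξ : Fin 2 → ℂ}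
  {V v : ℝ → Fin 2 → ℂ}

theorem CommonDensity.Ioo_ae_eq_Iio (D : CommonDensity q w c) (t : ℝ) :
    Ioo 0 t =ᵐ[D.m] Iio t := by
  filter_upwards [D.ae_mem] with x hx
  exact propext ⟨fun h => h.2, fun h => ⟨hx.1, h⟩⟩

theorem CommonDensity.setIntegral_Iio_zero {E : Type*} [NormedAddCommGroup E] [NormedSpace ℝ E]
    (D : CommonDensity q w c) (g : ℝ → E) : ∫ t in Iio 0, g t ∂D.m = 0 := by
  rw [← setIntegral_congr_set (D.Ioo_ae_eq_Iio 0), Ioo_self, setIntegral_empty]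

/-- Because the measure is carried by $(0,c]$, integrating over $(-\infty,t)$ or $(0,t)$ makes no
difference. All one-sided limits and the variation of $v$ are read off from this representation. -/
theorem CommonDensity.eq_add_balancedInt (D : CommonDensity q w c)
    (hV : IsVolterra D.m (D.kernel lam) c ξ V)
    (hv0 : v 0 = ξ) (hv : ∀ t ∈ openInt b, v t = balance q w lam V t) {t : ℝ} (ht : t ∈ Icc 0 c) :
    v t = ξ + balancedInt D.m (fun s => D.kernel lam s *ᵥ V s) t := by
  rcases ht.1.eq_or_lt with rfl | h0
  · rw [hv0, balancedInt, D.setIntegral_Iio_zero, D.measureReal_singleton_eq_zero (by simp)]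
    simp
  · have ht' : t ∈ Ioc 0 c := ⟨h0, ht.2⟩
    rw [hv t ⟨h0, (EReal.coe_le_coe_iff.2 ht.2).trans_lt D.mem.2⟩, D.balance_eq _ ht', balancedOf,
      balancedInt, ← setIntegral_congr_set (D.Ioo_ae_eq_Iio t)]
    ext i
    simp only [Pi.add_apply, Pi.smul_apply]
    rw [hV.eq t ht', eval_integral (fun i => (hV.int i).restrict) i, cumInt, add_assoc,
      Complex.real_smul]
    simp [CommonDensity.kernel]

variable (hV : ∀ (c : ℝ) (D : CommonDensity q w c), IsVolterra D.m (D.kernel lam) c ξ V)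
  (hv0 : v 0 = ξ) (hv : ∀ t ∈ openInt b, v t = balance q w lam V t)

include hV hv0 hv

theorem CommonDensity.tendsto_left (D : CommonDensity q w c) {x : ℝ} (hx : x ∈ Ioc 0 c) :
    Tendsto v (𝓝[<] x) (𝓝 (V x)) := by
  have hV' := hV c D
  have h := (tendsto_balancedInt_left (Integrable.of_eval hV'.int) x).const_add ξ
  have h2 : ξ + ∫ s in Iio x, D.kernel lam s *ᵥ V s ∂D.m = V x := by
    rw [← setIntegral_congr_set (D.Ioo_ae_eq_Iio x)]
    ext i
    rw [hV'.eq x hx i, Pi.add_apply, eval_integral (fun i => (hV'.int i).restrict) i, cumInt]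
  rw [h2] at h
  refine h.congr' ?_
  filter_upwards [Ioo_mem_nhdsLT hx.1] with t ht
  exact (D.eq_add_balancedInt hV' hv0 hv ⟨ht.1.le, ht.2.le.trans hx.2⟩).symm

theorem CommonDensity.tendsto_right (D : CommonDensity q w c) {x : ℝ} (hx : x ∈ Ioo 0 c) :
    Tendsto v (𝓝[>] x) (𝓝 (V x + (D.m.real {x}) • (D.kernel lam x *ᵥ V x))) := by
  have hV' := hV c D
  have h := (tendsto_balancedInt_right (Integrable.of_eval hV'.int) x).const_add ξ
  have h2 : ξ + ∫ s in Iio x, D.kernel lam s *ᵥ V s ∂D.m = V x := by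
    rw [← setIntegral_congr_set (D.Ioo_ae_eq_Iio x)]
    ext i
    rw [hV'.eq x ⟨hx.1, hx.2.le⟩ i, Pi.add_apply, eval_integral (fun i => (hV'.int i).restrict) i,
      cumInt]
  rw [← add_assoc, h2] at h
  refine h.congr' ?_
  filter_upwards [Ioo_mem_nhdsGT hx.2] with t ht
  exact (D.eq_add_balancedInt hV' hv0 hv ⟨hx.1.le.trans ht.1.le, ht.2.le⟩).symm

theorem CommonDensity.tendsto_zero (D : CommonDensity q w c) : Tendsto v (𝓝[>] 0) (𝓝 ξ) := by
  have hV' := hV c D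
  have h := (tendsto_balancedInt_right (Integrable.of_eval hV'.int) 0).const_add ξ
  rw [D.setIntegral_Iio_zero, D.measureReal_singleton_eq_zero (by simp), zero_smul, add_zero,
    add_zero] at h
  refine h.congr' ?_
  filter_upwards [Ioo_mem_nhdsGT D.mem.1] with t ht
  exact (D.eq_add_balancedInt hV' hv0 hv ⟨ht.1.le, ht.2.le⟩).symm

theorem CommonDensity.eVariationOn_ne_top (D : CommonDensity q w c) {x y : ℝ} (hx : 0 ≤ x)
    (hy : y ≤ c) : eVariationOn v (Icc x y) ≠ ⊤ := by
  have h : EqOn v (fun t => ξ + balancedInt D.m (fun s => D.kernel lam s *ᵥ V s) t) (Icc x y) :=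
    fun t ht => D.eq_add_balancedInt (hV c D) hv0 hv ⟨hx.trans ht.1, ht.2.trans hy⟩
  rw [eVariationOn.congr h]
  refine ne_top_of_le_ne_top
    (eVariationOn_balancedInt_ne_top (Integrable.of_eval (hV c D).int) x y)
    (eVariationOn_le_of_edist_le fun s _ t _ => ?_)
  simp

theorem CommonDensity.stieltjes_eq (D : CommonDensity q w c)
    (hbv : LocallyBoundedVariationOn v (halfOpen b)) {E : Set ℝ} (hE : MeasurableSet E)
    (hEc : E ⊆ Ioo 0 c) (i : Fin 2) :
    stieltjes (fun x => v x i) c E = ∫ t in E, (D.kernel lam t *ᵥ V t) i ∂D.m := by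
  have hV' := hV c D
  have hi := hbv.clamp_apply D.mem i
  rw [_root_.stieltjes_eq hi]
  have hr : Function.rightLim (clamp (fun x => v x i) c) 0 = ξ i := by
    refine rightLim_eq_of_tendsto ?_
    refine Tendsto.congr' (clamp_eventuallyEq_right (fun x => v x i) ⟨le_rfl, D.mem.1⟩).symm ?_
    exact tendsto_pi_nhds.1 (D.tendsto_zero hV hv0 hv) i
  have hIoo : ∀ x ∈ Ioc 0 c, hi.vectorMeasure (Ioo 0 x) =
      D.m.withDensityᵥ (fun t => (D.kernel lam t *ᵥ V t) i) (Ioo 0 x) := by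
    intro x hx
    have hl : Function.leftLim (clamp (fun x => v x i) c) x = V x i := by
      refine leftLim_eq_of_tendsto ?_
      refine Tendsto.congr' (clamp_eventuallyEq_left (fun x => v x i) hx).symm ?_
      exact tendsto_pi_nhds.1 (D.tendsto_left hV hv0 hv hx) i
    rw [hi.vectorMeasure_Ioo hx.1, hl, hr, withDensityᵥ_apply (hV'.int i) measurableSet_Ioo,
      hV'.eq x hx i, add_sub_cancel_left, cumInt]
  have hext : hi.vectorMeasure.restrict (Ioo 0 c) =
      (D.m.withDensityᵥ fun t => (D.kernel lam t *ᵥ V t) i).restrict (Ioo 0 c) := by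
    -- Half-lines form a generating $\pi$-system, and their traces on $(0,c)$ are the intervals
    -- $(0,x)$ handled by `hIoo`.
    refine VectorMeasure.ext_of_generateFrom (range Iio) ?_
      ((borel_eq_generateFrom_Iio ℝ) ▸ BorelSpace.measurable_eq) isPiSystem_Iio ?_
    · rintro _ ⟨x, rfl⟩
      rw [VectorMeasure.restrict_apply _ measurableSet_Ioo measurableSet_Iio,
        VectorMeasure.restrict_apply _ measurableSet_Ioo measurableSet_Iio]
      have h : Iio x ∩ Ioo 0 c = Ioo 0 (min x c) := by
        ext t
        simp only [mem_inter_iff, mem_Iio, mem_Ioo, lt_min_iff]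
        tauto
      rw [h]
      rcases le_or_gt (min x c) 0 with h0 | h0
      · simp [Ioo_eq_empty_of_le h0]
      · exact hIoo _ ⟨h0, min_le_right _ _⟩
    · rw [VectorMeasure.restrict_apply _ measurableSet_Ioo MeasurableSet.univ,
        VectorMeasure.restrict_apply _ measurableSet_Ioo MeasurableSet.univ, univ_inter]
      exact hIoo c ⟨D.mem.1, le_rfl⟩
  have h2 := congrArg (fun μ => μ E) hext
  simp only [VectorMeasure.restrict_apply _ measurableSet_Ioo hE, inter_eq_left.2 hEc] at h2
  rw [h2, withDensityᵥ_apply (hV'.int i) hE]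

theorem leftLim_eq_of_isVolterra (hq : q.IsHermitian) (hw : w.IsNonneg) {x : ℝ}
    (hx : x ∈ openInt b) : Function.leftLim v x = V x := by
  obtain ⟨D⟩ := nonempty_commonDensity hq hw hx
  exact leftLim_eq_of_tendsto (D.tendsto_left hV hv0 hv ⟨hx.1, le_rfl⟩)

/-- Solutions of the Volterra equation give solutions of the differential equation. -/
theorem isSolution_of_isVolterra (hb : 0 < b) (hq : q.IsHermitian) (hw : w.IsNonneg)
    (hlam : lam ∉ badSet q w) : IsSolution q w lam v := by
  have hex : ∀ y : ℝ, 0 ≤ y → (y : EReal) < b → ∃ c, y < c ∧ c ∈ openInt b := by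
    intro y h0 h
    obtain ⟨c, h1, h2⟩ := EReal.lt_iff_exists_real_btwn.1 h
    exact ⟨c, EReal.coe_lt_coe_iff.1 h1, h0.trans_lt (EReal.coe_lt_coe_iff.1 h1), h2⟩
  have hbv : LocallyBoundedVariationOn v (halfOpen b) := by
    intro x y hx hy
    obtain ⟨c, hyc, hc⟩ := hex y hy.1 hy.2
    obtain ⟨D⟩ := nonempty_commonDensity hq hw hc
    exact ne_top_of_le_ne_top (D.eVariationOn_ne_top hV hv0 hv hx.1 hyc.le)
      (eVariationOn.mono v inter_subset_right)
  refine ⟨hbv, ?_, fun x hx => ?_, fun c hc E hE hEc => ?_⟩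
  · obtain ⟨c, -, hc⟩ := hex 0 le_rfl hb
    obtain ⟨D⟩ := nonempty_commonDensity hq hw hc
    rw [hv0]
    exact D.tendsto_zero hV hv0 hv
  · obtain ⟨c, hxc, hc⟩ := exists_gt_mem_openInt hx
    obtain ⟨D⟩ := nonempty_commonDensity hq hw hc
    rw [rightLim_eq_of_tendsto (D.tendsto_right hV hv0 hv ⟨hx.1, hxc⟩),
      leftLim_eq_of_isVolterra hV hv0 hv hq hw hx, hv x hx, D.balance_eq _ ⟨hx.1, hxc.le⟩,
      balancedOf, CommonDensity.kernel]
    ext i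
    simp only [Pi.add_apply, Pi.smul_apply, smul_eq_mul, Complex.real_smul]
    ring
  · obtain ⟨D⟩ := nonempty_commonDensity hq hw hc
    rw [hbv.equation_iff lam D hE hEc]
    intro i
    rw [D.stieltjes_eq hV hv0 hv hbv hE hEc]
    refine setIntegral_congr_fun hE fun t ht => ?_
    have ht' := hEc ht
    rw [hv t ⟨ht'.1, (EReal.coe_lt_coe_iff.2 ht'.2).trans hc.2⟩, D.balance_eq _ ⟨ht'.1, ht'.2.le⟩,
      balancedOf, jInvMul_mulVec_balanced _ ((D.isRegularDensity hlam).det t),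
      CommonDensity.kernel]

end Backward

/-! ### The function $\tau$ and conjugation of the spectral parameter -/

section

variable {b : EReal} {q w : LocalMatrixMeasure b} {c : ℝ} {lam : ℂ}

/-- The left side removes the atoms of $\mu_{12}$, the right side all atoms of $m$. The two sets
differ on $(0,x)$ only at atoms of $m$ where the density entry vanishes. -/
theorem LocalMatrixMeasure.IsDensity.contPart12_eq {μ : LocalMatrixMeasure b} {m : Measure ℝ}
    [IsFiniteMeasure m] {D : ℝ → Matrix (Fin 2) (Fin 2) ℂ} (h : μ.IsDensity c m D)
    (hc : (c : EReal) < b) {x : ℝ} (hx : x ∈ Ioc 0 c) :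
    μ.contPart12 x = cumInt m ((atomSet m)ᶜ.indicator fun t => D t 0 1) x := by
  set A := {y : ℝ | μ.atom y 0 1 ≠ 0} with hA
  have hatom : ∀ t ∈ Ioo 0 x, μ.atom t 0 1 = (m.real {t} : ℂ) * D t 0 1 := fun t ht => by
    rw [h.atom_eq hc ⟨ht.1, ht.2.le.trans hx.2⟩, Matrix.smul_apply, smul_eq_mul]
  have hsub : Ioo 0 x ∩ A ⊆ atomSet m := fun t ht h0 => ht.2 (by
    rw [hatom t ht.1, h0, Complex.ofReal_zero, zero_mul])
  have hmeas : MeasurableSet (Ioo 0 x \ A) := by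
    rw [← sdiff_self_inter]
    exact measurableSet_Ioo.diff ((countable_atoms m).mono hsub).measurableSet
  have hsub' : Ioo 0 x \ A ⊆ Ioo 0 x := sdiff_subset
  rw [LocalMatrixMeasure.contPart12, μ.restr_of_subset hx.2 hc 0 1 hmeas
    (hsub'.trans Ioo_subset_Ioc_self), h.restr_apply 0 1 hmeas, cumInt]
  refine Eq.trans ?_ (setIntegral_eq_of_subset_of_forall_sdiff_eq_zero measurableSet_Ioo hsub'
    ?_).symm
  · refine setIntegral_congr_fun hmeas fun t ht => ?_
    by_cases hta : t ∈ atomSet m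
    · have h1 : (m.real {t} : ℂ) * D t 0 1 = 0 := by
        rw [← hatom t ht.1]
        exact not_not.1 ht.2
      have h2 : D t 0 1 = 0 := (mul_eq_zero.1 h1).resolve_left (Complex.ofReal_ne_zero.2 hta)
      change D t 0 1 = (atomSet m)ᶜ.indicator (fun t => D t 0 1) t
      rw [indicator_of_notMem (notMem_compl_iff.2 hta), h2]
    · rw [indicator_of_mem (mem_compl hta)]
  · intro t ht
    suffices hta : t ∈ atomSet m from indicator_of_notMem (notMem_compl_iff.2 hta) _
    by_contra hta
    exact ht.2 ⟨ht.1, fun htA => hta (hsub ⟨ht.1, htA⟩)⟩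

namespace CommonDensity

variable (D : CommonDensity q w c)

/-- The multiplier turning the solutions for `lam` into conjugates of those for `conj lam`. -/
noncomputable def multiplier (lam : ℂ) (x : ℝ) : ℂ :=
  prodExp D.m (fun t => detKernel (D.m.real {t}) (-D.H lam t)) x

theorem tau_eq (hlam : lam ∉ badSet q w) {x : ℝ} (hx : x ∈ Ioc 0 c) :
    tau q w x lam = prodExp D.m (fun t => detKernel (D.m.real {t}) (D.H lam t)) x := by
  have hreg := D.isRegularDensity hlam
  rw [tau, prodExp]
  congr 1
  · rw [cumProd]
    refine tprod_congr fun y => ?_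
    have hy : (y : ℝ) ∈ Ioc 0 c := ⟨y.2.1, y.2.2.le.trans hx.2⟩
    rw [one_add_detKernel (hreg.det y), det_matBPlus, det_matBMinus, ← D.atom_smul_H lam hy,
      ← smul_neg, jumpDet_one_smul, jumpDet_one_smul]
  · congr 1
    rw [D.hQ.contPart12_eq D.mem.2 hx, D.hW.contPart12_eq D.mem.2 hx]
    have hint : ∀ {f : ℝ → ℂ}, Integrable f D.m →
        IntegrableOn ((atomSet D.m)ᶜ.indicator f) (Ioo 0 x) D.m := fun hf =>
      (hf.indicator (measurableSet_atomSet D.m).compl).integrableOn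
    have hconj : ∀ f : ℝ → ℂ, conj (cumInt D.m ((atomSet D.m)ᶜ.indicator f) x) =
        cumInt D.m ((atomSet D.m)ᶜ.indicator fun t => conj (f t)) x := by
      intro f
      rw [← cumInt_conj]
      congr 1
      ext t
      by_cases ht : t ∈ (atomSet D.m)ᶜ
      · rw [indicator_of_mem ht, indicator_of_mem ht]
      · rw [indicator_of_notMem ht, indicator_of_notMem ht, map_zero]
    have hid : ∀ z : ℂ, 2 * Complex.I * (z.im : ℂ) = z - conj z := fun z => by
      rw [Complex.sub_conj]
      push_cast
      ring
    have hci : ∀ {f : ℝ → ℂ}, Integrable f D.m → Integrable (fun t => conj (f t)) D.m := fun hf =>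
      (Complex.conjCLE.toContinuousLinearMap).integrable_comp hf
    rw [mul_sub, mul_left_comm, hid, hid, hconj, hconj]
    simp only [cumInt]
    have hQ := hint (D.hQ.int 0 1)
    have hQ' := hint (hci (D.hQ.int 0 1))
    have hW := hint (D.hW.int 0 1)
    have hW' := hint (hci (D.hW.int 0 1))
    have hQd : IntegrableOn (fun t => (atomSet D.m)ᶜ.indicator (fun t => D.Q t 0 1) t -
        (atomSet D.m)ᶜ.indicator (fun t => conj (D.Q t 0 1)) t) (Ioo 0 x) D.m := hQ.sub hQ'
    have hWd : IntegrableOn (fun t => (atomSet D.m)ᶜ.indicator (fun t => D.W t 0 1) t -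
        (atomSet D.m)ᶜ.indicator (fun t => conj (D.W t 0 1)) t) (Ioo 0 x) D.m := hW.sub hW'
    rw [← integral_sub hQ hQ', ← integral_sub hW hW', ← integral_const_mul,
      ← integral_sub hQd (hWd.const_mul lam)]
    refine integral_congr_ae (Eventually.of_forall fun t => ?_)
    by_cases ht : t ∈ (atomSet D.m)ᶜ
    -- Away from atoms the determinant kernel is the trace $H_{21}-H_{12}$, which equals
    -- $2i(\operatorname{Im}Q_{12}-\lambda\operatorname{Im}W_{12})$ because $Q$ and $W$ are
    -- Hermitian.
    · have h0 : D.m.real {t} = 0 := by simpa [atomSet] using ht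
      simp only [indicator_of_mem ht, h0, detKernel, Complex.ofReal_zero, jumpDet_zero, div_one, H,
        Matrix.sub_apply, Matrix.smul_apply, smul_eq_mul]
      rw [← (D.hQ.herm t).apply 1 0, ← (D.hW.herm t).apply 1 0, Complex.star_def]
      ring
    · simp [indicator_of_notMem ht]

theorem tau_mul_multiplier (hlam : lam ∉ badSet q w) {x : ℝ} (hx : x ∈ Ioc 0 c) :
    tau q w x lam * D.multiplier lam x = 1 := by
  rw [D.tau_eq hlam hx]
  exact prodExp_mul_prodExp_neg (D.isRegularDensity hlam) (D.isRegularDensity_neg hlam) x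

end CommonDensity

/-- Passing to $\bar\lambda$ conjugates and exchanges the two determinants, so their product
vanishes for both parameters or for neither. -/
theorem conj_notMem_badSet (hq : q.IsHermitian) (hw : w.IsNonneg) (hlam : lam ∉ badSet q w) :
    conj lam ∉ badSet q w := by
  rintro ⟨x, hx, h⟩
  obtain ⟨D⟩ := nonempty_commonDensity hq hw hx
  have hx' : x ∈ Ioc 0 x := ⟨hx.1, le_rfl⟩
  refine hlam ⟨x, hx, ?_⟩
  rw [det_matBPlus, det_matBMinus, ← D.atom_smul_H _ hx', ← smul_neg, jumpDet_one_smul,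
    jumpDet_one_smul, ← D.H_conjTranspose] at h
  rw [det_matBPlus, det_matBMinus, ← D.atom_smul_H _ hx', ← smul_neg, jumpDet_one_smul,
    jumpDet_one_smul]
  rw [← conjTranspose_neg, jumpDet_conjTranspose, jumpDet_conjTranspose, neg_neg, ← map_mul,
    map_eq_zero] at h
  rw [mul_comm, h]

/-- The solution for `conj lam` with conjugate initial value, through the multiplier. -/
theorem CommonDensity.isVolterra_conj (hlam : lam ∉ badSet q w) (D : CommonDensity q w c)
    {ξ : Fin 2 → ℂ} {V : ℝ → Fin 2 → ℂ} (hV : IsVolterra D.m (D.kernel lam) c ξ V) :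
    IsVolterra D.m (D.kernel (conj lam)) c (fun i => conj (ξ i))
      (fun t i => conj (V t i * D.multiplier lam t)) := by
  have h := IsVolterra.conj_mul_prodExp D.supp (D.isRegularDensity hlam)
    (D.isRegularDensity_neg hlam) hV
  simp only [D.H_conjTranspose] at h
  exact h

end

/-! ### The norm and the boundary form -/

section

variable {b : EReal} {q w : LocalMatrixMeasure b} {c : ℝ} {lam mu : ℂ} {u v : ℝ → Fin 2 → ℂ}

theorem quadForm_nonneg {M : Matrix (Fin 2) (Fin 2) ℂ} (hM : M.PosSemidef) (ξ : Fin 2 → ℂ) :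
    0 ≤ quadForm M ξ := by
  rw [LocalMatrixMeasure.quadForm_eq]
  exact hM.re_dotProduct_nonneg ξ

theorem mulVec_eq_zero_of_quadForm {M : Matrix (Fin 2) (Fin 2) ℂ} (hM : M.PosSemidef)
    {ξ : Fin 2 → ℂ} (h : quadForm M ξ = 0) : M *ᵥ ξ = 0 := by
  rw [LocalMatrixMeasure.quadForm_eq] at h
  rw [← hM.dotProduct_mulVec_zero_iff]
  exact Complex.ext h (Complex.le_def.1 (hM.dotProduct_mulVec_nonneg ξ)).2.symm

theorem quadForm_smul (M : Matrix (Fin 2) (Fin 2) ℂ) (a : ℂ) (ξ : Fin 2 → ℂ) :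
    quadForm M (a • ξ) = Complex.normSq a * quadForm M ξ := by
  have h : ∀ i j, conj (a * ξ i) * (a * ξ j) * M i j =
      (Complex.normSq a : ℂ) * (conj (ξ i) * ξ j * M i j) := fun i j => by
    rw [Complex.normSq_eq_conj_mul_self, map_mul]
    ring
  simp only [quadForm, Pi.smul_apply, smul_eq_mul, h, ← Finset.mul_sum, Complex.re_ofReal_mul]

/-- Parallelogram law, with the form of the difference dropped. -/
theorem quadForm_add_le {M : Matrix (Fin 2) (Fin 2) ℂ} (hM : M.PosSemidef) (ξ η : Fin 2 → ℂ) :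
    quadForm M (ξ + η) ≤ 2 * quadForm M ξ + 2 * quadForm M η := by
  have h1 := quadForm_nonneg hM (ξ - η)
  have h2 : quadForm M (ξ + η) + quadForm M (ξ - η) = 2 * quadForm M ξ + 2 * quadForm M η := by
    simp [quadForm, Fin.sum_univ_two]
    ring
  linarith

namespace LocallyBoundedVariationOn

theorem integrableOn_conj_mul (hu : LocallyBoundedVariationOn u (halfOpen b))
    (D : CommonDensity q w c) (i j : Fin 2) {E : Set ℝ} (hE : MeasurableSet E)
    (hEc : E ⊆ Icc 0 c) :
    IntegrableOn (fun t => conj (u t i) * u t j * D.W t i j) E D.m := by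
  obtain ⟨C, hC⟩ := hu.exists_bound D.mem i
  have h := (hu.integrableOn_mul D j (D.hW.int i j) hE hEc).bdd_mul (c := C)
    (Complex.continuous_conj.comp_aestronglyMeasurable (hu.aestronglyMeasurable D i hE hEc)) (by
      filter_upwards [ae_restrict_mem hE] with t ht
      rw [RCLike.norm_conj]
      exact hC t (hEc ht))
  refine h.congr (Eventually.of_forall fun t => ?_)
  simp only
  ring

theorem integrableOn_quadForm (hu : LocallyBoundedVariationOn u (halfOpen b))
    (D : CommonDensity q w c) {E : Set ℝ} (hE : MeasurableSet E) (hEc : E ⊆ Icc 0 c) :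
    IntegrableOn (fun t => quadForm (D.W t) (u t)) E D.m :=
  (integrable_finsetSum Finset.univ fun i _ => integrable_finsetSum Finset.univ fun j _ =>
    hu.integrableOn_conj_mul D i j hE hEc).re

theorem normSqUpTo_eq (hu : LocallyBoundedVariationOn u (halfOpen b)) (D : CommonDensity q w c)
    {x : ℝ} (hx : x ≤ c) :
    w.normSqUpTo u x = ∫ t in Ioc 0 x, quadForm (D.W t) (u t) ∂D.m := by
  have hsub : Ioc 0 x ⊆ Icc 0 c := Ioc_subset_Icc_self.trans (Icc_subset_Icc_right hx)
  have hint := fun i j => hu.integrableOn_conj_mul D i j measurableSet_Ioc hsub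
  have h1 : ∀ i j, w.integralOn x (Ioc 0 x) i j (fun t => conj (u t i) * u t j) =
      ∫ t in Ioc 0 x, conj (u t i) * u t j * D.W t i j ∂D.m := by
    intro i j
    obtain ⟨C, hC⟩ := hu.exists_bound D.mem i
    obtain ⟨C', hC'⟩ := hu.exists_bound D.mem j
    refine D.hW.integralOn_eq hx D.mem.2 i j measurableSet_Ioc Subset.rfl
      ((Complex.continuous_conj.comp_aestronglyMeasurable
        (hu.aestronglyMeasurable D i measurableSet_Ioc hsub)).mul
        (hu.aestronglyMeasurable D j measurableSet_Ioc hsub)) (C := C * C') fun t ht => ?_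
    rw [norm_mul, RCLike.norm_conj]
    exact mul_le_mul (hC t (hsub ht)) (hC' t (hsub ht)) (norm_nonneg _)
      ((norm_nonneg _).trans (hC t (hsub ht)))
  have h2 : ∑ i, ∑ j, w.integralOn x (Ioc 0 x) i j (fun t => conj (u t i) * u t j) =
      ∫ t in Ioc 0 x, ∑ i, ∑ j, conj (u t i) * u t j * D.W t i j ∂D.m := by
    rw [integral_finsetSum _ fun i _ => integrable_finsetSum _ fun j _ => hint i j]
    refine Finset.sum_congr rfl fun i _ => ?_
    rw [integral_finsetSum _ fun j _ => hint i j]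
    exact Finset.sum_congr rfl fun j _ => h1 i j
  rw [LocalMatrixMeasure.normSqUpTo, h2]
  exact (integral_re (integrable_finsetSum _ fun i _ => integrable_finsetSum _ fun j _ =>
    hint i j)).symm

theorem normSqUpTo_nonneg (hq : q.IsHermitian) (hw : w.IsNonneg)
    (hu : LocallyBoundedVariationOn u (halfOpen b)) (hc : c ∈ openInt b) :
    0 ≤ w.normSqUpTo u c := by
  obtain ⟨D⟩ := nonempty_commonDensity hq hw hc
  rw [hu.normSqUpTo_eq D le_rfl]
  refine integral_nonneg_of_ae ?_
  filter_upwards [ae_restrict_of_ae (D.hW.ae_posSemidef hw hc)] with t ht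
  exact quadForm_nonneg ht _

end LocallyBoundedVariationOn

theorem normSq_congr (hq : q.IsHermitian) (hw : w.IsNonneg)
    (hu : LocallyBoundedVariationOn u (halfOpen b)) (hv : LocallyBoundedVariationOn v (halfOpen b))
    (h : EqOn u v (openInt b)) : w.normSq u = w.normSq v := by
  refine iSup_congr fun c => iSup_congr fun hc => ?_
  obtain ⟨D⟩ := nonempty_commonDensity hq hw hc
  rw [hu.normSqUpTo_eq D le_rfl, hv.normSqUpTo_eq D le_rfl]
  congr 1
  refine setIntegral_congr_fun measurableSet_Ioc fun t ht => ?_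
  simp only [h ⟨ht.1, (EReal.coe_le_coe_iff.2 ht.2).trans_lt hc.2⟩]

theorem normSq_smul_le (hq : q.IsHermitian) (hw : w.IsNonneg)
    (hu : LocallyBoundedVariationOn u (halfOpen b))
    (hau : LocallyBoundedVariationOn (mu • u) (halfOpen b)) :
    w.normSq (mu • u) ≤ ENNReal.ofReal (Complex.normSq mu) * w.normSq u := by
  refine iSup₂_le fun c hc => ?_
  obtain ⟨D⟩ := nonempty_commonDensity hq hw hc
  rw [hau.normSqUpTo_eq D le_rfl]
  simp only [Pi.smul_apply, quadForm_smul]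
  rw [integral_const_mul, ← hu.normSqUpTo_eq D le_rfl, ENNReal.ofReal_mul (Complex.normSq_nonneg _)]
  gcongr
  exact le_iSup₂ (f := fun c _ => ENNReal.ofReal (w.normSqUpTo u c)) c hc

theorem normSq_add_le (hq : q.IsHermitian) (hw : w.IsNonneg)
    (hu : LocallyBoundedVariationOn u (halfOpen b)) (hv : LocallyBoundedVariationOn v (halfOpen b))
    (huv : LocallyBoundedVariationOn (u + v) (halfOpen b)) :
    w.normSq (u + v) ≤ 2 * w.normSq u + 2 * w.normSq v := by
  refine iSup₂_le fun c hc => ?_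
  obtain ⟨D⟩ := nonempty_commonDensity hq hw hc
  have hint : ∀ {f : ℝ → Fin 2 → ℂ}, LocallyBoundedVariationOn f (halfOpen b) →
      Integrable (fun t => quadForm (D.W t) (f t)) (D.m.restrict (Ioc 0 c)) := fun hf =>
    hf.integrableOn_quadForm D measurableSet_Ioc Ioc_subset_Icc_self
  have h : w.normSqUpTo (u + v) c ≤ 2 * w.normSqUpTo u c + 2 * w.normSqUpTo v c := by
    rw [hu.normSqUpTo_eq D le_rfl, hv.normSqUpTo_eq D le_rfl, huv.normSqUpTo_eq D le_rfl,
      ← integral_const_mul, ← integral_const_mul,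
      ← integral_add ((hint hu).const_mul 2) ((hint hv).const_mul 2)]
    refine integral_mono_ae (hint huv) (((hint hu).const_mul 2).add ((hint hv).const_mul 2)) ?_
    filter_upwards [ae_restrict_of_ae (D.hW.ae_posSemidef hw hc)] with t ht
    exact quadForm_add_le ht _ _
  refine (ENNReal.ofReal_le_ofReal h).trans (ENNReal.ofReal_add_le.trans ?_)
  rw [ENNReal.ofReal_mul zero_le_two, ENNReal.ofReal_mul zero_le_two, ENNReal.ofReal_ofNat]
  gcongr
  · exact le_iSup₂ (f := fun c _ => ENNReal.ofReal (w.normSqUpTo u c)) c hc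
  · exact le_iSup₂ (f := fun c _ => ENNReal.ofReal (w.normSqUpTo v c)) c hc

/-- The boundary form `Im(V₁ conj(V₂))`. -/
noncomputable def boundaryForm (ξ : Fin 2 → ℂ) : ℝ := (ξ 0 * conj (ξ 1)).im

namespace IsSolution

theorem boundaryForm_leftLim (hlam : lam ∉ badSet q w) (hu : IsSolution q w lam u)
    (D : CommonDensity q w c) {x : ℝ} (hx : x ∈ Ioc 0 c) :
    boundaryForm (Function.leftLim u x) = boundaryForm (u 0) +
      lam.im * ∫ t in Ioo 0 x, quadForm (D.W t) (u t) ∂D.m := by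
  have h := IsVolterra.im_mul_conj D.hQ.herm D.hW.herm (D.isRegularDensity hlam)
    (hu.isVolterra hlam D) hx
  rw [boundaryForm, boundaryForm, h]
  congr 2
  refine setIntegral_congr_fun measurableSet_Ioo fun t ht => ?_
  have ht' : t ∈ Ioo 0 c := ⟨ht.1, ht.2.trans_le hx.2⟩
  congr 1
  have h1 := hu.kernel_mulVec_leftLim hlam D ht'
  rw [CommonDensity.kernel] at h1
  exact (congrArg (fun z => Function.leftLim u t + ((D.m.real {t} : ℂ) / 2) • z) h1).trans
    (hu.eq_leftLim_add D ht').symm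

/-- The norm of a solution up to `x`, through the boundary form. -/
theorem ofReal_boundaryForm_le (hq : q.IsHermitian) (hw : w.IsNonneg) (him : lam.im ≠ 0)
    (hlam : lam ∉ badSet q w) (hu : IsSolution q w lam u) {x : ℝ} (hx : x ∈ openInt b) :
    0 ≤ (boundaryForm (Function.leftLim u x) - boundaryForm (u 0)) / lam.im ∧
    (boundaryForm (Function.leftLim u x) - boundaryForm (u 0)) / lam.im ≤ w.normSqUpTo u x ∧
    ∀ c < x, w.normSqUpTo u c ≤
      (boundaryForm (Function.leftLim u x) - boundaryForm (u 0)) / lam.im := by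
  obtain ⟨D⟩ := nonempty_commonDensity hq hw hx
  have hnn : ∀ E : Set ℝ, 0 ≤ᵐ[D.m.restrict E] fun t => quadForm (D.W t) (u t) := fun E => by
    filter_upwards [ae_restrict_of_ae (D.hW.ae_posSemidef hw hx)] with t ht
    exact quadForm_nonneg ht _
  have hbv := hu.locallyBoundedVariation
  rw [hu.boundaryForm_leftLim hlam D ⟨hx.1, le_rfl⟩, add_sub_cancel_left,
    mul_div_cancel_left₀ _ him]
  -- The left limit at $x$ accounts for the open interval $(0,x)$, which lies between $(0,c]$ and
  -- $(0,x]$.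
  refine ⟨setIntegral_nonneg_of_ae_restrict (hnn _), ?_, fun c hc => ?_⟩
  · rw [hbv.normSqUpTo_eq D le_rfl]
    exact setIntegral_mono_set (hbv.integrableOn_quadForm D measurableSet_Ioc Ioc_subset_Icc_self)
      (hnn _) Ioo_subset_Ioc_self.eventuallyLE
  · rw [hbv.normSqUpTo_eq D hc.le]
    exact setIntegral_mono_set (hbv.integrableOn_quadForm D measurableSet_Ioo Ioo_subset_Icc_self)
      (hnn _) (LE.le.eventuallyLE fun t ht => ⟨ht.1, ht.2.trans_lt hc⟩)

/-- A solution is of finite norm if and only if its boundary form is bounded. -/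
theorem memL2_iff (hq : q.IsHermitian) (hw : w.IsNonneg) (him : lam.im ≠ 0)
    (hlam : lam ∉ badSet q w) (hu : IsSolution q w lam u) :
    w.MemL2 u ↔ ∃ C, ∀ x ∈ openInt b, |boundaryForm (Function.leftLim u x)| ≤ C := by
  constructor
  · intro h
    refine ⟨|boundaryForm (u 0)| + |lam.im| * (w.normSq u).toReal, fun x hx => ?_⟩
    obtain ⟨h0, h1, -⟩ := hu.ofReal_boundaryForm_le hq hw him hlam hx
    have h2 : w.normSqUpTo u x ≤ (w.normSq u).toReal := by
      refine (ENNReal.ofReal_le_iff_le_toReal h.ne).1 ?_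
      exact le_iSup₂ (f := fun c _ => ENNReal.ofReal (w.normSqUpTo u c)) x hx
    have h3 : boundaryForm (Function.leftLim u x) = boundaryForm (u 0) + lam.im *
        ((boundaryForm (Function.leftLim u x) - boundaryForm (u 0)) / lam.im) := by
      rw [mul_div_cancel₀ _ him]
      ring
    rw [h3]
    refine (abs_add_le _ _).trans (add_le_add_right ?_ _)
    rw [abs_mul, abs_of_nonneg h0]
    exact mul_le_mul_of_nonneg_left (h1.trans h2) (abs_nonneg _)
  · rintro ⟨C, hC⟩
    refine lt_of_le_of_lt (iSup₂_le fun c hc => ?_)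
      (ENNReal.ofReal_lt_top (r := (C + |boundaryForm (u 0)|) / |lam.im|))
    -- The left limit at $c$ misses a possible atom at $c$, so the boundary form is taken at a point
    -- beyond it.
    obtain ⟨x, hcx, hx⟩ := exists_gt_mem_openInt hc
    obtain ⟨-, -, h2⟩ := hu.ofReal_boundaryForm_le hq hw him hlam hx
    refine ENNReal.ofReal_le_ofReal ((h2 c hcx).trans ((le_abs_self _).trans ?_))
    rw [abs_div]
    gcongr
    exact (abs_sub _ _).trans (add_le_add_left (hC x hx) _)

/-- A solution of norm `0` solves the equation for every spectral parameter. -/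
theorem of_normSq_eq_zero (hq : q.IsHermitian) (hw : w.IsNonneg) (hu : IsSolution q w lam u)
    (h0 : w.normSq u = 0) : IsSolution q w mu u := by
  refine ⟨hu.locallyBoundedVariation, hu.tendsto_zero, hu.balanced, fun c hc E hE hEc => ?_⟩
  obtain ⟨D⟩ := nonempty_commonDensity hq hw hc
  have hbv := hu.locallyBoundedVariation
  rw [hbv.equation_iff mu D hE hEc]
  intro i
  rw [hu.stieltjes_eq_setIntegral D hE hEc]
  have h1 : w.normSqUpTo u c = 0 := by
    refine le_antisymm ?_ (hbv.normSqUpTo_nonneg hq hw hc)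
    rw [← ENNReal.ofReal_eq_zero, ← nonpos_iff_eq_zero, ← h0]
    exact le_iSup₂ (f := fun c _ => ENNReal.ofReal (w.normSqUpTo u c)) c hc
  have hps := D.hW.ae_posSemidef hw hc
  rw [hbv.normSqUpTo_eq D le_rfl, setIntegral_eq_zero_iff_of_nonneg_ae
    ((ae_restrict_of_ae hps).mono fun t ht => quadForm_nonneg ht _)
    (hbv.integrableOn_quadForm D measurableSet_Ioc Ioc_subset_Icc_self)] at h1
  -- For a positive semidefinite form, zero value at $u$ forces $Wu=0$. The density of $u'$ then no
  -- longer contains the spectral parameter.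
  have h2 : ∀ᵐ t ∂D.m.restrict E, D.W t *ᵥ u t = 0 := by
    filter_upwards [ae_restrict_of_ae hps,
      ae_restrict_of_ae_restrict_of_subset (hEc.trans Ioo_subset_Ioc_self) h1] with t ht1 ht2
    exact mulVec_eq_zero_of_quadForm ht1 ht2
  refine integral_congr_ae (h2.mono fun t ht => ?_)
  have h3 : ∀ z, D.H z t *ᵥ u t = -(D.Q t *ᵥ u t) := fun z => by
    rw [CommonDensity.H, sub_mulVec, smul_mulVec, ht, smul_zero, zero_sub]
  have h4 : ∀ M : Matrix (Fin 2) (Fin 2) ℂ, jInvMul M *ᵥ u t = ![(M *ᵥ u t) 1, -(M *ᵥ u t) 0] := by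
    intro M
    ext i
    fin_cases i
    · simp only [Fin.zero_eta, jInvMul_mulVec_zero]
      simp [mulVec, dotProduct, Fin.sum_univ_two]
    · simp only [Fin.mk_one, jInvMul_mulVec_one]
      simp [mulVec, dotProduct, Fin.sum_univ_two]
  simp only [h4, h3]

end IsSolution

end

/-! ### Conjugate solutions and linear structure -/

section

variable {b : EReal} {q w : LocalMatrixMeasure b} {c : ℝ} {lam : ℂ} {u v : ℝ → Fin 2 → ℂ}

theorem IsVolterra.congr {m : Measure ℝ} [IsFiniteMeasure m] {k : ℝ → Matrix (Fin 2) (Fin 2) ℂ} {ξ : Fin 2 → ℂ}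
    {U V : ℝ → Fin 2 → ℂ} (hm : m (Ioc 0 c)ᶜ = 0) (hU : IsVolterra m k c ξ U)
    (h : EqOn U V (Ioc 0 c)) : IsVolterra m k c ξ V := by
  refine ⟨fun i => (hU.int i).congr ?_, fun x hx i => ?_⟩
  · filter_upwards [ae_mem_Ioc hm] with t ht
    rw [h ht]
  · rw [← h hx, hU.eq x hx i]
    congr 1
    exact cumInt_congr fun t ht => by rw [h ⟨ht.1, ht.2.le.trans hx.2⟩]

theorem CommonDensity.multiplier_eq (D : CommonDensity q w c) (hlam : lam ∉ badSet q w) {x : ℝ}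
    (hx : x ∈ Ioc 0 c) : D.multiplier lam x = (tau q w x lam)⁻¹ :=
  eq_inv_of_mul_eq_one_right (D.tau_mul_multiplier hlam hx)

theorem CommonDensity.isVolterra_conj_tau (D : CommonDensity q w c) (hlam : lam ∉ badSet q w)
    {ξ : Fin 2 → ℂ} {V : ℝ → Fin 2 → ℂ} (hV : IsVolterra D.m (D.kernel lam) c ξ V) :
    IsVolterra D.m (D.kernel (conj lam)) c (fun i => conj (ξ i))
      (fun t i => conj (V t i * (tau q w t lam)⁻¹)) :=
  (D.isVolterra_conj hlam hV).congr D.supp fun t ht => by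
    simp only [D.multiplier_eq hlam ht]

/-- With $a=1/\tau$ this compares the boundary forms of corresponding solutions for $\lambda$ and
$\bar\lambda$; the sign reflects $\operatorname{Im}\bar\lambda=-\operatorname{Im}\lambda$. -/
theorem boundaryForm_conj_mul (ξ : Fin 2 → ℂ) (a : ℂ) :
    boundaryForm (fun i => conj (ξ i * a)) = -(‖a‖ ^ 2 * boundaryForm ξ) := by
  rw [boundaryForm, boundaryForm, ← Complex.normSq_eq_norm_sq]
  simp [Complex.normSq_apply]
  ring

namespace IsSolution

theorem eqOn_leftLim (hq : q.IsHermitian) (hw : w.IsNonneg) (hlam : lam ∉ badSet q w)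
    (hu : IsSolution q w lam u) {V : ℝ → Fin 2 → ℂ}
    (hV : ∀ (c : ℝ) (D : CommonDensity q w c), IsVolterra D.m (D.kernel lam) c (u 0) V) :
    EqOn (Function.leftLim u) V (openInt b) := by
  intro x hx
  obtain ⟨D⟩ := nonempty_commonDensity hq hw hx
  exact (hu.isVolterra hlam D).unique (fun i j => (D.isRegularDensity hlam).integrable_leftKernel i j)
    (hV x D) x ⟨hx.1, le_rfl⟩

theorem eqOn (hq : q.IsHermitian) (hw : w.IsNonneg) (hlam : lam ∉ badSet q w)
    (hu : IsSolution q w lam u) (hv : IsSolution q w lam v) (h : u 0 = v 0) :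
    EqOn u v (openInt b) := by
  intro x hx
  have h1 := hu.eqOn_leftLim hq hw hlam (V := Function.leftLim v)
    (fun c D => h ▸ hv.isVolterra hlam D) hx
  rw [hu.eq_balance hq hw hlam hx, hv.eq_balance hq hw hlam hx, balance, balance, h1]

theorem leftLim_conj (hq : q.IsHermitian) (hw : w.IsNonneg) (hlam : lam ∉ badSet q w)
    (hu : IsSolution q w lam u) (hv : IsSolution q w (conj lam) v)
    (h : ∀ i, v 0 i = conj (u 0 i)) {x : ℝ} (hx : x ∈ openInt b) : Function.leftLim v x =
      fun i => conj (Function.leftLim u x i * (tau q w x lam)⁻¹) :=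
  hv.eqOn_leftLim hq hw (conj_notMem_badSet hq hw hlam) (fun _ D =>
    (funext h : v 0 = _) ▸ D.isVolterra_conj_tau hlam (hu.isVolterra hlam D)) hx

/-- The explicit formula $\overline{V/\tau}$ supplies the solution, so no general existence theorem
for initial value problems is needed. -/
theorem exists_conj (hb : 0 < b) (hq : q.IsHermitian) (hw : w.IsNonneg) (hlam : lam ∉ badSet q w)
    (hu : IsSolution q w lam u) :
    ∃ v, IsSolution q w (conj lam) v ∧ ∀ i, v 0 i = conj (u 0 i) := by
  classical
  set V : ℝ → Fin 2 → ℂ := fun t i => conj (Function.leftLim u t i * (tau q w t lam)⁻¹)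
  have h0 : (0 : ℝ) ∉ openInt b := fun h => lt_irrefl _ h.1
  refine ⟨fun t => if t ∈ openInt b then balance q w (conj lam) V t else fun i => conj (u 0 i),
    isSolution_of_isVolterra (fun c D => D.isVolterra_conj_tau hlam (hu.isVolterra hlam D))
      (if_neg h0) (fun t ht => if_pos ht) hb hq hw (conj_notMem_badSet hq hw hlam), fun i => ?_⟩
  simp only [if_neg h0]

theorem memL2_conj_iff (hq : q.IsHermitian) (hw : w.IsNonneg) (him : lam.im ≠ 0)
    (hlam : lam ∉ badSet q w)
    (htau : ∃ m M : ℝ, 0 < m ∧ ∀ x ∈ openInt b, m ≤ ‖tau q w x lam‖ ∧ ‖tau q w x lam‖ ≤ M)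
    (hu : IsSolution q w lam u) (hv : IsSolution q w (conj lam) v)
    (h : ∀ i, v 0 i = conj (u 0 i)) : w.MemL2 u ↔ w.MemL2 v := by
  obtain ⟨m, M, hm, hmM⟩ := htau
  have him' : (conj lam).im ≠ 0 := by rwa [Complex.conj_im, neg_ne_zero]
  rw [hu.memL2_iff hq hw him hlam, hv.memL2_iff hq hw him' (conj_notMem_badSet hq hw hlam)]
  have hV : ∀ x ∈ openInt b, |boundaryForm (Function.leftLim v x)| * ‖tau q w x lam‖ ^ 2 =
      |boundaryForm (Function.leftLim u x)| := by
    intro x hx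
    have h1 : ‖tau q w x lam‖ ≠ 0 := (hm.trans_le (hmM x hx).1).ne'
    rw [hu.leftLim_conj hq hw hlam hv h hx, boundaryForm_conj_mul, norm_inv, abs_neg, abs_mul,
      abs_of_nonneg (sq_nonneg _)]
    field_simp
  constructor
  · rintro ⟨C, hC⟩
    refine ⟨C / m ^ 2, fun x hx => ?_⟩
    rw [le_div_iff₀ (by positivity)]
    refine le_trans ?_ (hC x hx)
    rw [← hV x hx]
    gcongr
    exact (hmM x hx).1
  · rintro ⟨C, hC⟩
    refine ⟨C * M ^ 2, fun x hx => ?_⟩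
    rw [← hV x hx]
    gcongr
    · exact (abs_nonneg _).trans (hC x hx)
    · exact hC x hx
    · exact (hmM x hx).2

theorem zero (hb : 0 < b) (hq : q.IsHermitian) (hw : w.IsNonneg) (hlam : lam ∉ badSet q w) :
    IsSolution q w lam 0 :=
  isSolution_of_isVolterra (ξ := 0) (V := 0)
    (fun c D => ⟨fun i => by simp, fun x _ i => by simp [cumInt]⟩) rfl
    (fun t _ => by simp [balance]) hb hq hw hlam

/-- Linearity is read off from the Volterra equation, which avoids additivity of one-sided limits
and of Stieltjes measures. -/
theorem add (hb : 0 < b) (hq : q.IsHermitian) (hw : w.IsNonneg) (hlam : lam ∉ badSet q w)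
    (hu : IsSolution q w lam u) (hv : IsSolution q w lam v) : IsSolution q w lam (u + v) := by
  refine isSolution_of_isVolterra (fun c D => (hu.isVolterra hlam D).add (hv.isVolterra hlam D))
    rfl (fun t ht => ?_) hb hq hw hlam
  rw [Pi.add_apply, hu.eq_balance hq hw hlam ht, hv.eq_balance hq hw hlam ht, balance, balance,
    balance, Pi.add_apply, mulVec_add, smul_add]
  abel

theorem smul (hb : 0 < b) (hq : q.IsHermitian) (hw : w.IsNonneg) (hlam : lam ∉ badSet q w)
    (a : ℂ) (hu : IsSolution q w lam u) : IsSolution q w lam (a • u) := by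
  refine isSolution_of_isVolterra (fun c D => (hu.isVolterra hlam D).smul a)
    rfl (fun t ht => ?_) hb hq hw hlam
  rw [Pi.smul_apply, hu.eq_balance hq hw hlam ht, balance, balance, Pi.smul_apply, mulVec_smul,
    smul_add, smul_comm a (1 / 2 : ℂ)]

theorem sum (hb : 0 < b) (hq : q.IsHermitian) (hw : w.IsNonneg) (hlam : lam ∉ badSet q w)
    {ι : Type*} (s : Finset ι) {u : ι → ℝ → Fin 2 → ℂ} (hu : ∀ k, IsSolution q w lam (u k))
    (a : ι → ℂ) : IsSolution q w lam (∑ k ∈ s, a k • u k) := by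
  classical
  induction s using Finset.induction_on with
  | empty => exact zero hb hq hw hlam
  | insert k s hk ih =>
    rw [Finset.sum_insert hk]
    exact ((hu k).smul hb hq hw hlam (a k)).add hb hq hw hlam ih

end IsSolution

/-- A condition on the squared norm that is preserved under linear combinations. -/
structure IsLinearCondition (P : ENNReal → Prop) : Prop where
  zero : P 0
  add : ∀ r s t, P s → P t → r ≤ 2 * s + 2 * t → P r
  smul : ∀ r s (a : ℝ), P s → r ≤ ENNReal.ofReal a * s → P r

theorem isLinearCondition_lt_top : IsLinearCondition (· < ⊤) where
  zero := ENNReal.zero_lt_top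
  add _ _ _ hs ht h := h.trans_lt (ENNReal.add_lt_top.2
    ⟨ENNReal.mul_lt_top (by simp) hs, ENNReal.mul_lt_top (by simp) ht⟩)
  smul _ _ _ hs h := h.trans_lt (ENNReal.mul_lt_top ENNReal.ofReal_lt_top hs)

theorem isLinearCondition_eq_zero : IsLinearCondition (· = 0) where
  zero := rfl
  add _ _ _ hs ht h := by simpa [hs, ht] using h
  smul _ _ _ hs h := by simpa [hs] using h

/-! ### Deficiency indices as dimensions of spaces of initial values -/

section InitialValues

variable (hb : 0 < b) (hq : q.IsHermitian) (hw : w.IsNonneg) (hlam : lam ∉ badSet q w)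

/-- The initial values of the solutions whose squared norm satisfies `P`. -/
def initialValues {P : ENNReal → Prop} (hP : IsLinearCondition P) : Submodule ℂ (Fin 2 → ℂ) where
  carrier := {ξ | ∃ u, IsSolution q w lam u ∧ P (w.normSq u) ∧ u 0 = ξ}
  zero_mem' := by
    have h := IsSolution.zero hb hq hw hlam
    have h0 := normSq_smul_le (mu := 0) (u := 0) hq hw h.locallyBoundedVariation
      (by simpa using h.locallyBoundedVariation)
    rw [smul_zero, map_zero, ENNReal.ofReal_zero, zero_mul, nonpos_iff_eq_zero] at h0
    exact ⟨0, h, h0 ▸ hP.zero, rfl⟩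
  add_mem' := by
    rintro _ _ ⟨u, hu, hPu, rfl⟩ ⟨v, hv, hPv, rfl⟩
    have huv := hu.add hb hq hw hlam hv
    exact ⟨u + v, huv, hP.add _ _ _ hPu hPv (normSq_add_le hq hw hu.locallyBoundedVariation
      hv.locallyBoundedVariation huv.locallyBoundedVariation), rfl⟩
  smul_mem' := by
    rintro a _ ⟨u, hu, hPu, rfl⟩
    have hau := hu.smul hb hq hw hlam a
    exact ⟨a • u, hau, hP.smul _ _ _ hPu (normSq_smul_le hq hw hu.locallyBoundedVariation
      hau.locallyBoundedVariation), rfl⟩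

/-- The initial values of the solutions of finite norm. -/
abbrev finiteInitialValues : Submodule ℂ (Fin 2 → ℂ) :=
  initialValues hb hq hw hlam isLinearCondition_lt_top

/-- The initial values of the solutions of norm `0`. -/
abbrev nullInitialValues : Submodule ℂ (Fin 2 → ℂ) :=
  initialValues hb hq hw hlam isLinearCondition_eq_zero

theorem nullInitialValues_le_finiteInitialValues :
    nullInitialValues hb hq hw hlam ≤ finiteInitialValues hb hq hw hlam := by
  rintro _ ⟨u, hu, h0, rfl⟩
  exact ⟨u, hu, h0 ▸ ENNReal.zero_lt_top, rfl⟩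

/-- Null solutions do not see the spectral parameter. Used in both directions this gives equality of
the null spaces for $\lambda$ and $\bar\lambda$. -/
theorem nullInitialValues_le {mu : ℂ} (hmu : mu ∉ badSet q w) :
    nullInitialValues hb hq hw hlam ≤ nullInitialValues hb hq hw hmu := by
  rintro _ ⟨u, hu, h0, rfl⟩
  exact ⟨u, hu.of_normSq_eq_zero hq hw h0, h0, rfl⟩

/-- A solution is determined on $(0,b)$ by its initial value, so having norm $0$ is a property of
the initial value alone. -/
theorem normSq_sum_eq_zero_iff {n : ℕ} {u : Fin n → ℝ → Fin 2 → ℂ}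
    (hu : ∀ k, IsSolution q w lam (u k)) (a : Fin n → ℂ) :
    w.normSq (fun x => ∑ k, a k • u k x) = 0 ↔
      ∑ k, a k • u k 0 ∈ nullInitialValues hb hq hw hlam := by
  have hs : (fun x => ∑ k, a k • u k x) = ∑ k, a k • u k := by
    ext x i
    simp [Finset.sum_apply]
  have hsol := IsSolution.sum hb hq hw hlam Finset.univ hu a
  rw [← hs] at hsol
  constructor
  · exact fun h => ⟨_, hsol, h, rfl⟩
  · rintro ⟨z, hz, h0, hz0⟩
    rw [← h0]
    exact normSq_congr hq hw hsol.locallyBoundedVariation hz.locallyBoundedVariation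
      (hsol.eqOn hq hw hlam hz hz0.symm)

/-- Initial values of solutions of finite norm modulo those of solutions of norm `0`. -/
abbrev deficiencySpace : Type :=
  finiteInitialValues hb hq hw hlam ⧸
    (nullInitialValues hb hq hw hlam).submoduleOf (finiteInitialValues hb hq hw hlam)

theorem sum_smul_mk_eq_zero_iff {n : ℕ} {u : Fin n → ℝ → Fin 2 → ℂ}
    (hu : ∀ k, IsSolution q w lam (u k)) (f : Fin n → finiteInitialValues hb hq hw hlam)
    (hf : ∀ k, (f k : Fin 2 → ℂ) = u k 0) (a : Fin n → ℂ) :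
    ∑ k, a k • (Submodule.Quotient.mk (f k) : deficiencySpace hb hq hw hlam) = 0 ↔
      w.normSq (fun x => ∑ k, a k • u k x) = 0 := by
  rw [normSq_sum_eq_zero_iff hb hq hw hlam hu]
  have h : ∑ k, a k • (Submodule.Quotient.mk (f k) : deficiencySpace hb hq hw hlam) =
      Submodule.Quotient.mk (∑ k, a k • f k) := by
    simp only [← Submodule.mkQ_apply, map_sum, map_smul]
  rw [h, Submodule.Quotient.mk_eq_zero, Submodule.submoduleOf,
    Submodule.mem_comap]
  simp [hf]

/-- Independence modulo null solutions is linear independence in the quotient space, and independent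
families there lift to solutions. -/
theorem exists_independent_iff (n : ℕ) : (∃ u : Fin n → ℝ → Fin 2 → ℂ,
      (∀ k, IsSolution q w lam (u k) ∧ w.MemL2 (u k)) ∧
      ∀ a : Fin n → ℂ, w.normSq (fun x => ∑ k, a k • u k x) = 0 → a = 0) ↔
    n ≤ Module.finrank ℂ (deficiencySpace hb hq hw hlam) := by
  constructor
  · rintro ⟨u, hu, hind⟩
    let f : Fin n → finiteInitialValues hb hq hw hlam := fun k =>
      ⟨u k 0, u k, (hu k).1, (hu k).2, rfl⟩
    have hli : LinearIndependent ℂ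
        fun k => (Submodule.Quotient.mk (f k) : deficiencySpace hb hq hw hlam) :=
      Fintype.linearIndependent_iff.2 fun a ha => congrFun (hind a
        ((sum_smul_mk_eq_zero_iff hb hq hw hlam (fun k => (hu k).1) f (fun _ => rfl) a).1 ha))
    simpa using hli.fintype_card_le_finrank
  · intro hn
    obtain ⟨g, hg⟩ := exists_linearIndependent_of_le_finrank hn
    choose f hf using fun k => Submodule.Quotient.mk_surjective _ (g k)
    choose u hu hP h0 using fun k => (f k).2
    refine ⟨u, fun k => ⟨hu k, hP k⟩, fun a ha => ?_⟩
    rw [← sum_smul_mk_eq_zero_iff hb hq hw hlam hu f (fun k => (h0 k).symm)] at ha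
    simp only [hf] at ha
    exact funext (Fintype.linearIndependent_iff.1 hg a ha)

theorem deficiencyIndex_eq :
    deficiencyIndex q w lam = Module.finrank ℂ (deficiencySpace hb hq hw hlam) := by
  rw [deficiencyIndex]
  simp only [exists_independent_iff hb hq hw hlam]
  exact le_antisymm (iSup₂_le fun n hn => by exact_mod_cast hn)
    (le_iSup₂ (f := fun (n : ℕ) (_ : n ≤ _) => (n : ℕ∞)) _ le_rfl)

theorem finrank_deficiencySpace : Module.finrank ℂ (deficiencySpace hb hq hw hlam) +
    Module.finrank ℂ (nullInitialValues hb hq hw hlam) =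
      Module.finrank ℂ (finiteInitialValues hb hq hw hlam) := by
  rw [← (Submodule.submoduleOfEquivOfLe
    (nullInitialValues_le_finiteInitialValues hb hq hw hlam)).finrank_eq]
  exact Submodule.finrank_quotient_add_finrank _

theorem conj_mem_finiteInitialValues_iff (him : lam.im ≠ 0)
    (htau : ∃ m M : ℝ, 0 < m ∧ ∀ x ∈ openInt b, m ≤ ‖tau q w x lam‖ ∧ ‖tau q w x lam‖ ≤ M)
    (hlam' : conj lam ∉ badSet q w) (ξ : Fin 2 → ℂ) :
    star ξ ∈ finiteInitialValues hb hq hw hlam' ↔ ξ ∈ finiteInitialValues hb hq hw hlam := by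
  constructor
  · rintro ⟨v, hv, hP, h0⟩
    obtain ⟨u, hu, huv⟩ := hv.exists_conj hb hq hw hlam'
    rw [Complex.conj_conj] at hu
    have h1 : ∀ i, v 0 i = conj (u 0 i) := fun i => by rw [huv, Complex.conj_conj]
    refine ⟨u, hu, (hu.memL2_conj_iff hq hw him hlam htau hv h1).2 hP, ?_⟩
    ext i
    rw [huv, h0, Pi.star_apply, Complex.star_def, Complex.conj_conj]
  · rintro ⟨u, hu, hP, rfl⟩
    obtain ⟨v, hv, huv⟩ := hu.exists_conj hb hq hw hlam
    exact ⟨v, hv, (hu.memL2_conj_iff hq hw him hlam htau hv huv).1 hP, funext huv⟩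

/-- Conjugate-linear images of subspaces have the same dimension. -/
theorem Submodule.finrank_eq_of_star_mem_iff {ι : Type*} {A B : Submodule ℂ (ι → ℂ)}
    (h : ∀ ξ, star ξ ∈ B ↔ ξ ∈ A) : Module.finrank ℂ A = Module.finrank ℂ B := by
  let j : A ≃+ B :=
    { toFun := fun ξ => ⟨star ξ.1, (h _).2 ξ.2⟩
      invFun := fun ξ => ⟨star ξ.1, (h _).1 (by rw [star_star]; exact ξ.2)⟩
      left_inv := fun ξ => Subtype.ext (star_star ξ.1)
      right_inv := fun ξ => Subtype.ext (star_star ξ.1)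
      map_add' := fun ξ η => Subtype.ext (star_add ξ.1 η.1) }
  -- The bijection is only conjugate-linear, so ranks are compared along the automorphism of the
  -- scalars given by conjugation.
  refine congrArg Cardinal.toNat (rank_eq_of_equiv_equiv (starRingEnd ℂ) j
    (starRingAut (R := ℂ)).bijective fun r m => Subtype.ext ?_)
  exact star_smul r m.1

end InitialValues

end

end

theorem lemma2p3 {b : EReal} (hb : 0 < b) (q w : LocalMatrixMeasure b)
    (hq : q.IsHermitian) (hw : w.IsNonneg)
    (lam : ℂ) (him : lam.im ≠ 0) (hlam : lam ∉ badSet q w)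
    (htau : ∃ m M : ℝ, 0 < m ∧ ∀ x ∈ openInt b, m ≤ ‖tau q w x lam‖ ∧ ‖tau q w x lam‖ ≤ M) :
    (∀ u v : ℝ → Fin 2 → ℂ, IsSolution q w lam u → IsSolution q w (conj lam) v →
      (∀ i, v 0 i = conj (u 0 i)) → (w.MemL2 u ↔ w.MemL2 v)) ∧
    deficiencyIndex q w lam = deficiencyIndex q w (conj lam) := by
  refine ⟨fun u v hu hv h => hu.memL2_conj_iff hq hw him hlam htau hv h, ?_⟩
  have hlam' := conj_notMem_badSet hq hw hlam
  rw [deficiencyIndex_eq hb hq hw hlam, deficiencyIndex_eq hb hq hw hlam']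
  have h1 := finrank_deficiencySpace hb hq hw hlam
  have h2 := finrank_deficiencySpace hb hq hw hlam'
  have h3 := Submodule.finrank_eq_of_star_mem_iff
    (conj_mem_finiteInitialValues_iff hb hq hw hlam him htau hlam')
  -- The two finite-norm spaces have equal dimension by `h3` and the null spaces coincide, so the
  -- quotients have equal dimension.
  have h4 : Module.finrank ℂ (nullInitialValues hb hq hw hlam') =
      Module.finrank ℂ (nullInitialValues hb hq hw hlam) := by
    rw [le_antisymm (nullInitialValues_le hb hq hw hlam' hlam)
      (nullInitialValues_le hb hq hw hlam hlam')]
  norm_cast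
  omega
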